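/- Let $\nu\in\mathbb R$ and $D=\{u=(u^1,u^2,u^3)\in\mathbb R^3:\ -\nu<u^1<u^2<u^3\}$. Put $R(\lambda)=(\lambda+\nu)(\lambda-u^1)(\lambda-u^2)(\lambda-u^3)$, let $\oint_a\frac{p(\lambda)\,d\lambda}{\sqrt{R(\lambda)}}=2\int_{u^1}^{u^2}\frac{p(\lambda)\,d\lambda}{\sqrt{R(\lambda)}}$ and $I_k=\oint_a\frac{\lambda^k d\lambda}{\sqrt{R(\lambda)}}$. The speeds of the Camassa--Holm modulation (Whitham) equations $\partial_tu^i+C^i(u)\,\partial_xu^i=0$ are $$C^i=\frac{\partial_{u^i}\omega}{\partial_{u^i}k},\qquad k=2\pi\Big(\oint_a\frac{(\lambda+\nu)\,d\lambda}{\sqrt{R(\lambda)}}\Big)^{-1},\qquad \omega=(2\nu+u^1+u^2+u^3)\,k .$$ Let $P_1(\lambda)=\lambda-\frac{I_1}{I_0}$, $P_2(\lambda)=\lambda^2-\frac12(u^1+u^2+u^3-\nu)\lambda+\gamma_2$ with $\gamma_2=-\frac{I_2}{I_0}+\frac12(u^1+u^2+u^3-\nu)\frac{I_1}{I_0}$,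 and $$\sigma_1=\frac{P_1(\lambda)\,d\lambda}{\sqrt{R(\lambda)}},\qquad \Omega_\nu=\frac{P_\nu(\lambda)\,d\lambda}{\sqrt{R(\lambda)}\sqrt{(-\nu-u^1)(-\nu-u^2)(-\nu-u^3)}},\qquad P_\nu(\lambda)=-\frac{(\nu+u^1)(\nu+u^2)(\nu+u^3)}{2(\lambda+\nu)}+P_2(-\nu).$$ Define the diagonal metric $$g_{ii}(u)=-4(u^i+\nu)\,\frac{\operatorname{Res}_{\lambda=u^i}\big\{\Omega_\nu(\lambda)^2/d\lambda\big\}}{\operatorname{Res}_{\lambda=-\nu}\big\{\sigma_1(\lambda)^2/d\lambda\big\}},\qquad i=1,2,3 .$$ For a metric $g$, $R^{ij}{}_{kl}=g^{jm}R^i{}_{mkl}$ with $R^i{}_{jkl}=\partial_k\Gamma^i_{lj}-\partial_l\Gamma^i_{kj}+\Gamma^i_{km}\Gamma^m_{lj}-\Gamma^i_{lm}\Gamma^m_{kj}$, so that for a diagonal metric $R^{ij}{}_{ij}$ ($i\ne j$) is the sectional curvature. It changes sign when $g$ is replaced by $-g$. On $D$ one has $\partial_{u^i}k\ne0$, the $C^i$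 are smooth, the $g_{ii}$ are real, smooth and nowhere zero, and: 1. For $i\neq j$, $\ \partial_{u^j}C^i=(C^j-C^i)\,\partial_{u^j}\log\sqrt{|g_{ii}|}$, that is, $\frac{\partial_{u^j}C^i}{C^j-C^i}=\partial_{u^j}\log\sqrt{|g_{ii}|}$ wherever $C^i\ne C^j$. 2. These relations determine $g_{ii}$ exactly up to multiplication by an arbitrary function of $u^i$: nowhere vanishing $C^1$ functions $h_{11},h_{22},h_{33}$ on $D$ satisfy them in place of the $g_{ii}$ if and only if $h_{ii}(u)=f_i(u^i)\,g_{ii}(u)$ for some functions $f_i$ of one variable. 3. The metrics $g_{ii}$ and $\frac{g_{ii}}{2(u^i+\nu)}$ are flat. 4. The metric $\frac{g_{ii}}{4(u^i+\nu)^2}$ has constant curvature $R^{ij}{}_{ij}=1$; equivalently, $-\frac{g_{ii}}{4(u^i+\nu)^2}$ has constant curvature $R^{ij}{}_{ij}=-1$. 5. The metric $\frac{g_{ii}}{8(u^i+\nu)^3}$ is (locally) conformally flat, with $R^{ij}{}_{ij}=C^i+C^j+2\nu$; equivalently, $-\frac{g_{ii}}{8(u^i+\nu)^3}$ has $R^{ij}{}_{ij}=-C^i-C^j-2\nu$.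 In 4 and 5, $i\ne j$, and all components of the curvature tensor other than $R^{ij}{}_{ij}=-R^{ij}{}_{ji}$ vanish. 6. The pencil formed by the metrics $g_{ii}$ and $\frac{g_{ii}}{u^i+\nu}$ is flat: for every real $\lambda$ the metric with contravariant components $g^{ii}+\lambda\,(u^i+\nu)\,g^{ii}$, where $g^{ii}=1/g_{ii}$, is flat on the part of $D$ where it is nondegenerate. 7. None of the four metrics $g_{ii}$, $\frac{g_{ii}}{2(u^i+\nu)}$, $\frac{g_{ii}}{4(u^i+\nu)^2}$, $\frac{g_{ii}}{8(u^i+\nu)^3}$ is of Egorov type on any nonempty open subset of $D$; here a diagonal metric $h_{ii}$ is of Egorov type if its rotation coefficients $r_{ij}=\partial_{u^i}\sqrt{h_{jj}}\,/\sqrt{h_{ii}}$ satisfy $r_{ij}=r_{ji}$ for all $i\ne j$. -/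

import Mathlib

noncomputable section

namespace CHWhitham

open Filter Topology

/- ### Differential geometry in coordinates -/

/-- The partial derivative of `f` with respect to the `i`-th coordinate, at `u`. -/
def pd {n : ℕ} {F : Type*} [NormedAddCommGroup F] [NormedSpace ℝ F]
    (i : Fin n) (f : (Fin n → ℝ) → F) (u : Fin n → ℝ) : F :=
  lineDeriv ℝ f u (Pi.single i 1)

/-- `G` is the matrix of components `g_{ij}` of a smooth (pseudo-Riemannian, possibly indefinite)
metric on the set `U`. -/
structure IsMetricOn {n : ℕ} (U : Set (Fin n → ℝ))
    (G : (Fin n → ℝ) → Matrix (Fin n) (Fin n) ℝ) : Prop where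
  smooth : ∀ i j, ContDiffOn ℝ (⊤ : ℕ∞) (fun u => G u i j) U
  symm : ∀ u ∈ U, (G u).IsSymm
  nondeg : ∀ u ∈ U, (G u).det ≠ 0

/-- The Christoffel symbol `Γ^i_{jk}` of the Levi-Civita connection of `G`. -/
def christoffel {n : ℕ} (G : (Fin n → ℝ) → Matrix (Fin n) (Fin n) ℝ) (i j k : Fin n)
    (u : Fin n → ℝ) : ℝ :=
  (1 / 2) * ∑ m, (G u)⁻¹ i m *
    (pd j (fun v => G v m k) u + pd k (fun v => G v m j) u - pd m (fun v => G v j k) u)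

/-- The Riemann tensor
`R^i_{jkl} = ∂_k Γ^i_{lj} - ∂_l Γ^i_{kj} + Γ^i_{km} Γ^m_{lj} - Γ^i_{lm} Γ^m_{kj}`. -/
def riemann {n : ℕ} (G : (Fin n → ℝ) → Matrix (Fin n) (Fin n) ℝ) (i j k l : Fin n)
    (u : Fin n → ℝ) : ℝ :=
  pd k (christoffel G i l j) u - pd l (christoffel G i k j) u
    + ∑ m, (christoffel G i k m u * christoffel G m l j u
      - christoffel G i l m u * christoffel G m k j u)

/-- The curvature tensor with raised index, `R^{ij}_{kl} = g^{jm} R^i_{mkl}`. With this sign,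
`R^{ij}_{ij}` (`i ≠ j`, no summation, diagonal metric) is the sectional curvature of the
coordinate plane `(i, j)`; it is `+1` for the unit sphere. -/
def curvature {n : ℕ} (G : (Fin n → ℝ) → Matrix (Fin n) (Fin n) ℝ) (i j k l : Fin n)
    (u : Fin n → ℝ) : ℝ :=
  ∑ m, (G u)⁻¹ j m * riemann G i m k l u

/-- `G` is a flat metric on `U`. -/
def IsFlatOn {n : ℕ} (U : Set (Fin n → ℝ))
    (G : (Fin n → ℝ) → Matrix (Fin n) (Fin n) ℝ) : Prop :=
  IsMetricOn U G ∧ ∀ u ∈ U, ∀ i j k l, riemann G i j k l u = 0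

/-- `G` is a metric on `U` whose curvature tensor is
`R^{ij}_{kl} = K_{ij} (δ^i_k δ^j_l - δ^i_l δ^j_k)`; that is, `R^{ij}_{ij} = -R^{ij}_{ji} = K_{ij}`
for `i ≠ j`, and all the other components vanish. -/
def HasDiagonalCurvatureOn {n : ℕ} (U : Set (Fin n → ℝ))
    (G : (Fin n → ℝ) → Matrix (Fin n) (Fin n) ℝ) (K : Fin n → Fin n → (Fin n → ℝ) → ℝ) : Prop :=
  IsMetricOn U G ∧ ∀ u ∈ U, ∀ i j k l,
    curvature G i j k l u =
      K i j u * ((if i = k ∧ j = l then 1 else 0) - (if i = l ∧ j = k then 1 else 0))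

/-- `G` is a metric of constant curvature `c` on `U`. -/
def HasConstantCurvatureOn {n : ℕ} (U : Set (Fin n → ℝ))
    (G : (Fin n → ℝ) → Matrix (Fin n) (Fin n) ℝ) (c : ℝ) : Prop :=
  HasDiagonalCurvatureOn U G (fun _ _ _ => c)

/-- `G` is a conformally flat metric on `U`: around each point it becomes flat after
multiplication by a positive smooth function. -/
def IsConformallyFlatOn {n : ℕ} (U : Set (Fin n → ℝ))
    (G : (Fin n → ℝ) → Matrix (Fin n) (Fin n) ℝ) : Prop :=
  IsMetricOn U G ∧ ∀ p ∈ U, ∃ V ⊆ U, IsOpen V ∧ p ∈ V ∧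
    ∃ φ : (Fin n → ℝ) → ℝ, ContDiffOn ℝ (⊤ : ℕ∞) φ V ∧ (∀ u ∈ V, 0 < φ u) ∧
      IsFlatOn V (fun u => φ u • G u)

/-- The diagonal metric with covariant components `h_{ii} = h i`. -/
def diag {n : ℕ} (h : Fin n → (Fin n → ℝ) → ℝ) (u : Fin n → ℝ) : Matrix (Fin n) (Fin n) ℝ :=
  Matrix.diagonal fun i => h i u

/-- The pencil of contravariant metrics `g_1^{ij} + t g_2^{ij}`, where `G₁`, `G₂` are the
covariant components of `g_1`, `g_2`. -/
def contraPencil {n : ℕ} (G₁ G₂ : (Fin n → ℝ) → Matrix (Fin n) (Fin n) ℝ) (t : ℝ)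
    (u : Fin n → ℝ) : Matrix (Fin n) (Fin n) ℝ :=
  (G₁ u)⁻¹ + t • (G₂ u)⁻¹

/-- The pencil of metrics `g_1^{ij} + t g_2^{ij}` is flat: for every real `t`, it is
a flat metric on the part of `U` where it is nondegenerate. -/
def IsFlatPencilOn {n : ℕ} (U : Set (Fin n → ℝ))
    (G₁ G₂ : (Fin n → ℝ) → Matrix (Fin n) (Fin n) ℝ) : Prop :=
  ∀ t : ℝ, IsFlatOn {u ∈ U | (contraPencil G₁ G₂ t u).det ≠ 0}
    (fun u => (contraPencil G₁ G₂ t u)⁻¹)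

/-- The rotation coefficient `r_{ij} = ∂_i √h_{jj} / √h_{ii}` of a diagonal metric. The metric may
be indefinite, so the roots are complex. -/
def rotation {n : ℕ} (h : Fin n → (Fin n → ℝ) → ℝ) (i j : Fin n) (u : Fin n → ℝ) : ℂ :=
  pd i (fun v => Complex.sqrt (h j v : ℂ)) u / Complex.sqrt (h i u : ℂ)

/-- The diagonal metric `h` is of Egorov type on `U`: its rotation coefficients are symmetric. -/
def IsEgorovOn {n : ℕ} (U : Set (Fin n → ℝ)) (h : Fin n → (Fin n → ℝ) → ℝ) : Prop :=
  ∀ u ∈ U, ∀ i j, i ≠ j → rotation h i j u = rotation h j i u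

/-- Tsarev's relations `∂_j C^i / (C^j - C^i) = ∂_j log √|h_{ii}|`, `i ≠ j`, multiplied by
`C^j - C^i`, so that they make sense where two speeds coincide. -/
def TsarevOn {n : ℕ} (U : Set (Fin n → ℝ)) (C h : Fin n → (Fin n → ℝ) → ℝ) : Prop :=
  ∀ u ∈ U, ∀ i j, i ≠ j →
    pd j (C i) u = (C j u - C i u) * pd j (fun v => Real.log (Real.sqrt |h i v|)) u

/- ### The elliptic curve and its differentials -/

/-- The region `-ν < u¹ < u² < u³`. -/
def region (ν : ℝ) : Set (Fin 3 → ℝ) :=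
  {u | -ν < u 0 ∧ u 0 < u 1 ∧ u 1 < u 2}

/-- `R(x) = (x + ν)(x - u¹)(x - u²)(x - u³)`. -/
def curveR (ν : ℝ) (u : Fin 3 → ℝ) (x : ℝ) : ℝ :=
  (x + ν) * (x - u 0) * (x - u 1) * (x - u 2)

/-- The integral `∮_a p(x) dx / √R(x)` over the cycle `a` that encircles the cut `[u¹, u²]`,
on which `R` is nonnegative: twice the integral from `u¹` to `u²`. -/
def aPeriod (ν : ℝ) (u : Fin 3 → ℝ) (p : ℝ → ℝ) : ℝ :=
  2 * ∫ x in (u 0)..(u 1), p x / Real.sqrt (curveR ν u x)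

/-- `I_k = ∮_a x^k dx / √R(x)`. -/
def periodI (ν : ℝ) (u : Fin 3 → ℝ) (k : ℕ) : ℝ :=
  aPeriod ν u (fun x => x ^ k)

/-- The wave number `k = 2π (∮_a (x + ν) dx / √R(x))⁻¹`. -/
def waveNumber (ν : ℝ) (u : Fin 3 → ℝ) : ℝ :=
  2 * Real.pi * (aPeriod ν u (fun x => x + ν))⁻¹

/-- The frequency `ω = (2ν + u¹ + u² + u³) k`. -/
def frequency (ν : ℝ) (u : Fin 3 → ℝ) : ℝ :=
  (2 * ν + u 0 + u 1 + u 2) * waveNumber ν u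

/-- The speeds `C^i = ∂_i ω / ∂_i k`. -/
def speed (ν : ℝ) (i : Fin 3) (u : Fin 3 → ℝ) : ℝ :=
  pd i (frequency ν) u / pd i (waveNumber ν) u

/-- `γ₁ = -I₁ / I₀`. -/
def gammaOne (ν : ℝ) (u : Fin 3 → ℝ) : ℝ :=
  -periodI ν u 1 / periodI ν u 0

/-- `γ₂ = -I₂ / I₀ + ½ (u¹ + u² + u³ - ν) I₁ / I₀`. -/
def gammaTwo (ν : ℝ) (u : Fin 3 → ℝ) : ℝ :=
  -periodI ν u 2 / periodI ν u 0
    + (1 / 2) * (u 0 + u 1 + u 2 - ν) * (periodI ν u 1 / periodI ν u 0)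

/-- `P₁(z) = z + γ₁`. -/
def polyOne (ν : ℝ) (u : Fin 3 → ℝ) (z : ℂ) : ℂ :=
  z + (gammaOne ν u : ℂ)

/-- `P₂(z) = z² - ½ (u¹ + u² + u³ - ν) z + γ₂`. -/
def polyTwo (ν : ℝ) (u : Fin 3 → ℝ) (z : ℂ) : ℂ :=
  z ^ 2 - (1 / 2) * ((u 0 : ℂ) + u 1 + u 2 - ν) * z + (gammaTwo ν u : ℂ)

/-- `P_ν(z) = -(ν + u¹)(ν + u²)(ν + u³) / (2 (z + ν)) + P₂(-ν)`. -/
def fracNu (ν : ℝ) (u : Fin 3 → ℝ) (z : ℂ) : ℂ :=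
  -((ν + u 0 : ℂ) * (ν + u 1) * (ν + u 2)) / (2 * (z + ν)) + polyTwo ν u (-ν : ℂ)

/-- `R` at a complex point. -/
def curveRC (ν : ℝ) (u : Fin 3 → ℝ) (z : ℂ) : ℂ :=
  (z + ν) * (z - u 0) * (z - u 1) * (z - u 2)

/-- The coefficient `P₁ / √R` of `dz` in `σ₁`. Only its square is used below, which
does not depend on the branch of the root. -/
def sigmaOne (ν : ℝ) (u : Fin 3 → ℝ) (z : ℂ) : ℂ :=
  polyOne ν u z / Complex.sqrt (curveRC ν u z)

/-- The coefficient `P_ν / (√R √((-ν - u¹)(-ν - u²)(-ν - u³)))` of `dz` in `Ω_ν`. Only its square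
is used below, which does not depend on the branches of the roots. -/
def omegaNu (ν : ℝ) (u : Fin 3 → ℝ) (z : ℂ) : ℂ :=
  fracNu ν u z /
    (Complex.sqrt (curveRC ν u z) *
      Complex.sqrt ((-ν - u 0 : ℂ) * (-ν - u 1) * (-ν - u 2)))

/-- The residue at `z₀` of `f(z) dz`: the integral of `f(z) dz / (2πi)` over small circles
around `z₀`. -/
def residue (f : ℂ → ℂ) (z₀ : ℂ) : ℂ :=
  limUnder (𝓝[>] (0 : ℝ)) fun r => (2 * Real.pi * Complex.I)⁻¹ * circleIntegral f z₀ r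

/-- The expression
`-4 (u^i + ν) Res_{z = u^i} (Ω_ν² / dz) / Res_{z = -ν} (σ₁² / dz)`. It takes
real values on the region. -/
def metricExpr (ν : ℝ) (i : Fin 3) (u : Fin 3 → ℝ) : ℂ :=
  -4 * ((u i : ℂ) + ν) *
    (residue (fun z => omegaNu ν u z ^ 2) (u i : ℂ) /
      residue (fun z => sigmaOne ν u z ^ 2) (-ν : ℂ))

/-- The metric components `g_{ii}`. -/
def chMetric (ν : ℝ) (i : Fin 3) (u : Fin 3 → ℝ) : ℝ :=
  (metricExpr ν i u).re

/-- `g_{ii} / (2 (u^i + ν))`. -/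
def chMetricTwo (ν : ℝ) (i : Fin 3) (u : Fin 3 → ℝ) : ℝ :=
  chMetric ν i u / (2 * (u i + ν))

/-- `g_{ii} / (4 (u^i + ν)²)`. -/
def chMetricThree (ν : ℝ) (i : Fin 3) (u : Fin 3 → ℝ) : ℝ :=
  chMetric ν i u / (4 * (u i + ν) ^ 2)

/-- `g_{ii} / (8 (u^i + ν)³)`. -/
def chMetricFour (ν : ℝ) (i : Fin 3) (u : Fin 3 → ℝ) : ℝ :=
  chMetric ν i u / (8 * (u i + ν) ^ 3)

end CHWhitham

end

/-! Write v_i = u^i + ν, m_k = ∮_a (x + ν)^k dx / √R, J = m_1, J_i = ∂_i J and t_i = J_i / J. The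
speeds and the metric are rational in u and the t_i. Since k = 2π / J, the speeds are C^i = 2ν + u¹
+ u² + u³ - 1/t_i (`speed_eq`). In the ratio of the two residues I₀ = m_0 and the product of the ν +
u^m cancel, which leaves g_ii = -4 ∏_{m≠i} (u^i - u^m) t_i² (`metricExpr_eq`).

The moments obey ∂_i m_{k+1} = m_k / 2 + v_i ∂_i m_k (`momentPd_succ`) and Euler's identity for
homogeneous functions (`sum_mul_momentPd`). Hence the derivatives of m_0, m_1, m_2 are rational
combinations of m_0, m_1, m_2. This gives smoothness, and the Euler–Poisson–Darboux equations ∂_j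
J_i = (J_i - J_j) / (2 (u^i - u^j)) (`hasPd_gradJ`). The signs of the J_i are fixed, so every t_i is
invertible.

It follows that ∂_j log √|g_ii| = -t_j / (2 (u^i - u^j) t_i) - t_j for j ≠ i, and differentiating
C^i yields Tsarev's relations (`hasPd_speed`). Conversely, they fix this logarithmic derivative
wherever C^i ≠ C^j. Coincidences are isolated on lines parallel to the third axis, so continuity
covers the rest (`tsarevOn_iff_exists`).

Division of g_ii by p(v_i) leaves the derivatives with j ≠ i unchanged, so all such metrics are
treated at once. They satisfy the Darboux equations, hence only the components R^{ij}_{ij} =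
-R^{ij}_{ji} can survive (`riemann_diag`). In these the unknown ∂_i t_i cancels, and for p = p0 + p1
v + p2 v² + p3 v³ an algebraic identity gives p2/4 + p3 (2 ∑ v_m - 1/t_i - 1/t_j) / 8
(`curvature_identity`, `riemann_quotMetric`). The choices p = 1, 2v, 4v², 8v³, 1 + λv give the
curvature statements and the flat pencil. Conformal flatness is a parallel computation with J_i / I₀
in place of t_i (`riemann_confMetric`).

Symmetric rotation coefficients would mean ∂_i h_j = ∂_j h_i. At a single point this becomes three
linear conditions on p, which positivity of the v_i contradicts (`egorov_coefficients`,
`not_isEgorovOn_quotMetric`). -/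

noncomputable section

namespace CHWhitham

open Filter Topology MeasureTheory

section

/-! ### Partial derivatives -/

section Partial

variable {n : ℕ} {F : Type*} [NormedAddCommGroup F] [NormedSpace ℝ F]
  {f g : (Fin n → ℝ) → ℝ} {f' g' : ℝ} {u : Fin n → ℝ} {i : Fin n}

/-- `f` has partial derivative `f'` with respect to the `i`-th coordinate at `u`. -/
abbrev HasPd (i : Fin n) (f : (Fin n → ℝ) → F) (f' : F) (u : Fin n → ℝ) : Prop :=
  HasLineDerivAt ℝ f f' u (Pi.single i 1)

theorem HasPd.pd_eq {f : (Fin n → ℝ) → F} {f' : F} (h : HasPd i f f' u) : pd i f u = f' :=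
  h.lineDeriv

theorem HasPd.congr_on {f g : (Fin n → ℝ) → F} {f' : F} {U : Set (Fin n → ℝ)} (hU : IsOpen U)
    (hu : u ∈ U) (hfg : ∀ v ∈ U, f v = g v) (h : HasPd i g f' u) : HasPd i f f' u :=
  HasLineDerivAt.congr_of_eventuallyEq h (by
    filter_upwards [hU.mem_nhds hu] with v hv using hfg v hv)

theorem pd_congr_on {f g : (Fin n → ℝ) → F} {U : Set (Fin n → ℝ)} (hU : IsOpen U)
    (hu : u ∈ U) (hfg : ∀ v ∈ U, f v = g v) : pd i f u = pd i g u := by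
  refine Filter.EventuallyEq.lineDeriv_eq ?_
  filter_upwards [hU.mem_nhds hu] with v hv using hfg v hv

theorem hasPd_of_hasFDerivAt {f : (Fin n → ℝ) → F} {f' : (Fin n → ℝ) →L[ℝ] F}
    (h : HasFDerivAt f f' u) : HasPd i f (f' (Pi.single i 1)) u :=
  h.hasLineDerivAt _

theorem hasPd_of_contDiffOn {f : (Fin n → ℝ) → F} {U : Set (Fin n → ℝ)} {m : WithTop ℕ∞}
    (hm : m ≠ 0) (hU : IsOpen U)
    (hf : ContDiffOn ℝ m f U) (hu : u ∈ U) : HasPd i f (pd i f u) u :=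
  ((hf.contDiffAt (hU.mem_nhds hu)).differentiableAt hm).lineDifferentiableAt.hasLineDerivAt

theorem hasPd_const (c : F) : HasPd i (fun _ => c) 0 u := by
  simpa [HasPd, HasLineDerivAt] using hasDerivAt_const (0 : ℝ) c

theorem hasPd_coord (i j : Fin n) (u : Fin n → ℝ) :
    HasPd i (fun v => v j) (if j = i then 1 else 0) u := by
  have h := (ContinuousLinearMap.proj (R := ℝ) (φ := fun _ : Fin n => ℝ) j).hasFDerivAt (x := u)
  have h2 := hasPd_of_hasFDerivAt (i := i) h
  rw [ContinuousLinearMap.proj_apply, Pi.single_apply] at h2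
  exact h2

theorem HasPd.add (hf : HasPd i f f' u) (hg : HasPd i g g' u) :
    HasPd i (fun v => f v + g v) (f' + g') u :=
  HasDerivAt.add hf hg

theorem HasPd.sub (hf : HasPd i f f' u) (hg : HasPd i g g' u) :
    HasPd i (fun v => f v - g v) (f' - g') u :=
  HasDerivAt.sub hf hg

theorem HasPd.neg (hf : HasPd i f f' u) : HasPd i (fun v => -f v) (-f') u :=
  HasDerivAt.neg hf

theorem HasPd.mul (hf : HasPd i f f' u) (hg : HasPd i g g' u) :
    HasPd i (fun v => f v * g v) (f' * g u + f u * g') u := by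
  have h := HasDerivAt.mul hf hg
  simp only [zero_smul, add_zero] at h
  exact h

theorem HasPd.const_mul (c : ℝ) (hf : HasPd i f f' u) :
    HasPd i (fun v => c * f v) (c * f') u :=
  HasDerivAt.const_mul c hf

theorem HasPd.pow (k : ℕ) (hf : HasPd i f f' u) :
    HasPd i (fun v => f v ^ k) (k * f u ^ (k - 1) * f') u := by
  have h := HasDerivAt.pow hf k
  simp only [zero_smul, add_zero] at h
  exact h

theorem HasPd.div (hf : HasPd i f f' u) (hg : HasPd i g g' u) (h0 : g u ≠ 0) :
    HasPd i (fun v => f v / g v) ((f' * g u - f u * g') / g u ^ 2) u := by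
  have h := HasDerivAt.div hf hg (by simpa using h0)
  simp only [zero_smul, add_zero] at h
  exact h

theorem HasPd.log (hf : HasPd i f f' u) (h0 : f u ≠ 0) :
    HasPd i (fun v => Real.log (f v)) (f' / f u) u := by
  simpa [HasPd, HasLineDerivAt] using HasDerivAt.log hf (by simpa using h0)

theorem contDiffOn_pd {U : Set (Fin n → ℝ)} (hU : IsOpen U) {f : (Fin n → ℝ) → ℝ}
    (hf : ContDiffOn ℝ (⊤ : ℕ∞) f U) (i : Fin n) : ContDiffOn ℝ (⊤ : ℕ∞) (pd i f) U := by
  have h1 : ContDiffOn ℝ (⊤ : ℕ∞) (fderiv ℝ f) U := hf.fderiv_of_isOpen hU (by simp)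
  have h2 : ContDiffOn ℝ (⊤ : ℕ∞) (fun u => fderiv ℝ f u (Pi.single i 1)) U :=
    h1.clm_apply contDiffOn_const
  refine h2.congr fun u hu => ?_
  exact (((hf.contDiffAt (hU.mem_nhds hu)).differentiableAt (by simp)).hasFDerivAt.hasLineDerivAt
    _).lineDeriv

theorem pd_comm {U : Set (Fin n → ℝ)} (hU : IsOpen U) {f : (Fin n → ℝ) → ℝ}
    (hf : ContDiffOn ℝ (⊤ : ℕ∞) f U) (hu : u ∈ U) (i j : Fin n) :
    pd i (pd j f) u = pd j (pd i f) u := by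
  have hd : ∀ v ∈ U, ∀ k, pd k f v = fderiv ℝ f v (Pi.single k 1) := fun v hv k =>
    (((hf.contDiffAt (hU.mem_nhds hv)).differentiableAt (by simp)).hasFDerivAt.hasLineDerivAt
      _).lineDeriv
  have h1 : DifferentiableAt ℝ (fderiv ℝ f) u :=
    ((hf.fderiv_of_isOpen (m := (⊤ : ℕ∞)) hU (by simp)).contDiffAt
      (hU.mem_nhds hu)).differentiableAt (by simp)
  have h2 : ∀ k l, pd k (pd l f) u = fderiv ℝ (fderiv ℝ f) u (Pi.single k 1) (Pi.single l 1) := by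
    intro k l
    have h3 : HasFDerivAt (fun v => fderiv ℝ f v (Pi.single l 1))
        ((ContinuousLinearMap.apply ℝ ℝ (Pi.single l 1)).comp (fderiv ℝ (fderiv ℝ f) u)) u :=
      HasFDerivAt.comp u (f := fderiv ℝ f) (g := fun A : (Fin n → ℝ) →L[ℝ] ℝ => A (Pi.single l 1))
        (ContinuousLinearMap.apply ℝ ℝ (Pi.single l (1 : ℝ) : Fin n → ℝ)).hasFDerivAt
        h1.hasFDerivAt
    have h4 := HasPd.congr_on (i := k) hU hu (fun v hv => hd v hv l) (hasPd_of_hasFDerivAt h3)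
    simpa using h4.pd_eq
  rw [h2, h2]
  have hs : IsSymmSndFDerivAt ℝ f u :=
    (hf.contDiffAt (hU.mem_nhds hu)).isSymmSndFDerivAt (by
      simpa using (mod_cast le_top : ((2 : ℕ∞) : WithTop ℕ∞) ≤ ((⊤ : ℕ∞) : WithTop ℕ∞)))
  exact hs _ _

end Partial

/-! ### Curvature of a diagonal metric -/

section Diagonal

variable {n : ℕ} {U : Set (Fin n → ℝ)} {h : Fin n → (Fin n → ℝ) → ℝ}

/-- The logarithmic derivative `∂_j log √|h_i|` of a metric coefficient. -/
def logPd (h : Fin n → (Fin n → ℝ) → ℝ) (i j : Fin n) (u : Fin n → ℝ) : ℝ :=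
  pd j (h i) u / (2 * h i u)

theorem diag_inv (u : Fin n → ℝ) (h0 : ∀ i, h i u ≠ 0) :
    (diag h u)⁻¹ = Matrix.diagonal fun i => (h i u)⁻¹ := by
  refine Matrix.inv_eq_right_inv ?_
  rw [diag, Matrix.diagonal_mul_diagonal, ← Matrix.diagonal_one]
  congr 1
  funext i
  exact mul_inv_cancel₀ (h0 i)

theorem isMetricOn_diag (hs : ∀ i, ContDiffOn ℝ (⊤ : ℕ∞) (h i) U)
    (h0 : ∀ u ∈ U, ∀ i, h i u ≠ 0) : IsMetricOn U (diag h) where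
  smooth i j := by
    by_cases hij : i = j
    · subst hij
      simpa [diag] using hs i
    · simpa [diag, Matrix.diagonal_apply_ne _ hij] using contDiffOn_const
  symm u _ := Matrix.isSymm_diagonal _
  nondeg u hu := by
    rw [diag, Matrix.det_diagonal]
    exact Finset.prod_ne_zero_iff.2 fun i _ => h0 u hu i

theorem pd_diag (i j m : Fin n) (u : Fin n → ℝ) :
    pd m (fun v => diag h v i j) u = if i = j then pd m (h i) u else 0 := by
  by_cases hij : i = j
  · subst hij
    simp [diag]
  · simp only [diag, Matrix.diagonal_apply_ne _ hij, if_neg hij]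
    exact (hasPd_const (0 : ℝ)).pd_eq

/-- The three Kronecker terms overlap when `i = j = k`; they then add up to a single `logPd h i i`,
so no case distinction is needed. -/
theorem christoffel_diag {u : Fin n → ℝ} (h0 : ∀ i, h i u ≠ 0) (i j k : Fin n) :
    christoffel (diag h) i j k u =
      (if i = j then logPd h i k u else 0) + (if i = k then logPd h i j u else 0)
        - (if j = k then h j u / h i u * logPd h j i u else 0) := by
  have hi := h0 i
  have hj := h0 j
  simp only [christoffel, diag_inv u h0, pd_diag, Matrix.diagonal_apply, ite_mul, zero_mul,
    Finset.sum_ite_eq, Finset.mem_univ, if_true, logPd]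
  split_ifs <;> (try subst_vars) <;> field_simp <;> ring

theorem contDiffOn_logPd (hU : IsOpen U) (hs : ∀ i, ContDiffOn ℝ (⊤ : ℕ∞) (h i) U)
    (h0 : ∀ u ∈ U, ∀ i, h i u ≠ 0) (i j : Fin n) :
    ContDiffOn ℝ (⊤ : ℕ∞) (logPd h i j) U :=
  (contDiffOn_pd hU (hs i) j).div (contDiffOn_const.mul (hs i)) fun u hu =>
    mul_ne_zero two_ne_zero (h0 u hu i)

/-- Symmetry of the second derivatives of log √|h_i|. It cancels the `i = j` derivative terms of the
Riemann tensor. -/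
theorem pd_logPd_comm (hU : IsOpen U) (hs : ∀ i, ContDiffOn ℝ (⊤ : ℕ∞) (h i) U)
    (h0 : ∀ u ∈ U, ∀ i, h i u ≠ 0) {u : Fin n → ℝ} (hu : u ∈ U) (i j k : Fin n) :
    pd k (logPd h i j) u = pd j (logPd h i k) u := by
  have key : ∀ a b, pd b (logPd h i a) u =
      (pd b (pd a (h i)) u * (2 * h i u) - pd a (h i) u * (2 * pd b (h i) u)) / (2 * h i u) ^ 2 := by
    intro a b
    refine HasPd.pd_eq (HasPd.div (g := fun u => 2 * h i u) ?_ ?_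
      (mul_ne_zero two_ne_zero (h0 u hu i)))
    · exact hasPd_of_contDiffOn (by simp) hU (contDiffOn_pd hU (hs i) a) hu
    · exact (hasPd_of_contDiffOn (by simp) hU (hs i) hu).const_mul 2
  rw [key, key, pd_comm hU (hs i) hu k j]
  ring

theorem pd_christoffel_diag (hU : IsOpen U) (hs : ∀ i, ContDiffOn ℝ (⊤ : ℕ∞) (h i) U)
    (h0 : ∀ u ∈ U, ∀ i, h i u ≠ 0) {u : Fin n → ℝ} (hu : u ∈ U) (i j k l : Fin n) :
    pd l (christoffel (diag h) i j k) u =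
      (if i = j then pd l (logPd h i k) u else 0) + (if i = k then pd l (logPd h i j) u else 0)
        - (if j = k then h j u / h i u * (pd l (logPd h j i) u
            + 2 * (logPd h j l u - logPd h i l u) * logPd h j i u) else 0) := by
  have hL : ∀ a b, HasPd l (logPd h a b) (pd l (logPd h a b) u) u := fun a b =>
    hasPd_of_contDiffOn (by simp) hU (contDiffOn_logPd hU hs h0 a b) hu
  have hh : ∀ a, HasPd l (h a) (2 * h a u * logPd h a l u) u := by
    intro a
    have := hasPd_of_contDiffOn (i := l) (by simp) hU (hs a) hu
    convert this using 1
    have := h0 u hu a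
    rw [logPd]
    field_simp
  have hite : ∀ (p : Prop) [Decidable p] (f : (Fin n → ℝ) → ℝ) (f' : ℝ), HasPd l f f' u →
      HasPd l (fun v => if p then f v else 0) (if p then f' else 0) u := by
    intro p _ f f' hf
    by_cases hp : p
    · simpa [hp] using hf
    · simpa [hp] using hasPd_const (i := l) (u := u) (0 : ℝ)
  have := (((hite (i = j) _ _ (hL i k)).add (hite (i = k) _ _ (hL i j))).sub
    (hite (j = k) _ _ (((hh j).div (hh i) (h0 u hu i)).mul (hL j i))))
  rw [(HasPd.congr_on hU hu (fun v hv => christoffel_diag (h0 v hv) i j k) this).pd_eq]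
  congr 1
  split_ifs with hjk
  · have := h0 u hu i
    field_simp
    ring
  · rfl

/-- The Riemann tensor of a diagonal metric, in terms of the logarithmic derivatives of its
coefficients. -/
theorem riemann_diag_eq (hU : IsOpen U) (hs : ∀ i, ContDiffOn ℝ (⊤ : ℕ∞) (h i) U)
    (h0 : ∀ u ∈ U, ∀ i, h i u ≠ 0) {u : Fin n → ℝ} (hu : u ∈ U) (i j k l : Fin n) :
    riemann (diag h) i j k l u =
      (if i = l then pd k (logPd h i j) u else 0) - (if i = k then pd l (logPd h i j) u else 0)
      - (if l = j then h l u / h i u * (pd k (logPd h l i) u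
            + 2 * (logPd h l k u - logPd h i k u) * logPd h l i u) else 0)
      + (if k = j then h k u / h i u * (pd l (logPd h k i) u
            + 2 * (logPd h k l u - logPd h i l u) * logPd h k i u) else 0)
      + ∑ m, (christoffel (diag h) i k m u * christoffel (diag h) m l j u
          - christoffel (diag h) i l m u * christoffel (diag h) m k j u) := by
  rw [riemann, pd_christoffel_diag hU hs h0 hu, pd_christoffel_diag hU hs h0 hu,
    pd_logPd_comm hU hs h0 hu i l k]
  ring

/-- Kronecker symbols in the first factor collapse the sum over `m`, except in its `i = k` part.
There the case `l = j` leaves a full sum, the source of the sum over all directions in the sectional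
curvature. -/
theorem sum_christoffel_mul_diag {u : Fin n → ℝ} (h0 : ∀ i, h i u ≠ 0) (i j k l : Fin n) :
    ∑ m, christoffel (diag h) i k m u * christoffel (diag h) m l j u =
      (if i = k then logPd h i l u * logPd h l j u + logPd h i j u * logPd h j l u
          - (if l = j then ∑ m, h l u / h m u * logPd h i m u * logPd h l m u else 0) else 0)
      + logPd h i k u * ((if i = l then logPd h i j u else 0)
          + (if i = j then logPd h i l u else 0)
          - (if l = j then h l u / h i u * logPd h l i u else 0))
      - h k u / h i u * logPd h k i u * ((if k = l then logPd h k j u else 0)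
          + (if k = j then logPd h k l u else 0)
          - (if l = j then h l u / h k u * logPd h l k u else 0)) := by
  simp only [christoffel_diag h0]
  have e : ∀ m : Fin n, 
      ((if i = k then logPd h i m u else 0) + (if i = m then logPd h i k u else 0)
        - (if k = m then h k u / h i u * logPd h k i u else 0)) *
      ((if m = l then logPd h m j u else 0) + (if m = j then logPd h m l u else 0)
        - (if l = j then h l u / h m u * logPd h l m u else 0)) =
      (if i = k then ((if l = m then logPd h i m u * logPd h m j u else 0)
        + (if j = m then logPd h i m u * logPd h m l u else 0)
        - (if l = j then h l u / h m u * logPd h i m u * logPd h l m u else 0)) else 0)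
      + (if i = m then logPd h i k u * ((if m = l then logPd h m j u else 0)
        + (if m = j then logPd h m l u else 0)
        - (if l = j then h l u / h m u * logPd h l m u else 0)) else 0)
      - (if k = m then h k u / h i u * logPd h k i u * ((if m = l then logPd h m j u else 0)
        + (if m = j then logPd h m l u else 0)
        - (if l = j then h l u / h m u * logPd h l m u else 0)) else 0) := by
    intro m
    simp only [show (l = m) = (m = l) from propext eq_comm,
      show (j = m) = (m = j) from propext eq_comm]
    by_cases h1 : i = k <;> by_cases h2 : i = m <;> by_cases h3 : k = m <;> 
      simp only [h1, h2, h3, if_true, if_false] <;> split_ifs <;> ring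
  rw [Finset.sum_congr rfl fun m _ => e m]
  simp only [Finset.sum_add_distrib, Finset.sum_sub_distrib, Finset.sum_ite_eq, Finset.mem_univ,
    if_true]
  by_cases h1 : i = k <;> by_cases h2 : l = j <;> 
    simp [h1, h2, Finset.sum_add_distrib, Finset.sum_sub_distrib]

/-- A diagonal metric whose coefficients satisfy the Darboux equations `∂_k β_{ij} = β_{ik} β_{kj}`
(in logarithmic form) has a curvature tensor with components `R^{ij}_{ij}` only. -/
theorem riemann_diag (hU : IsOpen U) (hs : ∀ i, ContDiffOn ℝ (⊤ : ℕ∞) (h i) U)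
    (h0 : ∀ u ∈ U, ∀ i, h i u ≠ 0) {K : Fin n → Fin n → (Fin n → ℝ) → ℝ}
    (hdarboux : ∀ u ∈ U, ∀ i j k, i ≠ j → i ≠ k → j ≠ k → pd k (logPd h i j) u =
      logPd h i j u * logPd h j k u + logPd h i k u * logPd h k j u
        - logPd h i j u * logPd h i k u)
    (hcurv : ∀ u ∈ U, ∀ i j, i ≠ j → K i j u =
      -(pd i (logPd h j i) u + logPd h j i u ^ 2 - 2 * logPd h i i u * logPd h j i u) / h i u
      - (pd j (logPd h i j) u + logPd h i j u ^ 2 - 2 * logPd h j j u * logPd h i j u) / h j u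
      - ∑ m, logPd h i m u * logPd h j m u / h m u)
    {u : Fin n → ℝ} (hu : u ∈ U) (i j k l : Fin n) :
    riemann (diag h) i j k l u = h j u * K i j u *
      ((if i = k ∧ j = l then 1 else 0) - (if i = l ∧ j = k then 1 else 0)) := by
  have hsum : ∀ a b, ∑ m, h a u / h m u * logPd h b m u * logPd h a m u =
      h a u * ∑ m, logPd h b m u * logPd h a m u / h m u := by
    intro a b
    rw [Finset.mul_sum]
    exact Finset.sum_congr rfl fun m _ => by ring
  rw [riemann_diag_eq hU hs h0 hu, Finset.sum_sub_distrib, sum_christoffel_mul_diag (h0 u hu),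
    sum_christoffel_mul_diag (h0 u hu), hsum, hsum]
  have hc := hcurv u hu
  have hd := hdarboux u hu
  have hz := h0 u hu
  rcases eq_or_ne k l with rfl | hkl
  · have : ¬(i = k ∧ j = k) ∨ (i = k ∧ j = k) := (em _).symm
    rcases this with h1 | h1 <;> simp [h1]
  rcases eq_or_ne i j with rfl | hij
  · have hzi := hz i
    rcases eq_or_ne i k with rfl | hik
    · have hzl := hz l
      simp [hkl, hkl.symm]
      field_simp
      ring
    · rcases eq_or_ne i l with rfl | hil
      · have hzk := hz k
        simp [hik, hik.symm]
        field_simp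
        ring
      · simp [hik, hik.symm, hil, hil.symm, hkl, hkl.symm]
        ring
  have hzi := hz i
  have hzj := hz j
  -- For `i ≠ j` and `k ≠ l`, the curvature equation enters only when {k, l} = {i, j}, a Darboux
  -- equation when exactly one of `k`, `l` lies in {i, j}, and nothing when neither does.
  rcases eq_or_ne i k with rfl | hik
  · rcases eq_or_ne j l with rfl | hjl
    · rw [hc i j hij]
      simp [hij, hij.symm]
      field_simp
      ring
    · have := hd i j l hij hkl hjl
      simp [hij, hij.symm, hjl, hjl.symm, hkl, hkl.symm]
      linear_combination -this
  rcases eq_or_ne j k with rfl | hjk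
  · rcases eq_or_ne i l with rfl | hil
    · rw [hc i j hij]
      simp [hij, hij.symm]
      field_simp
      ring
    · have := hd j i l hij.symm hkl hil
      have hzl := hz l
      simp [hij, hil, hkl, hkl.symm]
      field_simp
      linear_combination h j u * this
  have hzk := hz k
  rcases eq_or_ne i l with rfl | hil
  · have := hd i j k hij hik hjk
    simp [hij, hij.symm, hik, hik.symm, hjk, hjk.symm]
    linear_combination this
  rcases eq_or_ne j l with rfl | hjl
  · have := hd j i k hij.symm hjk hik
    simp [hij, hik, hjk, hjk.symm]
    field_simp
    linear_combination -h j u * this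
  simp [hij, hik, hjk, hjk.symm, hil, hjl, hjl.symm, hkl, hkl.symm]

end Diagonal

end

/-! ### Curvature criteria, congruence, and rotation coefficients -/

section

section Diagonal

variable {n : ℕ} {U : Set (Fin n → ℝ)} {h : Fin n → (Fin n → ℝ) → ℝ}

theorem hasDiagonalCurvatureOn_diag {K : Fin n → Fin n → (Fin n → ℝ) → ℝ}
    (hs : ∀ i, ContDiffOn ℝ (⊤ : ℕ∞) (h i) U) (h0 : ∀ u ∈ U, ∀ i, h i u ≠ 0)
    (hR : ∀ u ∈ U, ∀ i j k l, riemann (diag h) i j k l u = h j u * K i j u *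
      ((if i = k ∧ j = l then 1 else 0) - (if i = l ∧ j = k then 1 else 0))) :
    HasDiagonalCurvatureOn U (diag h) K := by
  refine ⟨isMetricOn_diag hs h0, fun u hu i j k l => ?_⟩
  have hj := h0 u hu j
  simp only [curvature, diag_inv u (h0 u hu), Matrix.diagonal_apply, ite_mul, zero_mul,
    Finset.sum_ite_eq, Finset.mem_univ, if_true, hR u hu]
  field_simp

theorem isFlatOn_diag {K : Fin n → Fin n → (Fin n → ℝ) → ℝ}
    (hs : ∀ i, ContDiffOn ℝ (⊤ : ℕ∞) (h i) U) (h0 : ∀ u ∈ U, ∀ i, h i u ≠ 0)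
    (hR : ∀ u ∈ U, ∀ i j k l, riemann (diag h) i j k l u = h j u * K i j u *
      ((if i = k ∧ j = l then 1 else 0) - (if i = l ∧ j = k then 1 else 0)))
    (hK : ∀ u ∈ U, ∀ i j, K i j u = 0) :
    IsFlatOn U (diag h) := by
  refine ⟨isMetricOn_diag hs h0, fun u hu i j k l => ?_⟩
  rw [hR u hu, hK u hu]
  ring

theorem riemann_congr_on {G G' : (Fin n → ℝ) → Matrix (Fin n) (Fin n) ℝ} (hU : IsOpen U)
    (hG : ∀ u ∈ U, G u = G' u) {u : Fin n → ℝ} (hu : u ∈ U) (i j k l : Fin n) :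
    riemann G i j k l u = riemann G' i j k l u := by
  have hc : ∀ v ∈ U, ∀ i j k, christoffel G i j k v = christoffel G' i j k v := by
    intro v hv i j k
    have hp : ∀ a b m, pd m (fun w => G w a b) v = pd m (fun w => G' w a b) v := fun a b m =>
      pd_congr_on hU hv fun w hw => by rw [hG w hw]
    simp only [christoffel, hp, hG v hv]
  have hp : ∀ a b c m, pd m (christoffel G a b c) u = pd m (christoffel G' a b c) u :=
    fun a b c m => pd_congr_on hU hu fun w hw => hc w hw a b c
  simp only [riemann, hp, hc u hu]

theorem IsMetricOn.congr_on {G G' : (Fin n → ℝ) → Matrix (Fin n) (Fin n) ℝ}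
    (hG : ∀ u ∈ U, G u = G' u) (h : IsMetricOn U G') : IsMetricOn U G where
  smooth i j := (h.smooth i j).congr fun u hu => by rw [hG u hu]
  symm u hu := by rw [hG u hu]; exact h.symm u hu
  nondeg u hu := by rw [hG u hu]; exact h.nondeg u hu

theorem IsFlatOn.congr_on {G G' : (Fin n → ℝ) → Matrix (Fin n) (Fin n) ℝ} (hU : IsOpen U)
    (hG : ∀ u ∈ U, G u = G' u) (h : IsFlatOn U G') : IsFlatOn U G :=
  ⟨h.1.congr_on hG, fun u hu i j k l => by
    rw [riemann_congr_on hU hG hu]; exact h.2 u hu i j k l⟩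

/-- Negative reals lie on the branch cut of the principal root, but along the real axis the sign of
`f` is locally constant. There the root is √f or i √(-f), and the real rule applies. -/
theorem hasDerivAt_complex_sqrt {f : ℝ → ℝ} {f' x : ℝ} (hf : HasDerivAt f f' x) (h0 : f x ≠ 0) :
    HasDerivAt (fun s => Complex.sqrt (f s : ℂ)) (Complex.sqrt (f x : ℂ) * (f' / (2 * f x) : ℝ)) x := by
  rcases h0.lt_or_gt with hneg | hpos
  · have he : ∀ s, f s < 0 → Complex.sqrt (f s : ℂ) = Complex.I * (Real.sqrt (-f s) : ℝ) := by
      intro s hs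
      have := Complex.sqrt_neg_of_nonneg (a := ((-f s : ℝ) : ℂ)) (by
        exact_mod_cast (neg_pos.2 hs).le)
      rw [Complex.sqrt_of_nonneg (a := ((-f s : ℝ) : ℂ))
        (by exact_mod_cast (neg_pos.2 hs).le)] at this
      simpa using this
    have h1 := ((hf.neg.sqrt (neg_ne_zero.2 h0)).ofReal_comp).const_mul Complex.I
    refine (h1.congr_of_eventuallyEq ?_).congr_deriv ?_
    · filter_upwards [hf.continuousAt.eventually (gt_mem_nhds hneg)] with s hs using he s hs
    · rw [he x hneg, mul_assoc, ← Complex.ofReal_mul]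
      congr 2
      have hs : 0 < Real.sqrt (-f x) := Real.sqrt_pos.2 (neg_pos.2 hneg)
      have hsq : Real.sqrt (-f x) ^ 2 = -f x := Real.sq_sqrt (neg_pos.2 hneg).le
      simp only [Pi.neg_apply]
      field_simp
      rw [hsq]
      ring
  · have he : ∀ s, 0 < f s → Complex.sqrt (f s : ℂ) = (Real.sqrt (f s) : ℝ) := by
      intro s hs
      rw [Complex.sqrt_of_nonneg (by exact_mod_cast hs.le)]
      simp
    have h1 := (hf.sqrt h0).ofReal_comp
    refine (h1.congr_of_eventuallyEq ?_).congr_deriv ?_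
    · filter_upwards [hf.continuousAt.eventually (lt_mem_nhds hpos)] with s hs using he s hs
    · rw [he x hpos, ← Complex.ofReal_mul]
      congr 1
      have hs : 0 < Real.sqrt (f x) := Real.sqrt_pos.2 hpos
      have hsq : Real.sqrt (f x) ^ 2 = f x := Real.sq_sqrt hpos.le
      field_simp
      rw [hsq]

/-- Symmetric rotation coefficients mean that `∂_i h_j = ∂_j h_i`. -/
theorem pd_eq_of_rotation_eq {u : Fin n → ℝ} {i j : Fin n}
    {a b : ℝ} (hi : HasPd j (h i) a u) (hj : HasPd i (h j) b u) (hi0 : h i u ≠ 0)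
    (hj0 : h j u ≠ 0) (hr : rotation h i j u = rotation h j i u) : b = a := by
  have key : ∀ (k m : Fin n) (c : ℝ), HasPd k (h m) c u → h m u ≠ 0 →
      pd k (fun v => Complex.sqrt (h m v : ℂ)) u =
        Complex.sqrt (h m u : ℂ) * (c / (2 * h m u) : ℝ) := by
    intro k m c hc hm
    have h1 := hasDerivAt_complex_sqrt hc (by simpa using hm)
    simp only [zero_smul, add_zero] at h1
    exact HasPd.pd_eq (f := fun v => Complex.sqrt (h m v : ℂ)) h1
  have hsq : ∀ z : ℂ, Complex.sqrt z ^ 2 = z := by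
    intro z
    rw [Complex.sqrt, ← Complex.cpow_nat_mul]
    simp
  have hs0 : ∀ z : ℂ, z ≠ 0 → Complex.sqrt z ≠ 0 := by
    intro z hz h0
    apply hz
    rw [← hsq z, h0, zero_pow two_ne_zero]
  rw [rotation, rotation, key i j b hj hj0, key j i a hi hi0,
    div_eq_div_iff (hs0 _ (by exact_mod_cast hi0)) (hs0 _ (by exact_mod_cast hj0))] at hr
  -- After cross-multiplication each root occurs squared, so the choice of branch disappears.
  have h1 : (h j u : ℂ) * (b / (2 * h j u) : ℝ) = (h i u : ℂ) * (a / (2 * h i u) : ℝ) := by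
    rw [← hsq (h j u : ℂ), ← hsq (h i u : ℂ)]
    linear_combination hr
  have h2 : h j u * (b / (2 * h j u)) = h i u * (a / (2 * h i u)) := by exact_mod_cast h1
  field_simp at h2
  exact h2

end Diagonal

end

section

/-! ### Residues at simple poles -/

theorem complex_sqrt_sq (z : ℂ) : Complex.sqrt z ^ 2 = z := by
  rw [Complex.sqrt, ← Complex.cpow_nat_mul]
  simp

/-- Cauchy's formula gives the value `h z₀` on every sufficiently small circle, so the limit is that
of an eventually constant function. -/
theorem residue_of_simplePole {f h : ℂ → ℂ} {z₀ : ℂ} {U : Set ℂ} (hU : U ∈ 𝓝 z₀)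
    (hh : DifferentiableOn ℂ h U) (hf : ∀ z ∈ U, z ≠ z₀ → f z = (z - z₀)⁻¹ * h z) :
    residue f z₀ = h z₀ := by
  refine Tendsto.limUnder_eq ?_
  obtain ⟨ε, hε, hball⟩ := Metric.mem_nhds_iff.1 hU
  refine tendsto_const_nhds.congr' ?_
  filter_upwards [Ioo_mem_nhdsGT hε] with r hr
  have hsub : Metric.closedBall z₀ r ⊆ U :=
    (Metric.closedBall_subset_ball hr.2).trans hball
  have h1 : circleIntegral f z₀ r = ∮ z in C(z₀, r), (z - z₀)⁻¹ • h z := by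
    refine circleIntegral.integral_congr hr.1.le fun z hz => ?_
    refine hf z (hsub (Metric.sphere_subset_closedBall hz)) ?_
    rintro rfl
    simp at hz
    exact hr.1.ne hz
  rw [h1, DiffContOnCl.circleIntegral_sub_inv_smul (w := z₀)
    ((hh.mono ?_).diffContOnCl) (Metric.mem_ball_self hr.1)]
  · have : (2 * Real.pi * Complex.I : ℂ) ≠ 0 := Complex.two_pi_I_ne_zero
    rw [smul_eq_mul, inv_mul_cancel_left₀ this]
  · rwa [closure_ball _ hr.1.ne']

/-! ### Differentiation under the integral -/

/-- Dominated differentiation: on a compact neighbourhood of `u` times [a, b] the continuous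
derivative is bounded, and a constant dominates it. -/
theorem hasFDerivAt_intervalIntegral {E : Type*} [NormedAddCommGroup E] [NormedSpace ℝ E]
    [LocallyCompactSpace E] {U : Set E} (hU : IsOpen U) {F : E → ℝ → ℝ}
    {F' : E → ℝ → E →L[ℝ] ℝ} {a b : ℝ}
    (hF : ∀ u ∈ U, ∀ θ, HasFDerivAt (fun v => F v θ) (F' u θ) u)
    (hFc : ∀ u ∈ U, Continuous (F u))
    (hF' : ContinuousOn (fun p : E × ℝ => F' p.1 p.2) (U ×ˢ Set.univ)) {u : E} (hu : u ∈ U) :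
    HasFDerivAt (fun v => ∫ θ in a..b, F v θ) (∫ θ in a..b, F' u θ) u := by
  obtain ⟨K, hK, huK, hKU⟩ := exists_compact_subset hU hu
  have hcpt : IsCompact (K ×ˢ Set.uIcc a b) := hK.prod isCompact_uIcc
  obtain ⟨M, hM⟩ := hcpt.exists_bound_of_continuousOn
    (hF'.mono (Set.prod_mono hKU (Set.subset_univ _)))
  have hFu : Continuous (F' u) := by
    refine continuousOn_univ.1 ?_
    exact hF'.comp (f := fun θ : ℝ => (u, θ)) (by fun_prop) fun θ _ => ⟨hu, Set.mem_univ _⟩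
  refine intervalIntegral.hasFDerivAt_integral_of_dominated_of_fderiv_le (s := interior K)
    (bound := fun _ => M) (F := F) (F' := F') (isOpen_interior.mem_nhds huK) ?_ ?_ ?_ ?_ ?_ ?_
  · filter_upwards [hU.mem_nhds hu] with v hv using (hFc v hv).aestronglyMeasurable
  · exact (hFc u hu).intervalIntegrable _ _
  · exact hFu.aestronglyMeasurable
  · exact Eventually.of_forall fun θ hθ v hv =>
      hM (v, θ) ⟨interior_subset hv, Set.uIoc_subset_uIcc hθ⟩
  · exact intervalIntegrable_const
  · exact Eventually.of_forall fun θ _ v hv => hF v (hKU (interior_subset hv)) θ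

/-! ### The periods as integrals over `[0, π]` -/

/-- The point `x + ν` of the cut that corresponds to the angle `θ`, shifted by `ν`. -/
def cutX (ν : ℝ) (u : Fin 3 → ℝ) (θ : ℝ) : ℝ :=
  (u 0 + u 1) / 2 - (u 1 - u 0) / 2 * Real.cos θ + ν

/-- The distance from the point of the cut to the third root of `R`. -/
def cutZ (ν : ℝ) (u : Fin 3 → ℝ) (θ : ℝ) : ℝ :=
  u 2 + ν - cutX ν u θ

/-- The integrand of the shifted moment of order `k`. -/
def momentIntegrand (ν : ℝ) (k : ℕ) (u : Fin 3 → ℝ) (θ : ℝ) : ℝ :=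
  cutX ν u θ ^ k / Real.sqrt (cutX ν u θ * cutZ ν u θ)

/-- The shifted moments `∮_a (x + ν)^k dx / √R(x)`. -/
def moment (ν : ℝ) (k : ℕ) (u : Fin 3 → ℝ) : ℝ :=
  aPeriod ν u fun x => (x + ν) ^ k

theorem isOpen_region (ν : ℝ) : IsOpen (region ν) := by
  have h1 : IsOpen {u : Fin 3 → ℝ | -ν < u 0} := isOpen_lt (by fun_prop) (by fun_prop)
  have h2 : IsOpen {u : Fin 3 → ℝ | u 0 < u 1} := isOpen_lt (by fun_prop) (by fun_prop)
  have h3 : IsOpen {u : Fin 3 → ℝ | u 1 < u 2} := isOpen_lt (by fun_prop) (by fun_prop)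
  exact h1.inter (h2.inter h3)

theorem cutX_pos {ν : ℝ} {u : Fin 3 → ℝ} (hu : u ∈ region ν) (θ : ℝ) : 0 < cutX ν u θ := by
  obtain ⟨h1, h2, h3⟩ := hu
  have := Real.cos_le_one θ
  unfold cutX
  nlinarith

theorem cutZ_pos {ν : ℝ} {u : Fin 3 → ℝ} (hu : u ∈ region ν) (θ : ℝ) : 0 < cutZ ν u θ := by
  obtain ⟨h1, h2, h3⟩ := hu
  have := Real.neg_one_le_cos θ
  unfold cutZ cutX
  nlinarith

theorem continuous_cutX (ν : ℝ) : Continuous fun p : (Fin 3 → ℝ) × ℝ => cutX ν p.1 p.2 := by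
  unfold cutX
  fun_prop

theorem continuous_cutZ (ν : ℝ) : Continuous fun p : (Fin 3 → ℝ) × ℝ => cutZ ν p.1 p.2 := by
  unfold cutZ cutX
  fun_prop

theorem sqrt_cut_pos {ν : ℝ} {u : Fin 3 → ℝ} (hu : u ∈ region ν) (θ : ℝ) :
    0 < Real.sqrt (cutX ν u θ * cutZ ν u θ) :=
  Real.sqrt_pos.2 (mul_pos (cutX_pos hu θ) (cutZ_pos hu θ))

theorem continuousOn_momentIntegrand (ν : ℝ) (k : ℕ) :
    ContinuousOn (fun p : (Fin 3 → ℝ) × ℝ => momentIntegrand ν k p.1 p.2)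
      (region ν ×ˢ Set.univ) := by
  refine ContinuousOn.div ((continuous_cutX ν).pow k).continuousOn
    (((continuous_cutX ν).mul (continuous_cutZ ν)).sqrt).continuousOn ?_
  rintro ⟨u, θ⟩ ⟨hu, -⟩
  exact (sqrt_cut_pos hu θ).ne'

theorem continuous_momentIntegrand {ν : ℝ} {u : Fin 3 → ℝ} (hu : u ∈ region ν) (k : ℕ) :
    Continuous (momentIntegrand ν k u) := by
  refine continuousOn_univ.1 ?_
  exact (continuousOn_momentIntegrand ν k).comp (f := fun θ : ℝ => (u, θ)) (by fun_prop)
    fun θ _ => ⟨hu, Set.mem_univ _⟩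

/-- The substitution `x = (u¹ + u²) / 2 - (u² - u¹) / 2 * cos θ` in an `a`-period. -/
theorem aPeriod_eq {ν : ℝ} {u : Fin 3 → ℝ} (hu : u ∈ region ν) (p : ℝ → ℝ) :
    aPeriod ν u p = 2 * ∫ θ in (0 : ℝ)..Real.pi,
      p (cutX ν u θ - ν) / Real.sqrt (cutX ν u θ * cutZ ν u θ) := by
  obtain ⟨h1, h2, h3⟩ := id hu
  set r := (u 1 - u 0) / 2 with hr
  have hr0 : 0 < r := by rw [hr]; linarith
  have hcut : ∀ θ, cutX ν u θ - ν = (u 0 + u 1) / 2 - r * Real.cos θ := fun θ => by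
    simp only [cutX, hr]; ring
  -- Open intervals suffice for the integrals and avoid the ends of the cut, where √R vanishes.
  have himg : (fun θ => cutX ν u θ - ν) '' Set.Ioo 0 Real.pi = Set.Ioo (u 0) (u 1) := by
    ext x
    constructor
    · rintro ⟨θ, hθ, rfl⟩
      have hc1 : Real.cos θ < 1 := by
        simpa using Real.strictAntiOn_cos (by simp [Real.pi_pos.le]) ⟨hθ.1.le, hθ.2.le⟩ hθ.1
      have hc2 : -1 < Real.cos θ := by
        simpa using Real.strictAntiOn_cos ⟨hθ.1.le, hθ.2.le⟩ (by simp [Real.pi_pos.le]) hθ.2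
      simp only [hcut]
      constructor <;> nlinarith
    · rintro ⟨hx1, hx2⟩
      have hb : -1 < ((u 0 + u 1) / 2 - x) / r ∧ ((u 0 + u 1) / 2 - x) / r < 1 := by
        rw [lt_div_iff₀ hr0, div_lt_iff₀ hr0, hr]
        constructor <;> linarith
      refine ⟨Real.arccos (((u 0 + u 1) / 2 - x) / r), ⟨Real.arccos_pos.2 hb.2, ?_⟩, ?_⟩
      · exact lt_of_le_of_ne (Real.arccos_le_pi _) fun h =>
          absurd (Real.arccos_eq_pi.1 h) (not_le.2 hb.1)
      · simp only [hcut]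
        rw [Real.cos_arccos hb.1.le hb.2.le]
        field_simp
        ring
  have hinj : Set.InjOn (fun θ => cutX ν u θ - ν) (Set.Ioo 0 Real.pi) := by
    intro a ha b hb hab
    simp only [hcut] at hab
    have : Real.cos a = Real.cos b := by
      have : r * (Real.cos a - Real.cos b) = 0 := by linarith
      rcases mul_eq_zero.1 this with h | h
      · exact absurd h hr0.ne'
      · linarith
    exact Real.injOn_cos ⟨ha.1.le, ha.2.le⟩ ⟨hb.1.le, hb.2.le⟩ this
  have hder : ∀ θ ∈ Set.Ioo 0 Real.pi, HasDerivWithinAt (fun θ => cutX ν u θ - ν)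
      (r * Real.sin θ) (Set.Ioo 0 Real.pi) θ := by
    intro θ _
    simp only [hcut]
    have := ((Real.hasDerivAt_cos θ).const_mul r).const_sub ((u 0 + u 1) / 2)
    refine (this.congr_deriv ?_).hasDerivWithinAt
    ring
  have hmain := integral_image_eq_integral_abs_deriv_smul measurableSet_Ioo hder hinj
    (fun x => p x / Real.sqrt (curveR ν u x))
  rw [himg] at hmain
  rw [aPeriod, intervalIntegral.integral_of_le h2.le, integral_Ioc_eq_integral_Ioo, hmain,
    intervalIntegral.integral_of_le Real.pi_pos.le, integral_Ioc_eq_integral_Ioo]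
  congr 1
  refine setIntegral_congr_fun measurableSet_Ioo fun θ hθ => ?_
  have hs := Real.sin_pos_of_mem_Ioo hθ
  -- The Jacobian r sin θ is the root of the factor of R that vanishes at the ends of the cut. It
  -- cancels and leaves an integrand that is regular on all of [0, π].
  have hR : curveR ν u (cutX ν u θ - ν) =
      (r * Real.sin θ) ^ 2 * (cutX ν u θ * cutZ ν u θ) := by
    have hs2 : Real.sin θ ^ 2 = 1 - Real.cos θ ^ 2 := by
      rw [← Real.sin_sq_add_cos_sq θ]; ring
    rw [mul_pow, hs2]
    simp only [curveR, cutZ, cutX, hr]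
    ring
  have hrs : 0 < r * Real.sin θ := mul_pos hr0 hs
  simp only [hR, smul_eq_mul, abs_of_pos hrs]
  rw [Real.sqrt_mul (sq_nonneg _), Real.sqrt_sq hrs.le]
  have := (sqrt_cut_pos hu θ).ne'
  field_simp

theorem moment_eq {ν : ℝ} {u : Fin 3 → ℝ} (hu : u ∈ region ν) (k : ℕ) :
    moment ν k u = 2 * ∫ θ in (0 : ℝ)..Real.pi, momentIntegrand ν k u θ := by
  rw [moment, aPeriod_eq hu]
  simp [momentIntegrand]

theorem momentIntegrand_pos {ν : ℝ} {u : Fin 3 → ℝ} (hu : u ∈ region ν) (k : ℕ) (θ : ℝ) :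
    0 < momentIntegrand ν k u θ :=
  div_pos (pow_pos (cutX_pos hu θ) k) (sqrt_cut_pos hu θ)

theorem moment_pos {ν : ℝ} {u : Fin 3 → ℝ} (hu : u ∈ region ν) (k : ℕ) : 0 < moment ν k u := by
  rw [moment_eq hu]
  refine mul_pos two_pos (intervalIntegral.intervalIntegral_pos_of_pos
    ((continuous_momentIntegrand hu k).intervalIntegrable _ _) (momentIntegrand_pos hu k)
    Real.pi_pos)

theorem periodI_zero (ν : ℝ) (u : Fin 3 → ℝ) : periodI ν u 0 = moment ν 0 u := by
  simp [periodI, moment]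

theorem periodI_one {ν : ℝ} {u : Fin 3 → ℝ} (hu : u ∈ region ν) :
    periodI ν u 1 = moment ν 1 u - ν * moment ν 0 u := by
  have hc := fun k => (continuous_momentIntegrand hu k).intervalIntegrable (μ := volume) 0 Real.pi
  rw [moment_eq hu, moment_eq hu, periodI, aPeriod_eq hu, ← mul_assoc, mul_comm ν 2, mul_assoc,
    ← intervalIntegral.integral_const_mul ν, ← mul_sub,
    ← intervalIntegral.integral_sub (hc 1) ((hc 0).const_mul ν)]
  congr 2
  funext θ
  simp only [momentIntegrand]
  ring

theorem periodI_two {ν : ℝ} {u : Fin 3 → ℝ} (hu : u ∈ region ν) :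
    periodI ν u 2 = moment ν 2 u - 2 * ν * moment ν 1 u + ν ^ 2 * moment ν 0 u := by
  have hc := fun k => (continuous_momentIntegrand hu k).intervalIntegrable (μ := volume) 0 Real.pi
  rw [moment_eq hu, moment_eq hu, moment_eq hu, periodI, aPeriod_eq hu]
  have e : ∀ a b c : ℝ, 2 * a - 2 * ν * (2 * b) + ν ^ 2 * (2 * c)
      = 2 * (a - 2 * ν * b + ν ^ 2 * c) := fun a b c => by ring
  rw [e, ← intervalIntegral.integral_const_mul (2 * ν),
    ← intervalIntegral.integral_const_mul (ν ^ 2),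
    ← intervalIntegral.integral_sub (hc 2) ((hc 1).const_mul _),
    ← intervalIntegral.integral_add ((hc 2).sub ((hc 1).const_mul _)) ((hc 0).const_mul _)]
  congr 2
  funext θ
  simp only [momentIntegrand]
  ring

end

/-! ### Derivatives of the moments -/

section

/-- Logarithmic differentiation of X^(k - 1/2) Z^(-1/2). The case `k = 0` is separate because the
power rule has the natural exponent `k - 1`. -/
theorem hasFDerivAt_pow_div_sqrt {E : Type*} [NormedAddCommGroup E] [NormedSpace ℝ E]
    {X Z : E → ℝ} {X' Z' : E →L[ℝ] ℝ} {u : E} (k : ℕ) (hX : HasFDerivAt X X' u)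
    (hZ : HasFDerivAt Z Z' u) (hX0 : 0 < X u) (hZ0 : 0 < Z u) :
    HasFDerivAt (fun v => X v ^ k / Real.sqrt (X v * Z v))
      ((X u ^ k / Real.sqrt (X u * Z u)) •
        (((k - 1 / 2) / X u) • X' - (1 / 2 / Z u) • Z')) u := by
  have hXZ : 0 < X u * Z u := mul_pos hX0 hZ0
  have hs : 0 < Real.sqrt (X u * Z u) := Real.sqrt_pos.2 hXZ
  have hsq : Real.sqrt (X u * Z u) ^ 2 = X u * Z u := Real.sq_sqrt hXZ.le
  have h1 := (hX.pow k).mul ((hasDerivAt_inv hs.ne').comp_hasFDerivAt u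
    ((hX.mul hZ).sqrt hXZ.ne'))
  refine (h1.congr_fderiv ?_)
  ext v
  set s := Real.sqrt (X u * Z u) with hsdef
  have e3 : (s ^ 2)⁻¹ = (X u * Z u)⁻¹ := by rw [hsq]
  simp only [Function.comp_apply, Pi.mul_apply, add_apply, smul_apply, sub_apply, smul_eq_mul, nsmul_eq_mul, e3, ← hsdef]
  rcases k with _ | k
  · simp
    field_simp
    ring
  · simp
    field_simp
    ring

/-- The derivative of `cutX` with respect to the `i`-th branch point. -/
def cutXPd (i : Fin 3) (θ : ℝ) : ℝ :=
  ![(1 + Real.cos θ) / 2, (1 - Real.cos θ) / 2, 0] i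

/-- The derivative of `cutZ` with respect to the `i`-th branch point. -/
def cutZPd (i : Fin 3) (θ : ℝ) : ℝ :=
  ![-((1 + Real.cos θ) / 2), -((1 - Real.cos θ) / 2), 1] i

/-- The linear form with the given coefficients. -/
def linForm (c : Fin 3 → ℝ) : (Fin 3 → ℝ) →L[ℝ] ℝ :=
  ∑ i, c i • ContinuousLinearMap.proj i

theorem linForm_apply (c v : Fin 3 → ℝ) :
    linForm c v = c 0 * v 0 + c 1 * v 1 + c 2 * v 2 := by
  simp [linForm, Fin.sum_univ_three]

theorem linForm_single (c : Fin 3 → ℝ) (i : Fin 3) : linForm c (Pi.single i 1) = c i := by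
  rw [linForm_apply]
  fin_cases i <;> simp

theorem hasFDerivAt_cutX (ν θ : ℝ) (u : Fin 3 → ℝ) :
    HasFDerivAt (fun v => cutX ν v θ) (linForm fun i => cutXPd i θ) u := by
  have h : (fun v => cutX ν v θ) = fun v => linForm (fun i => cutXPd i θ) v + ν := by
    funext v
    simp [linForm_apply, cutX, cutXPd]
    ring
  rw [h]
  exact (linForm _).hasFDerivAt.add_const ν

theorem hasFDerivAt_cutZ (ν θ : ℝ) (u : Fin 3 → ℝ) :
    HasFDerivAt (fun v => cutZ ν v θ) (linForm fun i => cutZPd i θ) u := by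
  have h : (fun v => cutZ ν v θ) = fun v => linForm (fun i => cutZPd i θ) v := by
    funext v
    simp [linForm_apply, cutZ, cutX, cutZPd]
    ring
  rw [h]
  exact (linForm _).hasFDerivAt

/-- The derivative of `momentIntegrand` with respect to the `i`-th branch point. -/
def momentIntegrandPd (ν : ℝ) (k : ℕ) (i : Fin 3) (u : Fin 3 → ℝ) (θ : ℝ) : ℝ :=
  momentIntegrand ν k u θ *
    ((k - 1 / 2) / cutX ν u θ * cutXPd i θ - 1 / 2 / cutZ ν u θ * cutZPd i θ)

theorem hasFDerivAt_momentIntegrand {ν : ℝ} {u : Fin 3 → ℝ} (hu : u ∈ region ν) (k : ℕ) (θ : ℝ) :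
    HasFDerivAt (fun v => momentIntegrand ν k v θ)
      (linForm fun i => momentIntegrandPd ν k i u θ) u := by
  refine (hasFDerivAt_pow_div_sqrt k (hasFDerivAt_cutX ν θ u) (hasFDerivAt_cutZ ν θ u)
    (cutX_pos hu θ) (cutZ_pos hu θ)).congr_fderiv ?_
  ext v
  simp [linForm_apply, momentIntegrandPd, momentIntegrand]
  ring

theorem continuousOn_momentIntegrandPd (ν : ℝ) (k : ℕ) (i : Fin 3) :
    ContinuousOn (fun p : (Fin 3 → ℝ) × ℝ => momentIntegrandPd ν k i p.1 p.2)
      (region ν ×ˢ Set.univ) := by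
  have hx : Continuous (cutXPd i) := by
    unfold cutXPd
    fin_cases i <;> simp <;> fun_prop
  have hz : Continuous (cutZPd i) := by
    unfold cutZPd
    fin_cases i <;> simp <;> fun_prop
  refine (continuousOn_momentIntegrand ν k).mul (ContinuousOn.sub
    (ContinuousOn.mul (ContinuousOn.div continuousOn_const (continuous_cutX ν).continuousOn ?_)
      (hx.comp continuous_snd).continuousOn)
    (ContinuousOn.mul (ContinuousOn.div continuousOn_const (continuous_cutZ ν).continuousOn ?_)
      (hz.comp continuous_snd).continuousOn))
  · rintro ⟨u, θ⟩ ⟨hu, -⟩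
    exact (cutX_pos hu θ).ne'
  · rintro ⟨u, θ⟩ ⟨hu, -⟩
    exact (cutZ_pos hu θ).ne'

theorem continuous_momentIntegrandPd {ν : ℝ} {u : Fin 3 → ℝ} (hu : u ∈ region ν) (k : ℕ)
    (i : Fin 3) : Continuous (momentIntegrandPd ν k i u) := by
  refine continuousOn_univ.1 ?_
  exact (continuousOn_momentIntegrandPd ν k i).comp (f := fun θ : ℝ => (u, θ)) (by fun_prop)
    fun θ _ => ⟨hu, Set.mem_univ _⟩

/-- The derivative of `moment` with respect to the `i`-th branch point. -/
def momentPd (ν : ℝ) (k : ℕ) (i : Fin 3) (u : Fin 3 → ℝ) : ℝ :=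
  2 * ∫ θ in (0 : ℝ)..Real.pi, momentIntegrandPd ν k i u θ

theorem hasFDerivAt_moment {ν : ℝ} {u : Fin 3 → ℝ} (hu : u ∈ region ν) (k : ℕ) :
    HasFDerivAt (moment ν k) (linForm fun i => momentPd ν k i u) u := by
  have hc : ContinuousOn (fun p : (Fin 3 → ℝ) × ℝ =>
      linForm fun i => momentIntegrandPd ν k i p.1 p.2) (region ν ×ˢ Set.univ) := by
    unfold linForm
    exact continuousOn_finsetSum _ fun i _ =>
      (continuousOn_momentIntegrandPd ν k i).smul continuousOn_const
  have h1 := (hasFDerivAt_intervalIntegral (a := 0) (b := Real.pi) (isOpen_region ν)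
    (fun u hu θ => hasFDerivAt_momentIntegrand hu k θ)
    (fun u hu => continuous_momentIntegrand hu k) hc hu).const_mul 2
  have h2 : HasFDerivAt (moment ν k) _ u := h1.congr_of_eventuallyEq (by
    filter_upwards [(isOpen_region ν).mem_nhds hu] with v hv using moment_eq hv k)
  refine h2.congr_fderiv ?_
  have hcu : Continuous fun θ => linForm fun i => momentIntegrandPd ν k i u θ := by
    unfold linForm
    exact continuous_finsetSum _ fun i _ =>
      (continuous_momentIntegrandPd hu k i).smul continuous_const
  have hi := fun i => (continuous_momentIntegrandPd hu k i).intervalIntegrable (μ := volume)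
    0 Real.pi
  ext v
  rw [smul_apply,
    ContinuousLinearMap.intervalIntegral_apply (hcu.intervalIntegrable _ _)]
  simp only [linForm_apply, momentPd, smul_eq_mul]
  rw [intervalIntegral.integral_add (((hi 0).mul_const _).add ((hi 1).mul_const _))
    ((hi 2).mul_const _), intervalIntegral.integral_add ((hi 0).mul_const _) ((hi 1).mul_const _)]
  simp only [intervalIntegral.integral_mul_const]
  ring

/-- Euler's identity for the homogeneous integrand. -/
theorem sum_mul_momentPd {ν : ℝ} {u : Fin 3 → ℝ} (hu : u ∈ region ν) (k : ℕ) :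
    ∑ i, (u i + ν) * momentPd ν k i u = (k - 1) * moment ν k u := by
  have hi := fun i => (continuous_momentIntegrandPd hu k i).intervalIntegrable (μ := volume)
    0 Real.pi
  have h : ∫ θ in (0 : ℝ)..Real.pi, ((u 0 + ν) * momentIntegrandPd ν k 0 u θ
      + (u 1 + ν) * momentIntegrandPd ν k 1 u θ + (u 2 + ν) * momentIntegrandPd ν k 2 u θ) =
      ∫ θ in (0 : ℝ)..Real.pi, (k - 1) * momentIntegrand ν k u θ := by
    congr 1
    funext θ
    have hx := (cutX_pos hu θ).ne'
    have hz := (cutZ_pos hu θ).ne'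
    have e1 : (u 0 + ν) * cutXPd 0 θ + (u 1 + ν) * cutXPd 1 θ + (u 2 + ν) * cutXPd 2 θ
        = cutX ν u θ := by
      simp [cutXPd, cutX]; ring
    have e2 : (u 0 + ν) * cutZPd 0 θ + (u 1 + ν) * cutZPd 1 θ + (u 2 + ν) * cutZPd 2 θ
        = cutZ ν u θ := by
      simp [cutZPd, cutZ, cutX]; ring
    simp only [momentIntegrandPd]
    have e3 : (k - 1 / 2 : ℝ) / cutX ν u θ * cutX ν u θ - 1 / 2 / cutZ ν u θ * cutZ ν u θ
        = k - 1 := by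
      field_simp; ring
    rw [← e3]
    linear_combination (momentIntegrand ν k u θ * (k - 1 / 2) / cutX ν u θ) * e1
      - (momentIntegrand ν k u θ / 2 / cutZ ν u θ) * e2
  rw [intervalIntegral.integral_add (((hi 0).const_mul _).add ((hi 1).const_mul _))
    ((hi 2).const_mul _), intervalIntegral.integral_add ((hi 0).const_mul _)
    ((hi 1).const_mul _)] at h
  simp only [intervalIntegral.integral_const_mul] at h
  rw [Fin.sum_univ_three, moment_eq hu]
  simp only [momentPd]
  linear_combination 2 * h

/-- The integrand is the total derivative of sin θ times the moment integrand, and sin vanishes at 0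
and π. -/
theorem integral_deriv_sin_mul_momentIntegrand {ν : ℝ} {u : Fin 3 → ℝ} (hu : u ∈ region ν)
    (k : ℕ) :
    ∫ θ in (0 : ℝ)..Real.pi, (Real.cos θ * momentIntegrand ν k u θ
      + Real.sin θ * (momentIntegrand ν k u θ * (((k - 1 / 2) / cutX ν u θ + 1 / 2 / cutZ ν u θ)
        * ((u 1 - u 0) / 2 * Real.sin θ)))) = 0 := by
  have hX : ∀ θ, HasDerivAt (cutX ν u) ((u 1 - u 0) / 2 * Real.sin θ) θ := by
    intro θ
    have := (((Real.hasDerivAt_cos θ).const_mul ((u 1 - u 0) / 2)).const_sub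
      ((u 0 + u 1) / 2)).add_const ν
    refine this.congr_deriv ?_
    ring
  have hZ : ∀ θ, HasDerivAt (cutZ ν u) (-((u 1 - u 0) / 2 * Real.sin θ)) θ := fun θ =>
    (hX θ).const_sub (u 2 + ν)
  have hd : ∀ θ, HasDerivAt (momentIntegrand ν k u) (momentIntegrand ν k u θ *
      (((k - 1 / 2) / cutX ν u θ + 1 / 2 / cutZ ν u θ) * ((u 1 - u 0) / 2 * Real.sin θ))) θ := by
    intro θ
    have := (hasFDerivAt_pow_div_sqrt k (hX θ).hasFDerivAt (hZ θ).hasFDerivAt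
      (cutX_pos hu θ) (cutZ_pos hu θ)).hasDerivAt
    refine this.congr_deriv ?_
    simp [momentIntegrand]
    left
    ring
  have hcont := continuous_momentIntegrand hu k
  have hx : Continuous (cutX ν u) := continuous_iff_continuousAt.2 fun θ => (hX θ).continuousAt
  have hz : Continuous (cutZ ν u) := continuous_iff_continuousAt.2 fun θ => (hZ θ).continuousAt
  have hx0 := fun θ => (cutX_pos hu θ).ne'
  have hz0 := fun θ => (cutZ_pos hu θ).ne'
  rw [intervalIntegral.integral_eq_sub_of_hasDerivAt
    (fun θ _ => (Real.hasDerivAt_sin θ).mul (hd θ))]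
  · simp
  · refine Continuous.intervalIntegrable ?_ _ _
    fun_prop (disch := assumption)

/-- Formally, ∂_i (1/√R) = 1 / (2 (x - u^i) √R), and splitting x + ν = (x - u^i) + (u^i + ν) in the
moment of order k + 1 gives the recursion. For the ends of the cut that integrand is not integrable,
so the identity is proved in the angle θ, modulo an exact term. -/
theorem momentPd_succ {ν : ℝ} {u : Fin 3 → ℝ} (hu : u ∈ region ν) (k : ℕ) (i : Fin 3) :
    momentPd ν (k + 1) i u = moment ν k u / 2 + (u i + ν) * momentPd ν k i u := by
  have hi := fun k => (continuous_momentIntegrandPd hu k i).intervalIntegrable (μ := volume)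
    0 Real.pi
  have hm := (continuous_momentIntegrand hu k).intervalIntegrable (μ := volume) 0 Real.pi
  have hsub := integral_deriv_sin_mul_momentIntegrand hu k
  -- In the variable θ the integrands differ by `c` times the exact derivative above. For the third
  -- root the cut does not move, and the identity is pointwise.
  set c : ℝ := ![1 / 2, -1 / 2, 0] i with hc
  have h : ∫ θ in (0 : ℝ)..Real.pi, (momentIntegrandPd ν (k + 1) i u θ
      - 1 / 2 * momentIntegrand ν k u θ - (u i + ν) * momentIntegrandPd ν k i u θ) =
      ∫ θ in (0 : ℝ)..Real.pi, c * (Real.cos θ * momentIntegrand ν k u θ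
      + Real.sin θ * (momentIntegrand ν k u θ * (((k - 1 / 2) / cutX ν u θ + 1 / 2 / cutZ ν u θ)
        * ((u 1 - u 0) / 2 * Real.sin θ)))) := by
    congr 1
    funext θ
    have hx := (cutX_pos hu θ).ne'
    have hz := (cutZ_pos hu θ).ne'
    have hs : Real.sin θ ^ 2 = 1 - Real.cos θ ^ 2 := by
      rw [← Real.sin_sq_add_cos_sq θ]; ring
    have hF : momentIntegrand ν (k + 1) u θ = cutX ν u θ * momentIntegrand ν k u θ := by
      simp only [momentIntegrand]; ring
    have hXd : cutX ν u θ = (u 0 + u 1) / 2 - (u 1 - u 0) / 2 * Real.cos θ + ν := rfl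
    have hZd : cutZ ν u θ = u 2 + ν - cutX ν u θ := rfl
    simp only [momentIntegrandPd, hF, cutXPd, cutZPd]
    push_cast
    have e1 : Real.sin θ * (momentIntegrand ν k u θ * (((k - 1 / 2) / cutX ν u θ
        + 1 / 2 / cutZ ν u θ) * ((u 1 - u 0) / 2 * Real.sin θ))) = momentIntegrand ν k u θ *
        (((k - 1 / 2) / cutX ν u θ + 1 / 2 / cutZ ν u θ) * ((u 1 - u 0) / 2 *
          (1 - Real.cos θ ^ 2))) := by
      rw [← hs]; ring
    rw [e1]
    have hνe : ν = cutX ν u θ - ((u 0 + u 1) / 2 - (u 1 - u 0) / 2 * Real.cos θ) := by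
      rw [hXd]; ring
    have hu2 : u 2 + ν = cutZ ν u θ + cutX ν u θ := by rw [hZd]; ring
    generalize momentIntegrand ν k u θ = m
    generalize cutX ν u θ = x at *
    generalize cutZ ν u θ = z at *
    generalize Real.cos θ = y at *
    fin_cases i
    · simp [hc]
      rw [hνe]
      field_simp
      ring
    · simp [hc]
      rw [hνe]
      field_simp
      ring
    · simp [hc]
      rw [hu2]
      field_simp
      ring
  rw [intervalIntegral.integral_const_mul, hsub, intervalIntegral.integral_sub
    ((hi (k + 1)).sub (hm.const_mul _)) ((hi k).const_mul _), intervalIntegral.integral_sub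
    (hi (k + 1)) (hm.const_mul _)] at h
  simp only [intervalIntegral.integral_const_mul] at h
  rw [moment_eq hu]
  simp only [momentPd]
  linear_combination 2 * h

end

/-! ### The gradient of J and the Euler–Poisson–Darboux equations -/

section

theorem sum_eq_of_pairwise_ne {M : Type*} [AddCommMonoid M] {i j k : Fin 3} (hij : i ≠ j) (hik : i ≠ k)
    (hjk : j ≠ k) (f : Fin 3 → M) : ∑ m, f m = f i + f j + f k := by
  have h : (Finset.univ : Finset (Fin 3)) = {i, j, k} := by
    revert i j k
    decide
  rw [h, Finset.sum_insert (by simp [hij, hik]), Finset.sum_pair hjk, add_assoc]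

theorem prod_eq_of_pairwise_ne {M : Type*} [CommMonoid M] {i j k : Fin 3} (hij : i ≠ j) (hik : i ≠ k)
    (hjk : j ≠ k) (f : Fin 3 → M) : ∏ m, f m = f i * (f j * f k) := by
  have h : (Finset.univ : Finset (Fin 3)) = {i, j, k} := by
    revert i j k
    decide
  rw [h, Finset.prod_insert (by simp [hij, hik]), Finset.prod_pair hjk]

theorem exists_third {i j : Fin 3} (hij : i ≠ j) : ∃ k, i ≠ k ∧ j ≠ k := by
  revert i j
  decide

theorem exists_others (i : Fin 3) : ∃ j k, i ≠ j ∧ i ≠ k ∧ j ≠ k := by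
  revert i
  decide

theorem region_ne {ν : ℝ} {u : Fin 3 → ℝ} (hu : u ∈ region ν) {i j : Fin 3} (hij : i ≠ j) :
    u i - u j ≠ 0 := by
  obtain ⟨h1, h2, h3⟩ := hu
  refine sub_ne_zero.2 ?_
  fin_cases i <;> fin_cases j <;> simp at hij ⊢ <;> intro h <;> linarith

theorem region_pos {ν : ℝ} {u : Fin 3 → ℝ} (hu : u ∈ region ν) (i : Fin 3) : 0 < u i + ν := by
  obtain ⟨h1, h2, h3⟩ := hu
  fin_cases i <;> simp <;> linarith

/-- The derivatives `J_i = ∂_i J` of the period `J = ∮_a (x + ν) dx / √R`. -/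
def gradJ (ν : ℝ) (i : Fin 3) (u : Fin 3 → ℝ) : ℝ :=
  momentPd ν 1 i u

variable {ν : ℝ} {u : Fin 3 → ℝ}

theorem sum_mul_gradJ (hu : u ∈ region ν) : ∑ i, (u i + ν) * gradJ ν i u = 0 := by
  have h := sum_mul_momentPd hu 1
  simpa [gradJ] using h

/-- The recursion run backwards, which is possible because u^i + ν is nonzero. -/
theorem momentPd_zero (hu : u ∈ region ν) (i : Fin 3) :
    momentPd ν 0 i u = (gradJ ν i u - moment ν 0 u / 2) / (u i + ν) := by
  have h := momentPd_succ hu 0 i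
  have := (region_pos hu i).ne'
  rw [gradJ, h]
  field_simp
  ring

theorem momentPd_two (hu : u ∈ region ν) (i : Fin 3) :
    momentPd ν 2 i u = moment ν 1 u / 2 + (u i + ν) * gradJ ν i u :=
  momentPd_succ hu 1 i

/-- Euler's identity for the moment of order 0, rewritten by the recursion. The orders 1 and 2 give
the companion sums with weights v_i and v_i²; together they are a Vandermonde system for the J_i. -/
theorem sum_gradJ (hu : u ∈ region ν) : ∑ i, gradJ ν i u = moment ν 0 u / 2 := by
  have h := sum_mul_momentPd hu 0
  have e : ∀ i, (u i + ν) * momentPd ν 0 i u = gradJ ν i u - moment ν 0 u / 2 := fun i => by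
    rw [momentPd_zero hu, mul_div_cancel₀ _ (region_pos hu i).ne']
  simp only [e, Finset.sum_sub_distrib] at h
  simp at h
  linarith

theorem sum_sq_mul_gradJ (hu : u ∈ region ν) :
    ∑ i, (u i + ν) ^ 2 * gradJ ν i u = moment ν 2 u - (∑ i, (u i + ν)) * moment ν 1 u / 2 := by
  have h := sum_mul_momentPd hu 2
  simp only [momentPd_two hu, Fin.sum_univ_three] at h ⊢
  push_cast at h
  linear_combination h

/-- `2 J_i (u^i - u^j) (u^i - u^k)` in terms of the moments. -/
theorem gradJ_mul (hu : u ∈ region ν) {i j k : Fin 3} (hij : i ≠ j) (hik : i ≠ k) (hjk : j ≠ k) :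
    gradJ ν i u * (2 * ((u i - u j) * (u i - u k))) = (u j + ν) * (u k + ν) * moment ν 0 u
      - (∑ i, (u i + ν)) * moment ν 1 u + 2 * moment ν 2 u := by
  have h0 := sum_gradJ hu
  have h1 := sum_mul_gradJ hu
  have h2 := sum_sq_mul_gradJ hu
  simp only [sum_eq_of_pairwise_ne hij hik hjk] at h0 h1 h2 ⊢
  -- Lagrange's trick: weighting J_m by (v_m - v_j)(v_m - v_k) leaves only the term m = i.
  linear_combination 2 * h2 - 2 * (u j + u k + 2 * ν) * h1 + 2 * (u j + ν) * (u k + ν) * h0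

theorem gradJ_eq (hu : u ∈ region ν) {i j k : Fin 3} (hij : i ≠ j) (hik : i ≠ k) (hjk : j ≠ k) :
    gradJ ν i u = ((u j + ν) * (u k + ν) * moment ν 0 u
      - (∑ i, (u i + ν)) * moment ν 1 u + 2 * moment ν 2 u) /
        (2 * ((u i - u j) * (u i - u k))) := by
  rw [eq_div_iff, gradJ_mul hu hij hik hjk]
  exact mul_ne_zero two_ne_zero (mul_ne_zero (region_ne hu hij) (region_ne hu hik))

theorem contDiffOn_linForm {n : WithTop ℕ∞} {U : Set (Fin 3 → ℝ)} {c : Fin 3 → (Fin 3 → ℝ) → ℝ}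
    (hc : ∀ i, ContDiffOn ℝ n (c i) U) : ContDiffOn ℝ n (fun u => linForm fun i => c i u) U := by
  unfold linForm
  exact ContDiffOn.sum fun i _ => (hc i).smul contDiffOn_const

theorem contDiffOn_gradJ_of_moment {n : WithTop ℕ∞}
    (h : ∀ k ≤ 2, ContDiffOn ℝ n (moment ν k) (region ν)) (i : Fin 3) :
    ContDiffOn ℝ n (gradJ ν i) (region ν) := by
  obtain ⟨j, k, hij, hik, hjk⟩ := exists_others i
  refine ContDiffOn.congr ?_ fun u hu => gradJ_eq hu hij hik hjk
  have h0 := h 0 (by norm_num)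
  have h1 := h 1 (by norm_num)
  have h2 := h 2 (by norm_num)
  refine ContDiffOn.div ?_ (by fun_prop) fun u hu =>
    mul_ne_zero two_ne_zero (mul_ne_zero (region_ne hu hij) (region_ne hu hik))
  exact (((by fun_prop : ContDiffOn ℝ n (fun u : Fin 3 → ℝ => (u j + ν) * (u k + ν)) _).mul
    h0).sub ((by fun_prop : ContDiffOn ℝ n (fun u : Fin 3 → ℝ => ∑ i, (u i + ν)) _).mul
    h1)).add (contDiffOn_const.mul h2)

/-- Bootstrap: the gradients of the moments of orders 0, 1, 2 are rational in these same moments and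
in u, so C^n for all three implies C^(n+1). The bound on `k` keeps the system closed. -/
theorem contDiffOn_moment (ν : ℝ) {k : ℕ} (hk : k ≤ 2) :
    ContDiffOn ℝ (⊤ : ℕ∞) (moment ν k) (region ν) := by
  suffices h : ∀ n : ℕ, ∀ k ≤ 2, ContDiffOn ℝ n (moment ν k) (region ν) from
    contDiffOn_infty.2 fun n => h n k hk
  intro n
  induction n with
  | zero =>
    intro k _
    exact contDiffOn_zero.2 fun u hu => (hasFDerivAt_moment hu k).continuousAt.continuousWithinAt
  | succ n ih =>
    intro k hk
    push_cast
    rw [contDiffOn_succ_iff_fderiv_of_isOpen (isOpen_region ν)]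
    refine ⟨fun u hu => (hasFDerivAt_moment hu k).differentiableAt.differentiableWithinAt,
      by simp, ?_⟩
    refine ContDiffOn.congr (f := fun u => linForm fun i => momentPd ν k i u) ?_
      fun u hu => (hasFDerivAt_moment hu k).fderiv
    refine contDiffOn_linForm fun i => ?_
    have hg := contDiffOn_gradJ_of_moment ih i
    have hv : ContDiffOn ℝ n (fun u : Fin 3 → ℝ => u i + ν) (region ν) := by fun_prop
    interval_cases k
    · refine ContDiffOn.congr ?_ fun u hu => momentPd_zero hu i
      exact (hg.sub ((ih 0 (by norm_num)).div_const 2)).div hv fun u hu => (region_pos hu i).ne'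
    · exact hg
    · refine ContDiffOn.congr ?_ fun u hu => momentPd_two hu i
      exact ((ih 1 (by norm_num)).div_const 2).add (hv.mul hg)

theorem contDiffOn_gradJ (ν : ℝ) (i : Fin 3) :
    ContDiffOn ℝ (⊤ : ℕ∞) (gradJ ν i) (region ν) :=
  contDiffOn_gradJ_of_moment (fun _ hk => contDiffOn_moment ν hk) i

theorem hasPd_moment (hu : u ∈ region ν) (k : ℕ) (i : Fin 3) :
    HasPd i (moment ν k) (momentPd ν k i u) u := by
  have := hasPd_of_hasFDerivAt (i := i) (hasFDerivAt_moment hu k)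
  rwa [linForm_single] at this

theorem hasPd_shift (ν : ℝ) (i j : Fin 3) (u : Fin 3 → ℝ) :
    HasPd i (fun v => v j + ν) (if j = i then 1 else 0) u := by
  simpa using (hasPd_coord i j u).add (hasPd_const ν)

theorem hasPd_sum_shift (ν : ℝ) (i : Fin 3) (u : Fin 3 → ℝ) :
    HasPd i (fun v => ∑ j, (v j + ν)) 1 u := by
  have := ((hasPd_shift ν i 0 u).add (hasPd_shift ν i 1 u)).add (hasPd_shift ν i 2 u)
  simp only [Fin.sum_univ_three]
  convert this using 1
  fin_cases i <;> simp

/-- The Euler–Poisson–Darboux equations. -/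
theorem hasPd_gradJ (hu : u ∈ region ν) {i j : Fin 3} (hij : i ≠ j) :
    HasPd j (gradJ ν i) ((gradJ ν i u - gradJ ν j u) / (2 * (u i - u j))) u := by
  obtain ⟨k, hik, hjk⟩ := exists_third hij
  have hne : ∀ v ∈ region ν, 2 * ((v i - v j) * (v i - v k)) ≠ 0 := fun v hv =>
    mul_ne_zero two_ne_zero (mul_ne_zero (region_ne hv hij) (region_ne hv hik))
  have h := ((((hasPd_shift ν j j u).mul (hasPd_shift ν j k u)).mul
    (hasPd_moment hu 0 j)).sub ((hasPd_sum_shift ν j u).mul (hasPd_moment hu 1 j))).add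
      ((hasPd_moment hu 2 j).const_mul 2)
  have h' := h.div ((((hasPd_coord j i u).sub (hasPd_coord j j u)).mul
    ((hasPd_coord j i u).sub (hasPd_coord j k u))).const_mul 2) (hne u hu)
  have h2 := HasPd.congr_on (isOpen_region ν) hu (fun v hv => gradJ_eq hv hij hik hjk) h'
  convert h2 using 1
  have e0 := sum_gradJ hu
  have e1 := sum_mul_gradJ hu
  have em := gradJ_mul hu hij hik hjk
  rw [← em, momentPd_zero hu, momentPd_two hu, show momentPd ν 1 j u = gradJ ν j u from rfl]
  simp only [sum_eq_of_pairwise_ne hij hik hjk, if_neg hij, if_neg hjk.symm, if_true] at e0 e1 ⊢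
  -- In the derivative of `gradJ_eq` the moment of order 1 cancels and the undifferentiated
  -- numerator is again a multiple of J_i. The order-0 moment and J_k are eliminated by the two
  -- linear relations.
  have hN : moment ν 0 u = 2 * (gradJ ν i u + gradJ ν j u + gradJ ν k u) := by linarith
  have hk : gradJ ν k u = -((u i + ν) * gradJ ν i u + (u j + ν) * gradJ ν j u) / (u k + ν) := by
    rw [eq_div_iff (region_pos hu k).ne']; linarith
  have hvj := (region_pos hu j).ne'
  have hvk := (region_pos hu k).ne'
  have h1 := region_ne hu hij
  have h2 := region_ne hu hik
  rw [hN, hk]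
  field_simp
  ring

/-- The integrand is a positive function times 1 + cos θ, because raising u¹ increases x + ν and
decreases the distance to u³ at fixed θ. For u² the factor is 1 - cos θ. -/
theorem gradJ_zero_pos (hu : u ∈ region ν) : 0 < gradJ ν 0 u := by
  refine mul_pos two_pos (intervalIntegral.intervalIntegral_pos_of_pos_on
    ((continuous_momentIntegrandPd hu 1 0).intervalIntegrable _ _) (fun θ hθ => ?_) Real.pi_pos)
  have hx := cutX_pos hu θ
  have hz := cutZ_pos hu θ
  have hF := momentIntegrand_pos hu 1 θ
  have hc : -1 < Real.cos θ := by
    simpa using Real.strictAntiOn_cos ⟨hθ.1.le, hθ.2.le⟩ (by simp [Real.pi_pos.le]) hθ.2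
  have hc' : 0 < (1 + Real.cos θ) / 2 := by linarith
  refine mul_pos hF ?_
  have : 0 < 1 / 2 / cutX ν u θ * ((1 + Real.cos θ) / 2) + 1 / 2 / cutZ ν u θ *
    ((1 + Real.cos θ) / 2) := by positivity
  simp only [cutXPd, cutZPd, Matrix.cons_val_zero]
  push_cast
  linarith

theorem gradJ_one_pos (hu : u ∈ region ν) : 0 < gradJ ν 1 u := by
  refine mul_pos two_pos (intervalIntegral.intervalIntegral_pos_of_pos_on
    ((continuous_momentIntegrandPd hu 1 1).intervalIntegrable _ _) (fun θ hθ => ?_) Real.pi_pos)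
  have hx := cutX_pos hu θ
  have hz := cutZ_pos hu θ
  have hF := momentIntegrand_pos hu 1 θ
  have hc : Real.cos θ < 1 := by
    simpa using Real.strictAntiOn_cos (by simp [Real.pi_pos.le]) ⟨hθ.1.le, hθ.2.le⟩ hθ.1
  have hc' : 0 < (1 - Real.cos θ) / 2 := by linarith
  refine mul_pos hF ?_
  have : 0 < 1 / 2 / cutX ν u θ * ((1 - Real.cos θ) / 2) + 1 / 2 / cutZ ν u θ *
    ((1 - Real.cos θ) / 2) := by positivity
  simp only [cutXPd, cutZPd, Matrix.cons_val_one, Matrix.cons_val_zero]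
  push_cast
  linarith

/-- Euler's identity ∑ v_i J_i = 0 has positive weights and two positive terms, so the third J_i is
negative. -/
theorem gradJ_two_neg (hu : u ∈ region ν) : gradJ ν 2 u < 0 := by
  have h := sum_mul_gradJ hu
  rw [Fin.sum_univ_three] at h
  have h0 := mul_pos (region_pos hu 0) (gradJ_zero_pos hu)
  have h1 := mul_pos (region_pos hu 1) (gradJ_one_pos hu)
  have h2 := region_pos hu 2
  by_contra hneg
  have := mul_nonneg h2.le (not_lt.1 hneg)
  linarith

theorem gradJ_ne_zero (hu : u ∈ region ν) (i : Fin 3) : gradJ ν i u ≠ 0 := by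
  fin_cases i
  · exact (gradJ_zero_pos hu).ne'
  · exact (gradJ_one_pos hu).ne'
  · exact (gradJ_two_neg hu).ne

end

section

/-! ### Logarithmic derivatives -/

section LogPd

variable {n : ℕ} {f g : (Fin n → ℝ) → ℝ} {L M : ℝ} {u : Fin n → ℝ} {i : Fin n}

/-- `f` does not vanish at `u`, and `∂_i log √|f| = L` there. -/
def HasLogPd (i : Fin n) (f : (Fin n → ℝ) → ℝ) (L : ℝ) (u : Fin n → ℝ) : Prop :=
  f u ≠ 0 ∧ HasPd i f (2 * f u * L) u

theorem HasPd.hasLogPd {f' : ℝ} (h : HasPd i f f' u) (h0 : f u ≠ 0) :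
    HasLogPd i f (f' / (2 * f u)) u := by
  refine ⟨h0, ?_⟩
  rwa [mul_div_cancel₀ _ (mul_ne_zero two_ne_zero h0)]

theorem HasLogPd.congr_value (h : HasLogPd i f L u) (e : M = L) : HasLogPd i f M u :=
  e ▸ h

theorem HasPd.congr_value {a b : ℝ} (h : HasPd i f a u) (e : b = a) : HasPd i f b u :=
  e ▸ h

theorem HasLogPd.mul (hf : HasLogPd i f L u) (hg : HasLogPd i g M u) :
    HasLogPd i (fun v => f v * g v) (L + M) u := by
  refine ⟨mul_ne_zero hf.1 hg.1, ?_⟩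
  convert hf.2.mul hg.2 using 1
  ring

theorem HasLogPd.div (hf : HasLogPd i f L u) (hg : HasLogPd i g M u) :
    HasLogPd i (fun v => f v / g v) (L - M) u := by
  refine ⟨div_ne_zero hf.1 hg.1, ?_⟩
  convert hf.2.div hg.2 hg.1 using 1
  have := hg.1
  field_simp

theorem HasLogPd.pow (k : ℕ) (hf : HasLogPd i f L u) :
    HasLogPd i (fun v => f v ^ k) (k * L) u := by
  refine ⟨pow_ne_zero k hf.1, ?_⟩
  convert hf.2.pow k using 1
  rcases k with _ | k
  · simp
  · simp only [Nat.add_sub_cancel]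
    ring

theorem HasLogPd.const_mul {c : ℝ} (hc : c ≠ 0) (hf : HasLogPd i f L u) :
    HasLogPd i (fun v => c * f v) L u := by
  refine ⟨mul_ne_zero hc hf.1, ?_⟩
  convert hf.2.const_mul c using 1
  ring

theorem HasLogPd.logPd_eq {h : Fin n → (Fin n → ℝ) → ℝ} {j : Fin n}
    (hf : HasLogPd i (h j) L u) : logPd h j i u = L := by
  have := hf.1
  rw [logPd, hf.2.pd_eq]
  field_simp

theorem HasLogPd.hasPd_log_sqrt_abs (hf : HasLogPd i f L u) :
    HasPd i (fun v => Real.log (Real.sqrt |f v|)) L u := by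
  have h : (fun v => Real.log (Real.sqrt |f v|)) = fun v => 1 / 2 * Real.log (f v) := by
    funext v
    rw [Real.log_sqrt (abs_nonneg _), Real.log_abs]
    ring
  rw [h]
  convert (hf.2.log hf.1).const_mul (1 / 2) using 1
  have := hf.1
  field_simp

end LogPd

/-! ### The metrics of the hierarchy -/

/-- The product of the differences `u^i - u^m`, `m ≠ i`. -/
def gap (i : Fin 3) (u : Fin 3 → ℝ) : ℝ :=
  (u i - u (i + 1)) * (u i - u (i + 2))

/-- Addition in `Fin 3` is cyclic, so `i + 1` and `i + 2` are the other two indices, in some order.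
-/
theorem gap_eq {i j k : Fin 3} (hij : i ≠ j) (hik : i ≠ k) (hjk : j ≠ k) (u : Fin 3 → ℝ) :
    gap i u = (u i - u j) * (u i - u k) := by
  have h : (j = i + 1 ∧ k = i + 2) ∨ (j = i + 2 ∧ k = i + 1) := by
    revert i j k
    decide
  rcases h with ⟨rfl, rfl⟩ | ⟨rfl, rfl⟩
  · rfl
  · rw [gap, mul_comm]

variable {ν : ℝ} {u : Fin 3 → ℝ}

theorem gap_ne_zero (hu : u ∈ region ν) (i : Fin 3) : gap i u ≠ 0 := by
  obtain ⟨j, k, hij, hik, hjk⟩ := exists_others i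
  rw [gap_eq hij hik hjk]
  exact mul_ne_zero (region_ne hu hij) (region_ne hu hik)

theorem contDiff_gap (i : Fin 3) {n : WithTop ℕ∞} : ContDiff ℝ n (gap i) := by
  unfold gap
  fun_prop

theorem hasPd_coord_sub {n : ℕ} (m i j : Fin n) (u : Fin n → ℝ) :
    HasPd m (fun v => v i - v j) ((if i = m then 1 else 0) - (if j = m then 1 else 0)) u :=
  (hasPd_coord m i u).sub (hasPd_coord m j u)

theorem hasLogPd_gap (hu : u ∈ region ν) {i j : Fin 3} (hij : i ≠ j) :
    HasLogPd j (gap i) (-1 / (2 * (u i - u j))) u := by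
  obtain ⟨k, hik, hjk⟩ := exists_third hij
  have h1 := (hasPd_coord_sub j i j u).hasLogPd (region_ne hu hij)
  have h2 := (hasPd_coord_sub j i k u).hasLogPd (region_ne hu hik)
  have h3 := h1.mul h2
  rw [← funext fun v => gap_eq hij hik hjk v] at h3
  simpa [hij, hjk.symm] using h3

theorem hasLogPd_gap_self (hu : u ∈ region ν) {i j k : Fin 3} (hij : i ≠ j) (hik : i ≠ k)
    (hjk : j ≠ k) :
    HasLogPd i (gap i) (1 / (2 * (u i - u j)) + 1 / (2 * (u i - u k))) u := by
  have h1 := (hasPd_coord_sub i i j u).hasLogPd (region_ne hu hij)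
  have h2 := (hasPd_coord_sub i i k u).hasLogPd (region_ne hu hik)
  have h3 := h1.mul h2
  rw [← funext fun v => gap_eq hij hik hjk v] at h3
  simpa [hij.symm, hik.symm] using h3

/-- The logarithmic derivative `∂_i log J`. -/
def gradLogJ (ν : ℝ) (i : Fin 3) (u : Fin 3 → ℝ) : ℝ :=
  gradJ ν i u / moment ν 1 u

theorem gradLogJ_ne_zero (hu : u ∈ region ν) (i : Fin 3) : gradLogJ ν i u ≠ 0 :=
  div_ne_zero (gradJ_ne_zero hu i) (moment_pos hu 1).ne'

theorem contDiffOn_gradLogJ (ν : ℝ) (i : Fin 3) :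
    ContDiffOn ℝ (⊤ : ℕ∞) (gradLogJ ν i) (region ν) :=
  (contDiffOn_gradJ ν i).div (contDiffOn_moment ν (by norm_num)) fun _ hu => (moment_pos hu 1).ne'

theorem hasPd_gradLogJ (hu : u ∈ region ν) {i j : Fin 3} (hij : i ≠ j) :
    HasPd j (gradLogJ ν i) ((gradLogJ ν i u - gradLogJ ν j u) / (2 * (u i - u j))
      - gradLogJ ν i u * gradLogJ ν j u) u := by
  have hJ := (moment_pos hu 1).ne'
  have hd := region_ne hu hij
  refine ((hasPd_gradJ hu hij).div (hasPd_moment hu 1 j) hJ).congr_value ?_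
  simp only [gradLogJ, show momentPd ν 1 j u = gradJ ν j u from rfl]
  field_simp

/-- The closed form `-4 ∏_{m ≠ i} (u^i - u^m) (∂_i log J)²` of the metric components. -/
def baseMetric (ν : ℝ) (i : Fin 3) (u : Fin 3 → ℝ) : ℝ :=
  -4 * (gap i u * gradLogJ ν i u ^ 2)

theorem baseMetric_ne_zero (hu : u ∈ region ν) (i : Fin 3) : baseMetric ν i u ≠ 0 :=
  mul_ne_zero (by norm_num) (mul_ne_zero (gap_ne_zero hu i) (pow_ne_zero 2 (gradLogJ_ne_zero hu i)))

theorem contDiffOn_baseMetric (ν : ℝ) (i : Fin 3) :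
    ContDiffOn ℝ (⊤ : ℕ∞) (baseMetric ν i) (region ν) :=
  contDiffOn_const.mul ((contDiff_gap i).contDiffOn.mul ((contDiffOn_gradLogJ ν i).pow 2))

/-- The Euler–Poisson–Darboux equation contributes 1 / (2 (u^i - u^j)), which the derivative of the
gap factor cancels. -/
theorem hasLogPd_baseMetric (hu : u ∈ region ν) {i j : Fin 3} (hij : i ≠ j) :
    HasLogPd j (baseMetric ν i)
      (-gradLogJ ν j u / (2 * (u i - u j) * gradLogJ ν i u) - gradLogJ ν j u) u := by
  have ht := gradLogJ_ne_zero hu i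
  have hd := region_ne hu hij
  have h := ((hasLogPd_gap hu hij).mul (((hasPd_gradLogJ hu hij).hasLogPd ht).pow 2)).const_mul
    (c := -4) (by norm_num)
  refine HasLogPd.congr_value h ?_
  push_cast
  field_simp
  ring

theorem hasLogPd_baseMetric_self (hu : u ∈ region ν) {i j k : Fin 3} (hij : i ≠ j) (hik : i ≠ k)
    (hjk : j ≠ k) :
    HasLogPd i (baseMetric ν i) (1 / (2 * (u i - u j)) + 1 / (2 * (u i - u k))
      + pd i (gradLogJ ν i) u / gradLogJ ν i u) u := by
  have ht := gradLogJ_ne_zero hu i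
  have h := ((hasLogPd_gap_self hu hij hik hjk).mul (((hasPd_of_contDiffOn (i := i) (by simp)
    (isOpen_region ν) (contDiffOn_gradLogJ ν i) hu).hasLogPd ht).pow 2)).const_mul
    (c := -4) (by norm_num)
  refine HasLogPd.congr_value h ?_
  push_cast
  field_simp

/-- Eliminates the second derivative `xx` of log J, about which no equation is available: it enters
`M` with coefficient L / x, and the term (xx / x) L removes it. -/
theorem curvature_numerator {d e x y xx L M : ℝ} (hd : d ≠ 0) (he : e ≠ 0)
    (hx : x ≠ 0) (hy : y ≠ 0) (hL : L = x / (2 * d * y) - x)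
    (hM : M = (xx * y - x * ((x - y) / (2 * d) - x * y)) / (2 * d * y ^ 2)
      - x / (2 * d ^ 2 * y) - xx) :
    M + L ^ 2 - (1 / (2 * d) + 1 / (2 * e) + xx / x) * L =
      x * (x - 1 / (2 * d * y) * (1 / d + x) + 1 / (2 * d)) - L / (2 * e) := by
  subst hL hM
  field_simp
  ring

/-- All differential equations have been used by this point: the values `x`, `y`, `z` of the t_i are
arbitrary nonzero numbers. The three summands collect the terms over h_i, h_j and h_k in
R^{ij}_{ij}; their sum is linear in the coefficients of p, and those of degree 0 and 1 drop out. -/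
theorem curvature_identity {a b c x y z : ℝ}
    (hx : x ≠ 0) (hy : y ≠ 0) (hz : z ≠ 0) (hab : a - b ≠ 0) (hac : a - c ≠ 0) (hbc : b - c ≠ 0)
    (p0 p1 p2 p3 : ℝ) :
    ((p0 + p1 * a + p2 * a ^ 2 + p3 * a ^ 3) * (
        x * (x - 1 / (2 * (a - b) * y) * (1 / (a - b) + x) + 1 / (2 * (a - b))) -
          (x / (2 * (a - b) * y) - x) / (2 * (a - c)))
        + (p1 + 2 * p2 * a + 3 * p3 * a ^ 2) * (x / (2 * (a - b) * y) - x) / 2) /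
          (4 * ((a - b) * (a - c)) * x ^ 2)
      - ((p0 + p1 * b + p2 * b ^ 2 + p3 * b ^ 3) * (
        y * (y + 1 / (2 * (a - b) * x) * (-1 / (a - b) + y) - 1 / (2 * (a - b))) -
          (-y / (2 * (a - b) * x) - y) / (2 * (b - c)))
        + (p1 + 2 * p2 * b + 3 * p3 * b ^ 2) * (-y / (2 * (a - b) * x) - y) / 2) /
          (4 * ((a - b) * (b - c)) * y ^ 2)
      + (p0 + p1 * c + p2 * c ^ 2 + p3 * c ^ 3) * (-z / (2 * (a - c) * x) - z) *
          (-z / (2 * (b - c) * y) - z) / (4 * ((a - c) * (b - c)) * z ^ 2)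
      = p2 / 4 + p3 * (2 * (a + b + c) - 1 / x - 1 / y) / 8 := by
  field_simp
  ring

/-- The total contribution of one direction i to R^{ij}_{ij}: its second-derivative term together
with the summand m = i. Passing from Λ to Λ' accounts for the divisor P. -/
theorem curvature_term {P P' h L Λ Λ' M N g t : ℝ} (hP : P ≠ 0) (hg : g ≠ 0) (ht : t ≠ 0)
    (hh : h = -4 * (g * t ^ 2) / P) (hΛ : Λ' = Λ - P' / (2 * P)) (hN : M + L ^ 2 - Λ * L = N) :
    -(M + L ^ 2 - 2 * Λ' * L) / h - Λ' * L / h = (P * N + P' * L / 2) / (4 * g * t ^ 2) := by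
  subst hN hh hΛ
  field_simp
  ring

/-- The quotient of the metric by a cubic polynomial in `u^i + ν`. -/
def quotMetric (ν p0 p1 p2 p3 : ℝ) (i : Fin 3) (u : Fin 3 → ℝ) : ℝ :=
  baseMetric ν i u /
    (p0 + p1 * (u i + ν) + p2 * (u i + ν) ^ 2 + p3 * (u i + ν) ^ 3)

section Quot

variable {p0 p1 p2 p3 : ℝ} {U : Set (Fin 3 → ℝ)}

theorem contDiffOn_quotMetric (hUr : U ⊆ region ν)
    (hp : ∀ u ∈ U, ∀ i, p0 + p1 * (u i + ν) + p2 * (u i + ν) ^ 2 + p3 * (u i + ν) ^ 3 ≠ 0)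
    (i : Fin 3) : ContDiffOn ℝ (⊤ : ℕ∞) (quotMetric ν p0 p1 p2 p3 i) U :=
  ((contDiffOn_baseMetric ν i).mono hUr).div (by fun_prop) fun u hu => hp u hu i

theorem quotMetric_ne_zero (hUr : U ⊆ region ν)
    (hp : ∀ u ∈ U, ∀ i, p0 + p1 * (u i + ν) + p2 * (u i + ν) ^ 2 + p3 * (u i + ν) ^ 3 ≠ 0)
    (u : Fin 3 → ℝ) (hu : u ∈ U) (i : Fin 3) : quotMetric ν p0 p1 p2 p3 i u ≠ 0 :=
  div_ne_zero (baseMetric_ne_zero (hUr hu) i) (hp u hu i)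

theorem hasPd_cubic (i j : Fin 3) (u : Fin 3 → ℝ) :
    HasPd j (fun v => p0 + p1 * (v i + ν) + p2 * (v i + ν) ^ 2 + p3 * (v i + ν) ^ 3)
      ((p1 + 2 * p2 * (u i + ν) + 3 * p3 * (u i + ν) ^ 2) * (if i = j then 1 else 0)) u := by
  have h := hasPd_shift ν j i u
  convert (((hasPd_const p0).add (h.const_mul p1)).add ((h.pow 2).const_mul p2)).add
    ((h.pow 3).const_mul p3) using 1
  push_cast
  ring

theorem logPd_quotMetric (hu : u ∈ region ν)
    (hp : ∀ i, p0 + p1 * (u i + ν) + p2 * (u i + ν) ^ 2 + p3 * (u i + ν) ^ 3 ≠ 0)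
    {i j : Fin 3} (hij : i ≠ j) :
    logPd (quotMetric ν p0 p1 p2 p3) i j u =
      -gradLogJ ν j u / (2 * (u i - u j) * gradLogJ ν i u) - gradLogJ ν j u := by
  have h := (hasLogPd_baseMetric hu hij).div ((hasPd_cubic (ν := ν) (p0 := p0) (p1 := p1)
    (p2 := p2) (p3 := p3) i j u).hasLogPd (hp i))
  rw [if_neg hij, mul_zero, zero_div, sub_zero] at h
  exact HasLogPd.logPd_eq (h := quotMetric ν p0 p1 p2 p3) h

theorem logPd_quotMetric_self (hu : u ∈ region ν)
    (hp : ∀ i, p0 + p1 * (u i + ν) + p2 * (u i + ν) ^ 2 + p3 * (u i + ν) ^ 3 ≠ 0)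
    {i j k : Fin 3} (hij : i ≠ j) (hik : i ≠ k) (hjk : j ≠ k) :
    logPd (quotMetric ν p0 p1 p2 p3) i i u =
      1 / (2 * (u i - u j)) + 1 / (2 * (u i - u k)) + pd i (gradLogJ ν i) u / gradLogJ ν i u
        - (p1 + 2 * p2 * (u i + ν) + 3 * p3 * (u i + ν) ^ 2) /
          (2 * (p0 + p1 * (u i + ν) + p2 * (u i + ν) ^ 2 + p3 * (u i + ν) ^ 3)) := by
  have h := (hasLogPd_baseMetric_self hu hij hik hjk).div ((hasPd_cubic (ν := ν) (p0 := p0)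
    (p1 := p1) (p2 := p2) (p3 := p3) i i u).hasLogPd (hp i))
  rw [if_pos rfl, mul_one] at h
  exact HasLogPd.logPd_eq (h := quotMetric ν p0 p1 p2 p3) h

theorem pd_logPd_quotMetric (hU : IsOpen U) (hUr : U ⊆ region ν)
    (hp : ∀ u ∈ U, ∀ i, p0 + p1 * (u i + ν) + p2 * (u i + ν) ^ 2 + p3 * (u i + ν) ^ 3 ≠ 0)
    (hu : u ∈ U) {i j : Fin 3} (hij : i ≠ j) (k : Fin 3) :
    pd k (logPd (quotMetric ν p0 p1 p2 p3) i j) u =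
      (-pd k (gradLogJ ν j) u * (2 * (u i - u j) * gradLogJ ν i u)
        + gradLogJ ν j u * (2 * ((if i = k then 1 else 0) - (if j = k then 1 else 0))
          * gradLogJ ν i u + 2 * (u i - u j) * pd k (gradLogJ ν i) u)) /
        (2 * (u i - u j) * gradLogJ ν i u) ^ 2 - pd k (gradLogJ ν j) u := by
  have ht : ∀ m, HasPd k (gradLogJ ν m) (pd k (gradLogJ ν m) u) u := fun m =>
    hasPd_of_contDiffOn (by simp) (isOpen_region ν) (contDiffOn_gradLogJ ν m) (hUr hu)
  have h := ((ht j).neg.div (((hasPd_coord_sub k i j u).const_mul 2).mul (ht i))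
    (mul_ne_zero (mul_ne_zero two_ne_zero (region_ne (hUr hu) hij))
      (gradLogJ_ne_zero (hUr hu) i))).sub (ht j)
  rw [(HasPd.congr_on hU hu (fun v hv => logPd_quotMetric (hUr hv) (hp v hv) hij) h).pd_eq]
  ring

/-- The curvature of the metrics `g_{ii} / p(u^i + ν)` with `p` a cubic polynomial. -/
theorem riemann_quotMetric (hU : IsOpen U) (hUr : U ⊆ region ν)
    (hp : ∀ u ∈ U, ∀ i, p0 + p1 * (u i + ν) + p2 * (u i + ν) ^ 2 + p3 * (u i + ν) ^ 3 ≠ 0)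
    (hu : u ∈ U) (i j k l : Fin 3) :
    riemann (diag (quotMetric ν p0 p1 p2 p3)) i j k l u = quotMetric ν p0 p1 p2 p3 j u *
      (p2 / 4 + p3 * (2 * (u 0 + u 1 + u 2 + 3 * ν) - 1 / gradLogJ ν i u - 1 / gradLogJ ν j u) / 8)
      * ((if i = k ∧ j = l then 1 else 0) - (if i = l ∧ j = k then 1 else 0)) := by
  refine riemann_diag (K := fun i j u => p2 / 4 + p3 * (2 * (u 0 + u 1 + u 2 + 3 * ν)
    - 1 / gradLogJ ν i u - 1 / gradLogJ ν j u) / 8) hU (contDiffOn_quotMetric hUr hp)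
    (quotMetric_ne_zero hUr hp) ?_ ?_ hu i j k l
  · intro u hu i j k hij hik hjk
    have hr := hUr hu
    rw [pd_logPd_quotMetric hU hUr hp hu hij, logPd_quotMetric hr (hp u hu) hij,
      logPd_quotMetric hr (hp u hu) hik, logPd_quotMetric hr (hp u hu) hjk,
      logPd_quotMetric hr (hp u hu) hjk.symm, (hasPd_gradLogJ hr hik).pd_eq,
      (hasPd_gradLogJ hr hjk).pd_eq, if_neg hik, if_neg hjk]
    have h1 := region_ne hr hij
    have h2 := region_ne hr hik
    have h3 := region_ne hr hjk
    have h4 : u k - u j ≠ 0 := region_ne hr hjk.symm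
    have t1 := gradLogJ_ne_zero hr i
    have t2 := gradLogJ_ne_zero hr j
    have t3 := gradLogJ_ne_zero hr k
    rw [show u k - u j = -(u j - u k) by ring]
    field_simp
    ring
  · intro u hu i j hij
    obtain ⟨k, hik, hjk⟩ := exists_third hij
    have hr := hUr hu
    have hpi := hp u hu i
    have hpj := hp u hu j
    have hpk := hp u hu k
    have h1 := region_ne hr hij
    have h2 := region_ne hr hik
    have h3 := region_ne hr hjk
    have t1 := gradLogJ_ne_zero hr i
    have t2 := gradLogJ_ne_zero hr j
    have t3 := gradLogJ_ne_zero hr k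
    have hs : u 0 + u 1 + u 2 + 3 * ν = (u i + ν) + (u j + ν) + (u k + ν) := by
      rw [← sum_eq_of_pairwise_ne hij hik hjk (fun m => u m + ν), Fin.sum_univ_three]
      ring
    have hLji : logPd (quotMetric ν p0 p1 p2 p3) j i u =
        gradLogJ ν i u / (2 * (u i - u j) * gradLogJ ν j u) - gradLogJ ν i u := by
      rw [logPd_quotMetric hr (hp u hu) hij.symm, show u j - u i = -(u i - u j) by ring]
      field_simp
    have hLij := logPd_quotMetric hr (hp u hu) hij
    have hNi := curvature_numerator (M := pd i (logPd (quotMetric ν p0 p1 p2 p3) j i) u)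
      (xx := pd i (gradLogJ ν i) u) h1 h2 t1 t2 hLji (by
        rw [pd_logPd_quotMetric hU hUr hp hu hij.symm, (hasPd_gradLogJ hr hij.symm).pd_eq,
          if_neg hij.symm, if_pos rfl, show u j - u i = -(u i - u j) by ring]
        field_simp
        ring)
    -- The same computation with `i` and `j` exchanged, so `d` changes sign.
    have hNj := curvature_numerator (d := -(u i - u j))
      (L := logPd (quotMetric ν p0 p1 p2 p3) i j u)
      (M := pd j (logPd (quotMetric ν p0 p1 p2 p3) i j) u)
      (xx := pd j (gradLogJ ν j) u) (neg_ne_zero.2 h1) h3 t2 t1 (by rw [hLij, mul_neg, neg_mul, div_neg, neg_div]) (by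
        rw [pd_logPd_quotMetric hU hUr hp hu hij, (hasPd_gradLogJ hr hij).pd_eq,
          if_neg hij, if_pos rfl]
        field_simp
        ring)
    -- The polynomial is evaluated at the shifted points u^m + ν, while differences are unaffected
    -- by the shift.
    have key := curvature_identity t1 t2 t3 (a := u i + ν) (b := u j + ν) (c := u k + ν)
      (by simpa using h1) (by simpa using h2) (by simpa using h3) p0 p1 p2 p3
    simp only [add_sub_add_right_eq_sub] at key
    rw [sum_eq_of_pairwise_ne hij hik hjk, hs, ← key]
    have hLii := logPd_quotMetric_self hr (hp u hu) hij hik hjk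
    have hLjj := logPd_quotMetric_self hr (hp u hu) hij.symm hjk hik
    rw [show u j - u i = -(u i - u j) by ring] at hLjj
    have hA := curvature_term hpi (gap_ne_zero hr i) t1 (rfl : quotMetric ν p0 p1 p2 p3 i u = _)
      hLii hNi
    have hB := curvature_term hpj (gap_ne_zero hr j) t2 (rfl : quotMetric ν p0 p1 p2 p3 j u = _)
      hLjj hNj
    have hC : logPd (quotMetric ν p0 p1 p2 p3) i k u * logPd (quotMetric ν p0 p1 p2 p3) j k u /
        quotMetric ν p0 p1 p2 p3 k u =
        -((p0 + p1 * (u k + ν) + p2 * (u k + ν) ^ 2 + p3 * (u k + ν) ^ 3) *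
          (-gradLogJ ν k u / (2 * (u i - u k) * gradLogJ ν i u) - gradLogJ ν k u) *
          (-gradLogJ ν k u / (2 * (u j - u k) * gradLogJ ν j u) - gradLogJ ν k u) /
          (4 * ((u i - u k) * (u j - u k)) * gradLogJ ν k u ^ 2)) := by
      rw [logPd_quotMetric hr (hp u hu) hik, logPd_quotMetric hr (hp u hu) hjk, quotMetric,
        baseMetric, gap_eq hik.symm hjk.symm hij, show u k - u i = -(u i - u k) by ring,
        show u k - u j = -(u j - u k) by ring]
      field_simp
    rw [hC]
    rw [gap_eq hij hik hjk, hLji] at hA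
    rw [gap_eq hij.symm hjk hik, hLij, show u j - u i = -(u i - u j) by ring] at hB
    have hB' : ∀ w : ℝ, w / (4 * (-(u i - u j) * (u j - u k)) * gradLogJ ν j u ^ 2) =
        -(w / (4 * ((u i - u j) * (u j - u k)) * gradLogJ ν j u ^ 2)) := by
      intro w
      rw [← div_neg]
      congr 1
      ring
    rw [hB'] at hB
    rw [hLij, hLji]
    simp only [mul_neg, neg_mul, div_neg] at hB
    linear_combination -hA - hB

end Quot

end

section

variable {ν : ℝ} {u : Fin 3 → ℝ}

/-! ### The residues -/

theorem curveRC_eq {i j k : Fin 3} (hij : i ≠ j) (hik : i ≠ k) (hjk : j ≠ k) (z : ℂ) :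
    curveRC ν u z = (z - u i) * ((z + ν) * ((z - u j) * (z - u k))) := by
  have hp := prod_eq_of_pairwise_ne hij hik hjk (fun m => z - (u m : ℂ))
  rw [Fin.prod_univ_three] at hp
  rw [curveRC]
  linear_combination (z + ν) * hp

theorem polyTwo_neg (hu : u ∈ region ν) :
    polyTwo ν u (-ν : ℂ) = (((u 0 + u 1 + u 2 + 3 * ν) / 2 * moment ν 1 u - moment ν 2 u)
      / moment ν 0 u : ℝ) := by
  have h0 := (moment_pos hu 0).ne'
  have h : (-ν) ^ 2 - (1 / 2) * (u 0 + u 1 + u 2 - ν) * (-ν) + gammaTwo ν u =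
      ((u 0 + u 1 + u 2 + 3 * ν) / 2 * moment ν 1 u - moment ν 2 u) / moment ν 0 u := by
    rw [gammaTwo, periodI_zero, periodI_one hu, periodI_two hu]
    field_simp
    ring
  rw [← h, polyTwo]
  push_cast
  ring

/-- In terms of shifted moments, P_ν(u^i) is -1 / (2 I₀) times the right-hand side of `gradJ_mul`.
This is how the normalised differential Ω_ν produces ∂_i J. -/
theorem fracNu_branch (hu : u ∈ region ν) (i : Fin 3) :
    fracNu ν u (u i) = (-(gap i u * gradJ ν i u) / moment ν 0 u : ℝ) := by
  obtain ⟨j, k, hij, hik, hjk⟩ := exists_others i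
  have h0 := (moment_pos hu 0).ne'
  have hv := (region_pos hu i).ne'
  have hg := gradJ_mul hu hij hik hjk
  rw [← gap_eq hij hik hjk] at hg
  have hs := sum_eq_of_pairwise_ne hij hik hjk (fun m => u m + ν)
  have hp : (ν + u 0) * (ν + u 1) * (ν + u 2) = (u i + ν) * ((u j + ν) * (u k + ν)) := by
    have hp := prod_eq_of_pairwise_ne hij hik hjk (fun m => u m + ν)
    rw [← hp, Fin.prod_univ_three]
    ring
  have h : -((ν + u 0) * (ν + u 1) * (ν + u 2)) / (2 * (u i + ν)) +
      ((u 0 + u 1 + u 2 + 3 * ν) / 2 * moment ν 1 u - moment ν 2 u) / moment ν 0 u =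
      -(gap i u * gradJ ν i u) / moment ν 0 u := by
    rw [Fin.sum_univ_three] at hg
    rw [hp]
    field_simp
    linear_combination hg
  rw [← h, fracNu, polyTwo_neg hu]
  push_cast
  ring

theorem polyOne_neg (hu : u ∈ region ν) :
    polyOne ν u (-ν : ℂ) = (-(moment ν 1 u / moment ν 0 u) : ℝ) := by
  have h0 := (moment_pos hu 0).ne'
  have h : -ν + gammaOne ν u = -(moment ν 1 u / moment ν 0 u) := by
    rw [gammaOne, periodI_zero, periodI_one hu]
    field_simp
    ring
  rw [← h, polyOne]
  push_cast
  ring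

theorem ofReal_sub_ne {a b : ℝ} (h : a - b ≠ 0) : (a : ℂ) - b ≠ 0 := by
  exact_mod_cast h

/-- R has a simple zero at u^i, so Ω_ν² has a simple pole there and only the value of P_ν at the
branch point matters. Squaring removes the branches of the roots. -/
theorem residue_omegaNu (hu : u ∈ region ν) (i : Fin 3) :
    residue (fun z => omegaNu ν u z ^ 2) (u i : ℂ) =
      ((-(gap i u * gradJ ν i u) / moment ν 0 u) ^ 2 / ((u i + ν) * gap i u *
        ((-ν - u 0) * (-ν - u 1) * (-ν - u 2))) : ℝ) := by
  obtain ⟨j, k, hij, hik, hjk⟩ := exists_others i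
  set c : ℂ := (-ν - u 0 : ℂ) * (-ν - u 1) * (-ν - u 2) with hc
  have hc0 : c ≠ 0 := by
    have h : (-ν - u 0) * (-ν - u 1) * (-ν - u 2) ≠ 0 := by
      rw [show (-ν - u 0) * (-ν - u 1) * (-ν - u 2)
        = -((u 0 + ν) * (u 1 + ν) * (u 2 + ν)) by ring]
      exact neg_ne_zero.2 (mul_ne_zero (mul_ne_zero (region_pos hu 0).ne' (region_pos hu 1).ne')
        (region_pos hu 2).ne')
    rw [hc]
    exact_mod_cast h
  have hvi : (u i : ℂ) + ν ≠ 0 := by exact_mod_cast (region_pos hu i).ne'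
  have key := residue_of_simplePole (f := fun z => omegaNu ν u z ^ 2) (z₀ := (u i : ℂ))
    (h := fun z => fracNu ν u z ^ 2 / ((z + ν) * ((z - u j) * (z - u k)) * c))
    (U := {z | z + ν ≠ 0} ∩ {z | z - u j ≠ 0} ∩ {z | z - u k ≠ 0}) ?_ ?_ ?_
  · rw [key]
    simp only [fracNu_branch hu, hc, gap_eq hij hik hjk]
    push_cast
    ring
  · refine IsOpen.mem_nhds ?_ ⟨⟨hvi, ofReal_sub_ne (region_ne hu hij)⟩,
      ofReal_sub_ne (region_ne hu hik)⟩
    exact ((isOpen_ne_fun (by fun_prop) (by fun_prop)).inter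
      (isOpen_ne_fun (by fun_prop) (by fun_prop))).inter (isOpen_ne_fun (by fun_prop) (by fun_prop))
  · rintro z ⟨⟨h1, h2⟩, h3⟩
    refine DifferentiableAt.differentiableWithinAt ?_
    have h1' : z + ν ≠ 0 := h1
    have h2' : z - u j ≠ 0 := h2
    have h3' : z - u k ≠ 0 := h3
    unfold fracNu
    refine DifferentiableAt.div ?_ (by fun_prop)
      (mul_ne_zero (mul_ne_zero h1' (mul_ne_zero h2' h3')) hc0)
    refine DifferentiableAt.pow (DifferentiableAt.add_const _ ?_) 2
    exact DifferentiableAt.div (by fun_prop) (by fun_prop) (mul_ne_zero two_ne_zero h1')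
  · rintro z - hz
    have hz' : z - u i ≠ 0 := sub_ne_zero.2 hz
    simp only [omegaNu, div_pow, mul_pow, complex_sqrt_sq, curveRC_eq hij hik hjk, ← hc]
    rw [div_eq_mul_inv, div_eq_mul_inv, mul_assoc (z - (u i : ℂ)), mul_inv (z - (u i : ℂ))]
    ring

theorem residue_sigmaOne (hu : u ∈ region ν) :
    residue (fun z => sigmaOne ν u z ^ 2) (-ν : ℂ) =
      ((moment ν 1 u / moment ν 0 u) ^ 2 / ((-ν - u 0) * (-ν - u 1) * (-ν - u 2)) : ℝ) := by
  have hne : ∀ i, (-ν : ℂ) - u i ≠ 0 := by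
    intro i
    have := region_pos hu i
    have h : -ν - u i ≠ 0 := by intro h; linarith
    exact_mod_cast h
  have key := residue_of_simplePole (f := fun z => sigmaOne ν u z ^ 2) (z₀ := (-ν : ℂ))
    (h := fun z => polyOne ν u z ^ 2 / ((z - u 0) * (z - u 1) * (z - u 2)))
    (U := {z | z - u 0 ≠ 0} ∩ {z | z - u 1 ≠ 0} ∩ {z | z - u 2 ≠ 0}) ?_ ?_ ?_
  · rw [key]
    simp only [polyOne_neg hu]
    push_cast
    ring
  · refine IsOpen.mem_nhds ?_ ⟨⟨hne 0, hne 1⟩, hne 2⟩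
    exact ((isOpen_ne_fun (by fun_prop) (by fun_prop)).inter
      (isOpen_ne_fun (by fun_prop) (by fun_prop))).inter (isOpen_ne_fun (by fun_prop) (by fun_prop))
  · rintro z ⟨⟨h1, h2⟩, h3⟩
    refine DifferentiableAt.differentiableWithinAt ?_
    unfold polyOne
    exact DifferentiableAt.div (by fun_prop) (by fun_prop) (mul_ne_zero (mul_ne_zero h1 h2) h3)
  · rintro z - hz
    simp only [sigmaOne, div_pow, complex_sqrt_sq, curveRC, sub_neg_eq_add]
    rw [div_eq_mul_inv, div_eq_mul_inv, mul_assoc (z + (ν : ℂ)), mul_assoc (z + (ν : ℂ)),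
      mul_inv (z + (ν : ℂ)), mul_assoc (z - (u 0 : ℂ))]
    ring

theorem metricExpr_eq (hu : u ∈ region ν) (i : Fin 3) :
    metricExpr ν i u = (baseMetric ν i u : ℂ) := by
  rw [metricExpr, residue_omegaNu hu, residue_sigmaOne hu]
  have h0 := (moment_pos hu 0).ne'
  have h1 := (moment_pos hu 1).ne'
  have hg := gap_ne_zero hu i
  have hi := (region_pos hu i).ne'
  have hne : ∀ m, -ν - u m ≠ 0 := fun m h => (region_pos hu m).ne' (by linarith)
  have hn0 := hne 0
  have hn1 := hne 1
  have hn2 := hne 2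
  have h : baseMetric ν i u = -4 * (u i + ν) *
      ((-(gap i u * gradJ ν i u) / moment ν 0 u) ^ 2 / ((u i + ν) * gap i u *
        ((-ν - u 0) * (-ν - u 1) * (-ν - u 2))) /
      ((moment ν 1 u / moment ν 0 u) ^ 2 / ((-ν - u 0) * (-ν - u 1) * (-ν - u 2)))) := by
    rw [baseMetric, gradLogJ]
    field_simp
  rw [h]
  push_cast
  ring

theorem chMetric_eq (hu : u ∈ region ν) (i : Fin 3) : chMetric ν i u = baseMetric ν i u := by
  rw [chMetric, metricExpr_eq hu, Complex.ofReal_re]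

/-! ### The speeds -/

theorem waveNumber_eq (ν : ℝ) (u : Fin 3 → ℝ) :
    waveNumber ν u = 2 * Real.pi / moment ν 1 u := by
  simp [waveNumber, moment, div_eq_mul_inv]

theorem hasPd_waveNumber (hu : u ∈ region ν) (i : Fin 3) :
    HasPd i (waveNumber ν) (-(2 * Real.pi) * gradJ ν i u / moment ν 1 u ^ 2) u := by
  have h := (hasPd_const (i := i) (u := u) (2 * Real.pi)).div (hasPd_moment hu 1 i)
    (moment_pos hu 1).ne'
  rw [← funext fun v => waveNumber_eq ν v] at h
  refine h.congr_value ?_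
  rw [gradJ]
  ring

theorem pd_waveNumber_ne_zero (hu : u ∈ region ν) (i : Fin 3) : pd i (waveNumber ν) u ≠ 0 := by
  rw [(hasPd_waveNumber hu i).pd_eq]
  exact div_ne_zero (mul_ne_zero (neg_ne_zero.2 (mul_ne_zero two_ne_zero Real.pi_ne_zero))
    (gradJ_ne_zero hu i)) (pow_ne_zero 2 (moment_pos hu 1).ne')

/-- With V = 2ν + u¹ + u² + u³ and ω = V k, the quotient is V + k / ∂_i k, and ∂_i log k = -∂_i log
J. -/
theorem speed_eq (hu : u ∈ region ν) (i : Fin 3) :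
    speed ν i u = 2 * ν + u 0 + u 1 + u 2 - 1 / gradLogJ ν i u := by
  have hs : HasPd i (fun v : Fin 3 → ℝ => 2 * ν + v 0 + v 1 + v 2) 1 u := by
    refine ((((hasPd_const (2 * ν)).add (hasPd_coord i 0 u)).add (hasPd_coord i 1 u)).add
      (hasPd_coord i 2 u)).congr_value ?_
    fin_cases i <;> simp
  have h : HasPd i (frequency ν) _ u := hs.mul (hasPd_waveNumber hu i)
  rw [speed, h.pd_eq, (hasPd_waveNumber hu i).pd_eq, waveNumber_eq, gradLogJ]
  have := gradJ_ne_zero hu i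
  have := (moment_pos hu 1).ne'
  have := Real.pi_ne_zero
  field_simp
  ring

theorem contDiffOn_speed (ν : ℝ) (i : Fin 3) :
    ContDiffOn ℝ (⊤ : ℕ∞) (speed ν i) (region ν) := by
  refine ContDiffOn.congr ?_ fun u hu => speed_eq hu i
  exact (by fun_prop : ContDiffOn ℝ (⊤ : ℕ∞) (fun u : Fin 3 → ℝ => 2 * ν + u 0 + u 1 + u 2)
    (region ν)).sub (contDiffOn_const.div (contDiffOn_gradLogJ ν i)
      fun u hu => gradLogJ_ne_zero hu i)

/-- The cofactor of the difference of speeds is the logarithmic derivative found in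
`hasLogPd_baseMetric`, so this already is Tsarev's relation. -/
theorem hasPd_speed (hu : u ∈ region ν) {i j : Fin 3} (hij : i ≠ j) :
    HasPd j (speed ν i) ((speed ν j u - speed ν i u) *
      (-gradLogJ ν j u / (2 * (u i - u j) * gradLogJ ν i u) - gradLogJ ν j u)) u := by
  have hti := gradLogJ_ne_zero hu i
  have htj := gradLogJ_ne_zero hu j
  have hd := region_ne hu hij
  have hs : HasPd j (fun v : Fin 3 → ℝ => 2 * ν + v 0 + v 1 + v 2) 1 u := by
    refine ((((hasPd_const (2 * ν)).add (hasPd_coord j 0 u)).add (hasPd_coord j 1 u)).add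
      (hasPd_coord j 2 u)).congr_value ?_
    fin_cases j <;> simp
  refine (HasPd.congr_on (isOpen_region ν) hu (fun v hv => speed_eq hv i)
    (hs.sub ((hasPd_const 1).div (hasPd_gradLogJ hu hij) hti))).congr_value ?_
  rw [speed_eq hu, speed_eq hu]
  field_simp
  ring

/-! ### Tsarev's relations -/

theorem HasLogPd.congr_on {n : ℕ} {f g : (Fin n → ℝ) → ℝ} {L : ℝ} {u : Fin n → ℝ} {i : Fin n}
    {U : Set (Fin n → ℝ)} (hU : IsOpen U)
    (hu : u ∈ U) (hfg : ∀ v ∈ U, f v = g v) (h : HasLogPd i g L u) : HasLogPd i f L u := by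
  refine ⟨by rw [hfg u hu]; exact h.1, HasPd.congr_on hU hu hfg ?_⟩
  rw [hfg u hu]
  exact h.2

/-- The derivatives of the speeds are known, so the relations compare the logarithmic derivatives of
`h` with those of the metric. Where two speeds coincide they say nothing, hence the product form. -/
theorem tsarevOn_iff {h : Fin 3 → (Fin 3 → ℝ) → ℝ} {L : Fin 3 → Fin 3 → (Fin 3 → ℝ) → ℝ}
    (hL : ∀ u ∈ region ν, ∀ i j, i ≠ j → HasLogPd j (h i) (L i j u) u) :
    TsarevOn (region ν) (speed ν) h ↔ ∀ u ∈ region ν, ∀ i j, i ≠ j →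
      (speed ν j u - speed ν i u) * (L i j u
        - (-gradLogJ ν j u / (2 * (u i - u j) * gradLogJ ν i u) - gradLogJ ν j u)) = 0 := by
  refine forall₂_congr fun u hu => forall_congr' fun i => forall_congr' fun j =>
    forall_congr' fun hij => ?_
  rw [(hasPd_speed hu hij).pd_eq, (hL u hu i j hij).hasPd_log_sqrt_abs.pd_eq]
  constructor <;> intro h <;> linear_combination -h

theorem hasLogPd_chMetric (hu : u ∈ region ν) {i j : Fin 3} (hij : i ≠ j) :
    HasLogPd j (chMetric ν i)
      (-gradLogJ ν j u / (2 * (u i - u j) * gradLogJ ν i u) - gradLogJ ν j u) u :=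
  HasLogPd.congr_on (isOpen_region ν) hu (fun _ hv => chMetric_eq hv i) (hasLogPd_baseMetric hu hij)

theorem tsarevOn_chMetric (ν : ℝ) : TsarevOn (region ν) (speed ν) (chMetric ν) := by
  rw [tsarevOn_iff fun u hu i j hij => hasLogPd_chMetric hu hij]
  intro u hu i j hij
  rw [sub_self, mul_zero]

theorem speed_ne_of_gradJ_ne (hu : u ∈ region ν) {i j : Fin 3} (h : gradJ ν i u ≠ gradJ ν j u) :
    speed ν j u - speed ν i u ≠ 0 := by
  rw [speed_eq hu, speed_eq hu]
  have hi := gradJ_ne_zero hu i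
  have hj := gradJ_ne_zero hu j
  have hJ := (moment_pos hu 1).ne'
  intro h0
  apply h
  rw [gradLogJ, gradLogJ] at h0
  field_simp at h0
  rcases mul_eq_zero.1 (show moment ν 1 u * (gradJ ν j u - gradJ ν i u) = 0 by
    linear_combination h0) with h1 | h1
  · exact absurd h1 hJ
  · linarith

/-- Two speeds can coincide on lines parallel to the third axis only at isolated points. -/
theorem eventually_gradJ_ne (hu : u ∈ region ν) {i j : Fin 3} (hij : i ≠ j) :
    ∀ᶠ s in 𝓝[≠] (0 : ℝ), gradJ ν i (u + s • Pi.single 2 1) ≠ gradJ ν j (u + s • Pi.single 2 1) := by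
  have hd : ∀ k, HasPd 2 (gradJ ν k) (pd 2 (gradJ ν k) u) u := fun k =>
    hasPd_of_contDiffOn (by simp) (isOpen_region ν) (contDiffOn_gradJ ν k) hu
  have hf : HasDerivAt (fun s : ℝ => gradJ ν i (u + s • Pi.single 2 1)
      - gradJ ν j (u + s • Pi.single 2 1)) _ 0 := (hd i).sub (hd j)
  suffices h : ∀ᶠ s in 𝓝[≠] (0 : ℝ), gradJ ν i (u + s • Pi.single 2 1)
      - gradJ ν j (u + s • Pi.single 2 1) ≠ 0 from h.mono fun s hs => sub_ne_zero.1 hs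
  rcases eq_or_ne (gradJ ν i u) (gradJ ν j u) with he | he
  · have hi : i ≠ 2 := by
      rintro rfl
      have h0 := gradJ_zero_pos hu
      have h1 := gradJ_one_pos hu
      have h2 := gradJ_two_neg hu
      fin_cases j <;> simp at hij he <;> linarith
    have hj : j ≠ 2 := by
      rintro rfl
      have h0 := gradJ_zero_pos hu
      have h1 := gradJ_one_pos hu
      have h2 := gradJ_two_neg hu
      fin_cases i <;> simp at hij he <;> linarith
    have hi2 : gradJ ν i u - gradJ ν 2 u ≠ 0 := by
      have h0 := gradJ_zero_pos hu
      have h1 := gradJ_one_pos hu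
      have h2 := gradJ_two_neg hu
      fin_cases i <;> simp at hi ⊢ <;> intro h <;> linarith
    -- At a coincidence the Euler–Poisson–Darboux equations give the difference a nonzero derivative
    -- along the third axis, so its zero is isolated.
    refine hf.eventually_ne ?_
    rw [(hasPd_gradJ hu hi).pd_eq, (hasPd_gradJ hu hj).pd_eq, ← he]
    have h1 := region_ne hu hi
    have h2 := region_ne hu hj
    have h3 := region_ne hu hij
    have e : (gradJ ν i u - gradJ ν 2 u) / (2 * (u i - u 2))
        - (gradJ ν i u - gradJ ν 2 u) / (2 * (u j - u 2)) =
        -((gradJ ν i u - gradJ ν 2 u) * (u i - u j)) / (2 * (u i - u 2) * (u j - u 2)) := by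
      field_simp
      ring
    rw [e]
    exact div_ne_zero (neg_ne_zero.2 (mul_ne_zero hi2 h3))
      (mul_ne_zero (mul_ne_zero two_ne_zero h1) h2)
  · have h0 := hf.continuousAt.eventually_ne (y := 0) (by simpa [sub_eq_zero] using he)
    exact h0.filter_mono nhdsWithin_le_nhds

/-- Along the segment from `a` to `b`, which convexity keeps inside `U`, the i-th coordinate is
constant, so only vanishing partial derivatives contribute. -/
theorem eq_of_hasPd_eq_zero {U : Set (Fin 3 → ℝ)} (hU : IsOpen U) (hconv : Convex ℝ U)
    {q : (Fin 3 → ℝ) → ℝ} (hq : DifferentiableOn ℝ q U) {i : Fin 3}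
    (h0 : ∀ u ∈ U, ∀ j, i ≠ j → pd j q u = 0) {a b : Fin 3 → ℝ} (ha : a ∈ U) (hb : b ∈ U)
    (hab : a i = b i) : q a = q b := by
  have hmem : ∀ s ∈ Set.Icc (0 : ℝ) 1, a + s • (b - a) ∈ U := fun s hs =>
    hconv.add_smul_sub_mem ha hb hs
  have hd : ∀ s ∈ Set.Icc (0 : ℝ) 1, HasDerivAt (fun s : ℝ => q (a + s • (b - a))) 0 s := by
    intro s hs
    have hqs := (hq.differentiableAt (hU.mem_nhds (hmem s hs))).hasFDerivAt
    have hline : HasDerivAt (fun s : ℝ => a + s • (b - a)) (b - a) s := by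
      simpa using ((hasDerivAt_id s).smul_const (b - a)).const_add a
    have h := hqs.comp_hasDerivAt s hline
    refine h.congr_deriv ?_
    have hdec : b - a = ∑ m, (b m - a m) • (Pi.single m 1 : Fin 3 → ℝ) := by
      ext m
      simp [Finset.sum_apply, Pi.single_apply]
    rw [congrArg (fderiv ℝ q (a + s • (b - a))) hdec, map_sum]
    refine Finset.sum_eq_zero fun m _ => ?_
    rw [map_smul]
    rcases eq_or_ne i m with rfl | him
    · simp [hab]
    · have := h0 _ (hmem s hs) m him
      rw [(hasPd_of_hasFDerivAt hqs).pd_eq] at this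
      rw [this, smul_zero]
  obtain ⟨c, hc, hslope⟩ := exists_hasDerivAt_eq_slope (fun s : ℝ => q (a + s • (b - a)))
    (fun _ => 0) zero_lt_one (fun s hs => (hd s hs).continuousAt.continuousWithinAt)
    (fun s hs => hd s ⟨hs.1.le, hs.2.le⟩)
  simp at hslope
  linarith

theorem convex_region (ν : ℝ) : Convex ℝ (region ν) := by
  intro a ha b hb s t hs ht hst
  obtain ⟨a1, a2, a3⟩ := ha
  obtain ⟨b1, b2, b3⟩ := hb
  have hlin : ∀ x y x' y' : ℝ, x < x' → y < y' → s * x + t * y < s * x' + t * y' := by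
    intro x y x' y' h1 h2
    rcases hs.eq_or_lt with rfl | hs
    · have : t = 1 := by linarith
      subst this
      linarith
    · have := mul_lt_mul_of_pos_left h1 hs
      have := mul_le_mul_of_nonneg_left h2.le ht
      linarith
  refine ⟨?_, ?_, ?_⟩
  · have := hlin _ _ _ _ a1 b1
    simp only [Pi.add_apply, Pi.smul_apply, smul_eq_mul]
    have e : s * -ν + t * -ν = -ν := by rw [← add_mul, hst, one_mul]
    linarith
  · exact hlin _ _ _ _ a2 b2
  · exact hlin _ _ _ _ a3 b3

/-- Tsarev's relations determine the metric up to factors `f_i(u^i)`. -/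
theorem tsarevOn_iff_exists {h : Fin 3 → (Fin 3 → ℝ) → ℝ}
    (hs : ∀ i, ContDiffOn ℝ 1 (h i) (region ν)) (h0 : ∀ i, ∀ u ∈ region ν, h i u ≠ 0) :
    TsarevOn (region ν) (speed ν) h ↔ ∃ f : Fin 3 → ℝ → ℝ, ∀ i, ∀ u ∈ region ν,
      h i u = f i (u i) * chMetric ν i u := by
  have hg0 : ∀ i, ∀ u ∈ region ν, chMetric ν i u ≠ 0 := fun i u hu => by
    rw [chMetric_eq hu]; exact baseMetric_ne_zero hu i
  have hgs : ∀ i, ContDiffOn ℝ 1 (chMetric ν i) (region ν) := fun i =>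
    ((contDiffOn_baseMetric ν i).of_le (by
      exact_mod_cast (le_top : (1 : ℕ∞) ≤ ⊤))).congr fun u hu => chMetric_eq hu i
  constructor
  · intro hT
    have hL : ∀ u ∈ region ν, ∀ i j, i ≠ j → HasLogPd j (h i) (logPd h i j u) u :=
      fun u hu i j _ => (hasPd_of_contDiffOn one_ne_zero (isOpen_region ν) (hs i) hu).hasLogPd
        (h0 i u hu)
    rw [tsarevOn_iff hL] at hT
    have hpd : ∀ i j, ContinuousOn (pd j (h i)) (region ν) := by
      intro i j
      have h1 : ContinuousOn (fun u => fderiv ℝ (h i) u (Pi.single j 1)) (region ν) :=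
        ((hs i).continuousOn_fderiv_of_isOpen (isOpen_region ν) le_rfl).clm_apply
          continuousOn_const
      refine h1.congr fun u hu => ?_
      exact (hasPd_of_hasFDerivAt (((hs i).contDiffAt
        ((isOpen_region ν).mem_nhds hu)).differentiableAt one_ne_zero).hasFDerivAt).pd_eq
    have hzero : ∀ u ∈ region ν, ∀ i j, i ≠ j → logPd h i j u =
        -gradLogJ ν j u / (2 * (u i - u j) * gradLogJ ν i u) - gradLogJ ν j u := by
      intro u hu i j hij
      set D : (Fin 3 → ℝ) → ℝ := fun u => logPd h i j u
        - (-gradLogJ ν j u / (2 * (u i - u j) * gradLogJ ν i u) - gradLogJ ν j u) with hD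
      have ht := fun k => (contDiffOn_gradLogJ ν k).continuousOn
      have hDc : ContinuousOn D (region ν) := by
        refine ContinuousOn.sub ((hpd i j).div (continuousOn_const.mul (hs i).continuousOn)
          fun u hu => mul_ne_zero two_ne_zero (h0 i u hu)) (((ht j).neg.div
          (ContinuousOn.mul (by fun_prop) (ht i)) fun u hu => mul_ne_zero
            (mul_ne_zero two_ne_zero (region_ne hu hij)) (gradLogJ_ne_zero hu i)).sub (ht j))
      have hcont : Continuous fun s : ℝ => u + s • (Pi.single 2 1 : Fin 3 → ℝ) := by fun_prop
      have hlim : Tendsto (fun s : ℝ => u + s • (Pi.single 2 1 : Fin 3 → ℝ)) (𝓝 0) (𝓝 u) := by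
        simpa using hcont.tendsto 0
      have h1 : Tendsto (fun s : ℝ => D (u + s • Pi.single 2 1)) (𝓝[≠] 0) (𝓝 (D u)) :=
        ((hDc.continuousAt ((isOpen_region ν).mem_nhds hu)).tendsto.comp hlim).mono_left
          nhdsWithin_le_nhds
      -- Off s = 0 the speeds differ and `D` is zero; continuity, which needs `h` to be C¹, extends
      -- this to `u` itself.
      have h2 : Tendsto (fun s : ℝ => D (u + s • Pi.single 2 1)) (𝓝[≠] 0) (𝓝 0) := by
        refine tendsto_const_nhds.congr' ?_
        filter_upwards [eventually_gradJ_ne hu hij, nhdsWithin_le_nhds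
          (hlim.eventually ((isOpen_region ν).mem_nhds hu))] with s hs1 hs2
        exact ((mul_eq_zero.1 (hT _ hs2 i j hij)).resolve_left (speed_ne_of_gradJ_ne hs2 hs1)).symm
      exact sub_eq_zero.1 (tendsto_nhds_unique h1 h2)
    have hq : ∀ i, ∀ a ∈ region ν, ∀ b ∈ region ν, a i = b i →
        h i a / chMetric ν i a = h i b / chMetric ν i b := by
      intro i a ha b hb hab
      refine eq_of_hasPd_eq_zero (isOpen_region ν) (convex_region ν)
        (((hs i).div (hgs i) (hg0 i)).differentiableOn one_ne_zero) (i := i) (fun u hu j hij => ?_) ha hb hab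
      have h1 := (hL u hu i j hij).div (hasLogPd_chMetric hu hij)
      rw [hzero u hu i j hij, sub_self] at h1
      have h2 := h1.2.pd_eq
      rw [mul_zero] at h2
      exact h2
    classical
    -- The quotient of `h i` by the metric component is constant on each slice u^i = t, so any point
    -- of the slice may be chosen; the value 0 on empty slices is irrelevant.
    refine ⟨fun i t => if ht : ∃ u ∈ region ν, u i = t then
      h i ht.choose / chMetric ν i ht.choose else 0, fun i u hu => ?_⟩
    have hex : ∃ w ∈ region ν, w i = u i := ⟨u, hu, rfl⟩
    simp only [dif_pos hex]
    rw [hq i _ hex.choose_spec.1 u hu hex.choose_spec.2, div_mul_cancel₀ _ (hg0 i u hu)]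
  · rintro ⟨f, hf⟩
    have hL : ∀ u ∈ region ν, ∀ i j, i ≠ j → HasLogPd j (h i)
        (-gradLogJ ν j u / (2 * (u i - u j) * gradLogJ ν i u) - gradLogJ ν j u) u := by
      intro u hu i j hij
      have hfi : f i (u i) ≠ 0 := fun h1 => h0 i u hu (by rw [hf i u hu, h1, zero_mul])
      have h1 := (hasLogPd_chMetric hu hij).const_mul hfi
      refine ⟨h0 i u hu, ?_⟩
      have h2 := h1.2
      simp only [← hf i u hu] at h2
      -- No regularity of `f i` is needed: along the j-th direction, j ≠ i, its argument does not
      -- move.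
      refine HasDerivAt.congr_of_eventuallyEq h2 ?_
      have hlim : Tendsto (fun s : ℝ => u + s • (Pi.single j 1 : Fin 3 → ℝ)) (𝓝 0) (𝓝 u) := by
        have hcont : Continuous fun s : ℝ => u + s • (Pi.single j 1 : Fin 3 → ℝ) := by fun_prop
        simpa using hcont.tendsto 0
      filter_upwards [hlim.eventually ((isOpen_region ν).mem_nhds hu)] with s hs
      rw [hf i _ hs]
      simp [hij]
    rw [tsarevOn_iff hL]
    intro u hu i j hij
    rw [sub_self, mul_zero]

end

section

variable {ν : ℝ} {u : Fin 3 → ℝ}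

/-! ### The conformally flat metric -/

/-- The quotients `∂_i J / I₀`. -/
def gradRatio (ν : ℝ) (i : Fin 3) (u : Fin 3 → ℝ) : ℝ :=
  gradJ ν i u / moment ν 0 u

theorem gradRatio_ne_zero (hu : u ∈ region ν) (i : Fin 3) : gradRatio ν i u ≠ 0 :=
  div_ne_zero (gradJ_ne_zero hu i) (moment_pos hu 0).ne'

theorem contDiffOn_gradRatio (ν : ℝ) (i : Fin 3) :
    ContDiffOn ℝ (⊤ : ℕ∞) (gradRatio ν i) (region ν) :=
  (contDiffOn_gradJ ν i).div (contDiffOn_moment ν (by norm_num)) fun _ hu => (moment_pos hu 0).ne'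

theorem hasPd_gradRatio (hu : u ∈ region ν) {i j : Fin 3} (hij : i ≠ j) :
    HasPd j (gradRatio ν i) ((gradRatio ν i u - gradRatio ν j u) / (2 * (u i - u j))
      - gradRatio ν i u * (gradRatio ν j u - 1 / 2) / (u j + ν)) u := by
  have h0 := (moment_pos hu 0).ne'
  have hd := region_ne hu hij
  have hv := (region_pos hu j).ne'
  refine ((hasPd_gradJ hu hij).div (hasPd_moment hu 0 j) h0).congr_value ?_
  simp only [gradRatio, momentPd_zero hu]
  field_simp

/-- The product of the shifted branch points. -/
def shiftProd (ν : ℝ) (u : Fin 3 → ℝ) : ℝ :=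
  (u 0 + ν) * (u 1 + ν) * (u 2 + ν)

theorem shiftProd_pos (hu : u ∈ region ν) : 0 < shiftProd ν u :=
  mul_pos (mul_pos (region_pos hu 0) (region_pos hu 1)) (region_pos hu 2)

theorem hasLogPd_shift (hu : u ∈ region ν) (i j : Fin 3) :
    HasLogPd j (fun v => v i + ν) ((if i = j then 1 else 0) / (2 * (u i + ν))) u :=
  (hasPd_shift ν j i u).hasLogPd (region_pos hu i).ne'

theorem hasLogPd_shiftProd (hu : u ∈ region ν) (j : Fin 3) :
    HasLogPd j (shiftProd ν) (1 / (2 * (u j + ν))) u := by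
  refine (((hasLogPd_shift hu 0 j).mul (hasLogPd_shift hu 1 j)).mul
    (hasLogPd_shift hu 2 j)).congr_value ?_
  fin_cases j <;> simp

/-- A flat metric in the conformal class of `g_{ii} / (8 (u^i + ν)³)`. -/
def confMetric (ν : ℝ) (i : Fin 3) (u : Fin 3 → ℝ) : ℝ :=
  -4 * (gap i u * gradRatio ν i u ^ 2) / (8 * (shiftProd ν u * (u i + ν) ^ 3))

theorem confMetric_denom_ne (hu : u ∈ region ν) (i : Fin 3) :
    8 * (shiftProd ν u * (u i + ν) ^ 3) ≠ 0 :=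
  mul_ne_zero (by norm_num) (mul_ne_zero (shiftProd_pos hu).ne' (pow_ne_zero 3 (region_pos hu i).ne'))

theorem confMetric_ne_zero (hu : u ∈ region ν) (i : Fin 3) : confMetric ν i u ≠ 0 :=
  div_ne_zero (mul_ne_zero (by norm_num)
    (mul_ne_zero (gap_ne_zero hu i) (pow_ne_zero 2 (gradRatio_ne_zero hu i))))
    (confMetric_denom_ne hu i)

theorem contDiffOn_confMetric (ν : ℝ) (i : Fin 3) :
    ContDiffOn ℝ (⊤ : ℕ∞) (confMetric ν i) (region ν) := by
  refine (contDiffOn_const.mul ((contDiff_gap i).contDiffOn.mul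
    ((contDiffOn_gradRatio ν i).pow 2))).div ?_ fun u hu => confMetric_denom_ne hu i
  unfold shiftProd
  fun_prop

theorem logPd_confMetric (hu : u ∈ region ν) {i j : Fin 3} (hij : i ≠ j) :
    logPd (confMetric ν) i j u =
      -gradRatio ν j u / (2 * (u i - u j) * gradRatio ν i u) - gradRatio ν j u / (u j + ν) := by
  have ht := gradRatio_ne_zero hu i
  have hd := region_ne hu hij
  have hv := (region_pos hu j).ne'
  have h := (((hasLogPd_gap hu hij).mul (((hasPd_gradRatio hu hij).hasLogPd ht).pow 2)).const_mul
    (c := -4) (by norm_num)).div (((hasLogPd_shiftProd hu j).mul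
      ((hasLogPd_shift hu i j).pow 3)).const_mul (c := 8) (by norm_num))
  rw [HasLogPd.logPd_eq (h := confMetric ν) h, if_neg hij]
  push_cast
  field_simp
  ring

theorem logPd_confMetric_self (hu : u ∈ region ν) {i j k : Fin 3} (hij : i ≠ j) (hik : i ≠ k)
    (hjk : j ≠ k) :
    logPd (confMetric ν) i i u = 1 / (2 * (u i - u j)) + 1 / (2 * (u i - u k))
      + pd i (gradRatio ν i) u / gradRatio ν i u - 2 / (u i + ν) := by
  have ht := gradRatio_ne_zero hu i
  have hv := (region_pos hu i).ne'
  have h := (((hasLogPd_gap_self hu hij hik hjk).mul (((hasPd_of_contDiffOn (i := i) (by simp)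
    (isOpen_region ν) (contDiffOn_gradRatio ν i) hu).hasLogPd ht).pow 2)).const_mul
    (c := -4) (by norm_num)).div (((hasLogPd_shiftProd hu i).mul
      ((hasLogPd_shift hu i i).pow 3)).const_mul (c := 8) (by norm_num))
  rw [HasLogPd.logPd_eq (h := confMetric ν) h, if_pos rfl]
  push_cast
  field_simp
  ring

theorem pd_logPd_confMetric (hu : u ∈ region ν) {i j : Fin 3} (hij : i ≠ j) (k : Fin 3) :
    pd k (logPd (confMetric ν) i j) u =
      (-pd k (gradRatio ν j) u * (2 * (u i - u j) * gradRatio ν i u)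
        + gradRatio ν j u * (2 * ((if i = k then 1 else 0) - (if j = k then 1 else 0))
          * gradRatio ν i u + 2 * (u i - u j) * pd k (gradRatio ν i) u)) /
        (2 * (u i - u j) * gradRatio ν i u) ^ 2
      - (pd k (gradRatio ν j) u * (u j + ν) - gradRatio ν j u * (if j = k then 1 else 0)) /
        (u j + ν) ^ 2 := by
  have ht : ∀ m, HasPd k (gradRatio ν m) (pd k (gradRatio ν m) u) u := fun m =>
    hasPd_of_contDiffOn (by simp) (isOpen_region ν) (contDiffOn_gradRatio ν m) hu
  have h := ((ht j).neg.div (((hasPd_coord_sub k i j u).const_mul 2).mul (ht i))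
    (mul_ne_zero (mul_ne_zero two_ne_zero (region_ne hu hij))
      (gradRatio_ne_zero hu i))).sub ((ht j).div (hasPd_shift ν k j u) (region_pos hu j).ne')
  rw [(HasPd.congr_on (isOpen_region ν) hu (fun v hv => logPd_confMetric hv hij) h).pd_eq]
  ring

/-- As in `curvature_numerator`, the unknown second derivative `xx` cancels; the extra terms in `a`
come from the derivative of I₀ and from the divisor. -/
theorem conformal_numerator {a d e x y xx L M : ℝ} (ha : a ≠ 0) (hd : d ≠ 0) (he : e ≠ 0)
    (hx : x ≠ 0) (hy : y ≠ 0) (hL : L = x / (2 * d * y) - x / a)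
    (hM : M = (xx * y - x * ((x - y) / (2 * d) - y * (x - 1 / 2) / a)) / (2 * d * y ^ 2)
      - x / (2 * d ^ 2 * y) - (xx * a - x) / a ^ 2) :
    M + L ^ 2 - (1 / (2 * d) + 1 / (2 * e) + xx / x - 2 / a) * L =
      x * (x / a ^ 2 - 1 / a ^ 2 + 1 / (2 * d * a) - 1 / (4 * d * y * a)
        - 1 / (2 * d ^ 2 * y) - x / (2 * d * y * a) + 1 / (d * y * a)) - L / (2 * e) := by
  subst hL hM
  field_simp
  ring

/-- The counterpart of `curvature_identity` for J_i / I₀. The common factor 8 times the product of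
the shifted branch points has been divided out. -/
theorem conformal_identity {a b c x y z : ℝ} (ha : a ≠ 0) (hb : b ≠ 0) (hc : c ≠ 0)
    (hx : x ≠ 0) (hy : y ≠ 0) (hz : z ≠ 0) (hab : a - b ≠ 0) (hac : a - c ≠ 0) (hbc : b - c ≠ 0) :
    a ^ 3 * (
        x * (x / a ^ 2 - 1 / a ^ 2 + 1 / (2 * (a - b) * a) - 1 / (4 * (a - b) * y * a)
          - 1 / (2 * (a - b) ^ 2 * y) - x / (2 * (a - b) * y * a) + 1 / ((a - b) * y * a)) -
          (x / (2 * (a - b) * y) - x / a) / (2 * (a - c))) /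
          (4 * ((a - b) * (a - c)) * x ^ 2)
      - b ^ 3 * (
        y * (y / b ^ 2 - 1 / b ^ 2 - 1 / (2 * (a - b) * b) + 1 / (4 * (a - b) * x * b)
          - 1 / (2 * (a - b) ^ 2 * x) + y / (2 * (a - b) * x * b) - 1 / ((a - b) * x * b)) -
          (-y / (2 * (a - b) * x) - y / b) / (2 * (b - c))) /
          (4 * ((a - b) * (b - c)) * y ^ 2)
      + c ^ 3 * (-z / (2 * (a - c) * x) - z / c) *
          (-z / (2 * (b - c) * y) - z / c) / (4 * ((a - c) * (b - c)) * z ^ 2)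
      = 0 := by
  field_simp
  ring

theorem riemann_confMetric (hu : u ∈ region ν) (i j k l : Fin 3) :
    riemann (diag (confMetric ν)) i j k l u = confMetric ν j u * 0
      * ((if i = k ∧ j = l then 1 else 0) - (if i = l ∧ j = k then 1 else 0)) := by
  refine riemann_diag (K := fun i j u => 0) (isOpen_region ν) (contDiffOn_confMetric ν)
    (fun u hu i => confMetric_ne_zero hu i) ?_ ?_ hu i j k l
  · intro u hu i j k hij hik hjk
    rw [pd_logPd_confMetric hu hij, logPd_confMetric hu hij,
      logPd_confMetric hu hik, logPd_confMetric hu hjk,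
      logPd_confMetric hu hjk.symm, (hasPd_gradRatio hu hik).pd_eq,
      (hasPd_gradRatio hu hjk).pd_eq, if_neg hik, if_neg hjk]
    have h1 := region_ne hu hij
    have h2 := region_ne hu hik
    have h3 := region_ne hu hjk
    have t1 := gradRatio_ne_zero hu i
    have t2 := gradRatio_ne_zero hu j
    have t3 := gradRatio_ne_zero hu k
    have v1 := (region_pos hu i).ne'
    have v2 := (region_pos hu j).ne'
    have v3 := (region_pos hu k).ne'
    have e : u j + ν = (u j - u k) + (u k + ν) := by ring
    rw [show u k - u j = -(u j - u k) by ring]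
    field_simp
    ring
  · intro u hu i j hij
    obtain ⟨k, hik, hjk⟩ := exists_third hij
    have h1 := region_ne hu hij
    have h2 := region_ne hu hik
    have h3 := region_ne hu hjk
    have t1 := gradRatio_ne_zero hu i
    have t2 := gradRatio_ne_zero hu j
    have t3 := gradRatio_ne_zero hu k
    have v1 := (region_pos hu i).ne'
    have v2 := (region_pos hu j).ne'
    have v3 := (region_pos hu k).ne'
    have hLji : logPd (confMetric ν) j i u =
        gradRatio ν i u / (2 * (u i - u j) * gradRatio ν j u) - gradRatio ν i u / (u i + ν) := by
      rw [logPd_confMetric hu hij.symm, show u j - u i = -(u i - u j) by ring]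
      field_simp
    have hLij := logPd_confMetric hu hij
    have hNi := conformal_numerator (M := pd i (logPd (confMetric ν) j i) u)
      (xx := pd i (gradRatio ν i) u) v1 h1 h2 t1 t2 hLji (by
        rw [pd_logPd_confMetric hu hij.symm, (hasPd_gradRatio hu hij.symm).pd_eq,
          if_neg hij.symm, if_pos rfl, show u j - u i = -(u i - u j) by ring]
        field_simp
        ring)
    have hNj := conformal_numerator (d := -(u i - u j)) (L := logPd (confMetric ν) i j u)
      (M := pd j (logPd (confMetric ν) i j) u)
      (xx := pd j (gradRatio ν j) u) v2 (neg_ne_zero.2 h1) h3 t2 t1 (by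
        rw [hLij, mul_neg, neg_mul, div_neg, neg_div]) (by
        rw [pd_logPd_confMetric hu hij, (hasPd_gradRatio hu hij).pd_eq,
          if_neg hij, if_pos rfl]
        field_simp
        ring)
    have key := conformal_identity (a := u i + ν) (b := u j + ν) (c := u k + ν) v1 v2 v3 t1 t2 t3
      (by simpa using h1) (by simpa using h2) (by simpa using h3)
    simp only [add_sub_add_right_eq_sub] at key
    rw [sum_eq_of_pairwise_ne hij hik hjk]
    have hLii := logPd_confMetric_self hu hij hik hjk
    have hLjj := logPd_confMetric_self hu hij.symm hjk hik
    rw [show u j - u i = -(u i - u j) by ring] at hLjj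
    -- The divisor depends on all coordinates here; its derivative is already contained in `hLii`,
    -- so no separate correction is made.
    have hA := curvature_term (P' := 0) (confMetric_denom_ne hu i) (gap_ne_zero hu i) t1
      (rfl : confMetric ν i u = _) (hLii.trans (by rw [zero_div, sub_zero])) hNi
    have hB := curvature_term (P' := 0) (confMetric_denom_ne hu j) (gap_ne_zero hu j) t2
      (rfl : confMetric ν j u = _) (hLjj.trans (by rw [zero_div, sub_zero])) hNj
    have hs := (shiftProd_pos hu).ne'
    have hC : logPd (confMetric ν) i k u * logPd (confMetric ν) j k u /
        confMetric ν k u = -(8 * shiftProd ν u * ((u k + ν) ^ 3 *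
          (-gradRatio ν k u / (2 * (u i - u k) * gradRatio ν i u) - gradRatio ν k u / (u k + ν)) *
          (-gradRatio ν k u / (2 * (u j - u k) * gradRatio ν j u) - gradRatio ν k u / (u k + ν)) /
          (4 * ((u i - u k) * (u j - u k)) * gradRatio ν k u ^ 2))) := by
      rw [logPd_confMetric hu hik, logPd_confMetric hu hjk, confMetric,
        gap_eq hik.symm hjk.symm hij, show u k - u i = -(u i - u k) by ring,
        show u k - u j = -(u j - u k) by ring]
      field_simp
    rw [hC]
    rw [gap_eq hij hik hjk, hLji] at hA
    rw [gap_eq hij.symm hjk hik, hLij, show u j - u i = -(u i - u j) by ring] at hB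
    have hB' : ∀ w : ℝ, w / (4 * (-(u i - u j) * (u j - u k)) * gradRatio ν j u ^ 2) =
        -(w / (4 * ((u i - u j) * (u j - u k)) * gradRatio ν j u ^ 2)) := by
      intro w
      rw [← div_neg]
      congr 1
      ring
    rw [hB'] at hB
    rw [hLij, hLji]
    simp only [mul_neg, neg_mul, div_neg] at hB
    clear hNi hNj hC hLii hLjj
    generalize u i - u j = d at *
    generalize u i - u k = e at *
    generalize u j - u k = f at *
    generalize u i + ν = a at *
    generalize u j + ν = b at *
    linear_combination -hA - hB - 8 * shiftProd ν u * key

theorem isFlatOn_confMetric (ν : ℝ) : IsFlatOn (region ν) (diag (confMetric ν)) :=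
  isFlatOn_diag (K := fun _ _ _ => 0) (contDiffOn_confMetric ν)
    (fun _ hu i => confMetric_ne_zero hu i) (fun _ hu => riemann_confMetric hu)
    fun _ _ _ _ => rfl

/-! ### Egorov metrics -/

theorem quadratic_eq_zero {v : Fin 3 → ℝ} (hv : Function.Injective v) {q0 q1 q2 : ℝ}
    (h : ∀ k, q0 + q1 * v k + q2 * v k ^ 2 = 0) : q0 = 0 ∧ q1 = 0 ∧ q2 = 0 := by
  have h01 : v 0 - v 1 ≠ 0 := sub_ne_zero.2 (hv.ne (by decide))
  have h02 : v 0 - v 2 ≠ 0 := sub_ne_zero.2 (hv.ne (by decide))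
  have h12 : v 1 - v 2 ≠ 0 := sub_ne_zero.2 (hv.ne (by decide))
  have e1 : q1 + q2 * (v 0 + v 1) = 0 :=
    (mul_eq_zero.1 (show (v 0 - v 1) * (q1 + q2 * (v 0 + v 1)) = 0 by
      linear_combination h 0 - h 1)).resolve_left h01
  have e2 : q1 + q2 * (v 0 + v 2) = 0 :=
    (mul_eq_zero.1 (show (v 0 - v 2) * (q1 + q2 * (v 0 + v 2)) = 0 by
      linear_combination h 0 - h 2)).resolve_left h02
  have e3 : q2 = 0 :=
    (mul_eq_zero.1 (show (v 1 - v 2) * q2 = 0 by linear_combination e1 - e2)).resolve_left h12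
  subst e3
  have e4 : q1 = 0 := by linarith
  subst e4
  exact ⟨by linarith [h 0], rfl, rfl⟩

variable {p0 p1 p2 p3 : ℝ} {U : Set (Fin 3 → ℝ)}

/-- The Egorov condition is ∂_i h_j = ∂_j h_i. Common factors cancel, and `gradJ_mul` writes 2 gap_i
t_i as v_j v_k A - W with A = I₀ / J and the same W for every i. -/
theorem egorov_relation (hU : IsOpen U) (hUr : U ⊆ region ν)
    (hp : ∀ u ∈ U, ∀ i, p0 + p1 * (u i + ν) + p2 * (u i + ν) ^ 2 + p3 * (u i + ν) ^ 3 ≠ 0)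
    (hE : IsEgorovOn U (quotMetric ν p0 p1 p2 p3)) (hu : u ∈ U) : ∃ A W : ℝ, ∀ i j k,
      i ≠ j → i ≠ k → j ≠ k →
      (p0 + p1 * (u j + ν) + p2 * (u j + ν) ^ 2 + p3 * (u j + ν) ^ 3) *
        ((u i - u k) + (u j + ν) * (u k + ν) * A - W) =
      (p0 + p1 * (u i + ν) + p2 * (u i + ν) ^ 2 + p3 * (u i + ν) ^ 3) *
        ((u j - u k) + (u i + ν) * (u k + ν) * A - W) := by
  have hr := hUr hu
  have hJ := (moment_pos hr 1).ne'
  refine ⟨moment ν 0 u / moment ν 1 u,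
    ((∑ i, (u i + ν)) * moment ν 1 u - 2 * moment ν 2 u) / moment ν 1 u, ?_⟩
  intro i j k hij hik hjk
  have hpi := hp u hu i
  have hpj := hp u hu j
  have h1 := region_ne hr hij
  have h2 := region_ne hr hik
  have h3 := region_ne hr hjk
  have t1 := gradLogJ_ne_zero hr i
  have t2 := gradLogJ_ne_zero hr j
  have hne := quotMetric_ne_zero hUr hp u hu
  have hd : ∀ m n, HasPd n (quotMetric ν p0 p1 p2 p3 m) (pd n (quotMetric ν p0 p1 p2 p3 m) u) u :=
    fun m n => hasPd_of_contDiffOn (by simp) hU (contDiffOn_quotMetric hUr hp m) hu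
  have hpd := pd_eq_of_rotation_eq (hd i j) (hd j i) (hne i) (hne j) (hE u hu i j hij)
  have hl : ∀ m n, m ≠ n → pd n (quotMetric ν p0 p1 p2 p3 m) u = 2 * quotMetric ν p0 p1 p2 p3 m u *
      (-gradLogJ ν n u / (2 * (u m - u n) * gradLogJ ν m u) - gradLogJ ν n u) := by
    intro m n hmn
    have := hne m
    rw [← logPd_quotMetric hr (hp u hu) hmn, logPd]
    field_simp
  rw [hl i j hij, hl j i hij.symm] at hpd
  simp only [quotMetric, baseMetric] at hpd
  generalize p0 + p1 * (u i + ν) + p2 * (u i + ν) ^ 2 + p3 * (u i + ν) ^ 3 = a at *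
  generalize p0 + p1 * (u j + ν) + p2 * (u j + ν) ^ 2 + p3 * (u j + ν) ^ 3 = b at *
  rw [gap_eq hij hik hjk, gap_eq hij.symm hjk hik, show u j - u i = -(u i - u j) by ring] at hpd
  field_simp at hpd
  have e1 : (u j + ν) * (u k + ν) * (moment ν 0 u / moment ν 1 u)
      - ((∑ i, (u i + ν)) * moment ν 1 u - 2 * moment ν 2 u) / moment ν 1 u =
      2 * ((u i - u j) * (u i - u k)) * gradLogJ ν i u := by
    have := gradJ_mul hr hij hik hjk
    rw [gradLogJ]
    field_simp
    linear_combination -this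
  have e2 : (u i + ν) * (u k + ν) * (moment ν 0 u / moment ν 1 u)
      - ((∑ i, (u i + ν)) * moment ν 1 u - 2 * moment ν 2 u) / moment ν 1 u =
      2 * ((u j - u i) * (u j - u k)) * gradLogJ ν j u := by
    have := gradJ_mul hr hij.symm hjk hik
    rw [gradLogJ]
    field_simp
    linear_combination -this
  rw [add_sub_assoc, add_sub_assoc, e1, e2]
  linear_combination -hpd

/-- The two relations of `egorov_relation`, divided by `v i - v j`, are a quadratic equation
for `v k`, with coefficients symmetric in `v`. -/
theorem egorov_coefficients {v : Fin 3 → ℝ} (hv : Function.Injective v) {A W s1 s2 s3 : ℝ}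
    (h1 : s1 = v 0 + v 1 + v 2) (h2 : s2 = v 0 * v 1 + v 0 * v 2 + v 1 * v 2)
    (h3 : s3 = v 0 * v 1 * v 2)
    (h : ∀ i j k, i ≠ j → i ≠ k → j ≠ k →
      (p0 + p1 * v j + p2 * v j ^ 2 + p3 * v j ^ 3) * ((v i - v k) + v j * v k * A - W) =
        (p0 + p1 * v i + p2 * v i ^ 2 + p3 * v i ^ 3) * ((v j - v k) + v i * v k * A - W)) :
    p0 + p1 * W + p2 * (W * s1 - s2) + p3 * (s3 - s1 * s2 + W * (s1 ^ 2 - s2)) = 0 ∧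
    -p0 * A + p1 * (1 - A * s1) + p2 * (2 * s1 - A * (s1 ^ 2 - s2) - W)
      + p3 * (2 * s1 ^ 2 - s2 - A * (s1 ^ 3 - 2 * s1 * s2 + s3) - W * s1) = 0 ∧
    p1 * A + p2 * (A * s1 - 2) + p3 * (A * (s1 ^ 2 - s2) - 2 * s1) = 0 := by
  subst h1 h2 h3
  have key : ∀ i j : Fin 3, i ≠ j → ∀ x : ℝ, (v i - v j) * x = 0 → x = 0 := fun i j hij x hx =>
    (mul_eq_zero.1 hx).resolve_left (sub_ne_zero.2 (hv.ne hij))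
  refine quadratic_eq_zero hv fun k => ?_
  fin_cases k
  · refine key 1 2 (by decide) _ ?_
    have := h 1 2 0 (by decide) (by decide) (by decide)
    simp only [Fin.zero_eta, Fin.isValue]
    linear_combination this
  · refine key 0 2 (by decide) _ ?_
    have := h 0 2 1 (by decide) (by decide) (by decide)
    simp only [Fin.mk_one, Fin.isValue]
    linear_combination this
  · refine key 0 1 (by decide) _ ?_
    have := h 0 1 2 (by decide) (by decide) (by decide)
    simp only [Fin.reduceFinMk, Fin.isValue]
    linear_combination this

/-- With s1, s2, s3 the elementary symmetric functions of the v_i: p = 1 makes the first coefficient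
1. For p = 2v the third forces A = 0, and the second is then nonzero. For p = 4v² elimination of A
and W gives s2 = 0, and for p = 8v³ it gives s2² = s1 s3; both fail for positive v_i. -/
theorem not_isEgorovOn_quotMetric (hU : IsOpen U) (hUr : U ⊆ region ν) (hne : U.Nonempty)
    (hp : (p0, p1, p2, p3) ∈ ({(1, 0, 0, 0), (0, 2, 0, 0), (0, 0, 4, 0), (0, 0, 0, 8)} :
      Set (ℝ × ℝ × ℝ × ℝ))) :
    ¬ IsEgorovOn U (quotMetric ν p0 p1 p2 p3) := by
  intro hE
  obtain ⟨u, hu⟩ := hne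
  have hv := region_pos (hUr hu)
  have hinj : Function.Injective fun i => u i + ν := fun i j hij => by
    by_contra hne
    exact region_ne (hUr hu) hne (by linarith [show u i + ν = u j + ν from hij])
  have h0 := hv 0
  have h1 := hv 1
  have h2 := hv 2
  obtain ⟨A, W, h⟩ := egorov_relation hU hUr (fun u hu i => by
    have := region_pos (hUr hu) i
    simp only [Set.mem_insert_iff, Set.mem_singleton_iff, Prod.mk.injEq] at hp
    rcases hp with ⟨rfl, rfl, rfl, rfl⟩ | ⟨rfl, rfl, rfl, rfl⟩ | ⟨rfl, rfl, rfl, rfl⟩ |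
      ⟨rfl, rfl, rfl, rfl⟩ <;> positivity) hE hu
  obtain ⟨e0, e1, e2⟩ := egorov_coefficients hinj rfl rfl rfl (A := A) (W := W)
    fun i j k hij hik hjk => by
      rw [add_sub_add_right_eq_sub, add_sub_add_right_eq_sub]
      exact h i j k hij hik hjk
  generalize u 0 + ν = a at *
  generalize u 1 + ν = b at *
  generalize u 2 + ν = c at *
  have hs1 : 0 < a + b + c := by positivity
  simp only [Set.mem_insert_iff, Set.mem_singleton_iff, Prod.mk.injEq] at hp
  rcases hp with ⟨rfl, rfl, rfl, rfl⟩ | ⟨rfl, rfl, rfl, rfl⟩ | ⟨rfl, rfl, rfl, rfl⟩ |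
    ⟨rfl, rfl, rfl, rfl⟩
  · linarith
  · have hA : A = 0 := by linarith
    subst hA
    linarith
  · have : a * b + a * c + b * c = 0 := by
      linear_combination (e1 * (a + b + c) + e0 + e2 * ((a + b + c) ^ 2 -
        (a * b + a * c + b * c))) / 4
    nlinarith [mul_pos h0 h1, mul_pos h0 h2, mul_pos h1 h2]
  · have : (a * b + a * c + b * c) ^ 2 - (a + b + c) * (a * b * c) = 0 := by
      linear_combination (e1 * ((a + b + c) ^ 2 - (a * b + a * c + b * c)) + e0 * (a + b + c)
        + e2 * ((a + b + c) ^ 3 - 2 * (a + b + c) * (a * b + a * c + b * c) + a * b * c)) / 8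
    have hpos : 0 < (a * b) ^ 2 + (a * c) ^ 2 + (b * c) ^ 2 + (a + b + c) * (a * b * c) := by
      positivity
    linarith [show (a * b + a * c + b * c) ^ 2 - (a + b + c) * (a * b * c) =
      (a * b) ^ 2 + (a * c) ^ 2 + (b * c) ^ 2 + (a + b + c) * (a * b * c) by ring]

end

/-! ### Specialisation to the metrics of the theorem -/

section

section Congruence

variable {n : ℕ} {U : Set (Fin n → ℝ)}

theorem HasDiagonalCurvatureOn.congr_on {G G' : (Fin n → ℝ) → Matrix (Fin n) (Fin n) ℝ}
    {K K' : Fin n → Fin n → (Fin n → ℝ) → ℝ} (hU : IsOpen U) (hG : ∀ u ∈ U, G u = G' u)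
    (hK : ∀ u ∈ U, ∀ i j, K i j u = K' i j u) (h : HasDiagonalCurvatureOn U G' K') :
    HasDiagonalCurvatureOn U G K :=
  ⟨h.1.congr_on hG, fun u hu i j k l => by
    rw [hK u hu, ← h.2 u hu i j k l, curvature, curvature, hG u hu]
    simp only [riemann_congr_on hU hG hu]⟩

theorem diag_congr {h h' : Fin n → (Fin n → ℝ) → ℝ} {u : Fin n → ℝ} (hh : ∀ i, h i u = h' i u) :
    diag h u = diag h' u :=
  congrArg Matrix.diagonal (funext hh)

theorem IsEgorovOn.congr_on {h h' : Fin n → (Fin n → ℝ) → ℝ} (hU : IsOpen U)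
    (hh : ∀ u ∈ U, ∀ i, h i u = h' i u) (hE : IsEgorovOn U h') : IsEgorovOn U h := by
  have key : ∀ u ∈ U, ∀ i j, rotation h i j u = rotation h' i j u := by
    intro u hu i j
    have hp : pd i (fun v => Complex.sqrt (h j v : ℂ)) u =
        pd i (fun v => Complex.sqrt (h' j v : ℂ)) u :=
      pd_congr_on hU hu fun v hv => by rw [hh v hv j]
    rw [rotation, rotation, hp, hh u hu i]
  intro u hu i j hij
  rw [key u hu, key u hu]
  exact hE u hu i j hij

end Congruence

variable {ν p0 p1 p2 p3 : ℝ} {u : Fin 3 → ℝ} {U : Set (Fin 3 → ℝ)}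

theorem hasDiagonalCurvatureOn_quotMetric (hU : IsOpen U) (hUr : U ⊆ region ν)
    (hp : ∀ u ∈ U, ∀ i, p0 + p1 * (u i + ν) + p2 * (u i + ν) ^ 2 + p3 * (u i + ν) ^ 3 ≠ 0) :
    HasDiagonalCurvatureOn U (diag (quotMetric ν p0 p1 p2 p3)) fun i j u => p2 / 4 + p3 *
      (2 * (u 0 + u 1 + u 2 + 3 * ν) - 1 / gradLogJ ν i u - 1 / gradLogJ ν j u) / 8 :=
  hasDiagonalCurvatureOn_diag (contDiffOn_quotMetric hUr hp) (quotMetric_ne_zero hUr hp)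
    fun _ hu => riemann_quotMetric hU hUr hp hu

theorem isFlatOn_quotMetric (hU : IsOpen U) (hUr : U ⊆ region ν)
    (hp : ∀ u ∈ U, ∀ i, p0 + p1 * (u i + ν) ≠ 0) :
    IsFlatOn U (diag (quotMetric ν p0 p1 0 0)) := by
  have hp' : ∀ u ∈ U, ∀ i, p0 + p1 * (u i + ν) + 0 * (u i + ν) ^ 2 + 0 * (u i + ν) ^ 3 ≠ 0 := by
    simpa using hp
  exact isFlatOn_diag (contDiffOn_quotMetric hUr hp') (quotMetric_ne_zero hUr hp')
    (fun _ hu => riemann_quotMetric hU hUr hp' hu) fun u hu i j => by simp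

theorem chMetric_eq_quotMetric (hu : u ∈ region ν) (i : Fin 3) :
    chMetric ν i u = quotMetric ν 1 0 0 0 i u := by
  simp [quotMetric, chMetric_eq hu]

theorem chMetricTwo_eq_quotMetric (hu : u ∈ region ν) (i : Fin 3) :
    chMetricTwo ν i u = quotMetric ν 0 2 0 0 i u := by
  simp [chMetricTwo, quotMetric, chMetric_eq hu]

theorem chMetricThree_eq_quotMetric (hu : u ∈ region ν) (i : Fin 3) :
    chMetricThree ν i u = quotMetric ν 0 0 4 0 i u := by
  simp [chMetricThree, quotMetric, chMetric_eq hu]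

/-- A change of sign of the metric is absorbed in p, so the curvature formula covers it. -/
theorem neg_chMetricThree_eq_quotMetric (hu : u ∈ region ν) (i : Fin 3) :
    -chMetricThree ν i u = quotMetric ν 0 0 (-4) 0 i u := by
  simp [chMetricThree, quotMetric, chMetric_eq hu, div_neg]

theorem chMetricFour_eq_quotMetric (hu : u ∈ region ν) (i : Fin 3) :
    chMetricFour ν i u = quotMetric ν 0 0 0 8 i u := by
  simp [chMetricFour, quotMetric, chMetric_eq hu]

theorem neg_chMetricFour_eq_quotMetric (hu : u ∈ region ν) (i : Fin 3) :
    -chMetricFour ν i u = quotMetric ν 0 0 0 (-8) i u := by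
  simp [chMetricFour, quotMetric, chMetric_eq hu, div_neg]

theorem isFlatOn_chMetric (ν : ℝ) : IsFlatOn (region ν) (diag (chMetric ν)) :=
  (isFlatOn_quotMetric (isOpen_region ν) subset_rfl fun _ _ _ => by simp).congr_on
    (isOpen_region ν) fun _ hu => diag_congr (chMetric_eq_quotMetric hu)

theorem isFlatOn_chMetricTwo (ν : ℝ) : IsFlatOn (region ν) (diag (chMetricTwo ν)) :=
  (isFlatOn_quotMetric (isOpen_region ν) subset_rfl fun _ hu i => by
    simpa using (region_pos hu i).ne').congr_on
    (isOpen_region ν) fun _ hu => diag_congr (chMetricTwo_eq_quotMetric hu)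

theorem hasConstantCurvatureOn_chMetricThree (ν : ℝ) :
    HasConstantCurvatureOn (region ν) (diag (chMetricThree ν)) 1 :=
  (hasDiagonalCurvatureOn_quotMetric (isOpen_region ν) subset_rfl fun _ hu i => by
    simpa using (region_pos hu i).ne').congr_on (isOpen_region ν)
    (fun _ hu => diag_congr (chMetricThree_eq_quotMetric hu)) fun _ _ _ _ => by norm_num

theorem hasConstantCurvatureOn_neg_chMetricThree (ν : ℝ) :
    HasConstantCurvatureOn (region ν) (diag fun i u => -chMetricThree ν i u) (-1) :=
  (hasDiagonalCurvatureOn_quotMetric (isOpen_region ν) subset_rfl fun _ hu i => by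
    simpa using (region_pos hu i).ne').congr_on (isOpen_region ν)
    (fun _ hu => diag_congr (neg_chMetricThree_eq_quotMetric hu)) fun _ _ _ _ => by norm_num

theorem hasDiagonalCurvatureOn_chMetricFour (ν : ℝ) :
    HasDiagonalCurvatureOn (region ν) (diag (chMetricFour ν))
      fun i j u => speed ν i u + speed ν j u + 2 * ν :=
  (hasDiagonalCurvatureOn_quotMetric (isOpen_region ν) subset_rfl fun _ hu i => by
    simpa using (region_pos hu i).ne').congr_on (isOpen_region ν)
    (fun _ hu => diag_congr (chMetricFour_eq_quotMetric hu)) fun _ hu _ _ => by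
      rw [speed_eq hu, speed_eq hu]
      ring

theorem hasDiagonalCurvatureOn_neg_chMetricFour (ν : ℝ) :
    HasDiagonalCurvatureOn (region ν) (diag fun i u => -chMetricFour ν i u)
      fun i j u => -speed ν i u - speed ν j u - 2 * ν :=
  (hasDiagonalCurvatureOn_quotMetric (isOpen_region ν) subset_rfl fun _ hu i => by
    simpa using (region_pos hu i).ne').congr_on (isOpen_region ν)
    (fun _ hu => diag_congr (neg_chMetricFour_eq_quotMetric hu)) fun _ hu _ _ => by
      rw [speed_eq hu, speed_eq hu]
      ring

/-- The conformal factor replaces J by I₀ in the denominators of the t_i and supplies the product of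
shifted branch points. It is positive on the whole region, so one neighbourhood serves all points.
-/
theorem isConformallyFlatOn_chMetricFour (ν : ℝ) :
    IsConformallyFlatOn (region ν) (diag (chMetricFour ν)) := by
  refine ⟨(hasDiagonalCurvatureOn_chMetricFour ν).1, fun p hp => ⟨region ν, subset_rfl,
    isOpen_region ν, hp, fun u => moment ν 1 u ^ 2 / (moment ν 0 u ^ 2 * shiftProd ν u),
    ?_, ?_, ?_⟩⟩
  · refine ((contDiffOn_moment ν (by norm_num)).pow 2).div
      (((contDiffOn_moment ν (by norm_num)).pow 2).mul ?_) fun u hu =>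
        mul_ne_zero (pow_ne_zero 2 (moment_pos hu 0).ne') (shiftProd_pos hu).ne'
    unfold shiftProd
    fun_prop
  · intro u hu
    have h0 := moment_pos hu 0
    have h1 := moment_pos hu 1
    have hs := shiftProd_pos hu
    positivity
  · refine (isFlatOn_confMetric ν).congr_on (isOpen_region ν) fun u hu => ?_
    rw [diag, diag, ← Matrix.diagonal_smul]
    congr 1
    funext i
    have h0 := (moment_pos hu 0).ne'
    have h1 := (moment_pos hu 1).ne'
    have hs := (shiftProd_pos hu).ne'
    have hv := (region_pos hu i).ne'
    simp only [Pi.smul_apply, smul_eq_mul, chMetricFour, chMetric_eq hu, baseMetric, gradLogJ,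
      confMetric, gradRatio]
    field_simp

/-- The pencil adds contravariant components, (1 + t v_i) / g_ii, so its covariant form is again a
quotient of g_ii by a polynomial, of degree at most 1. -/
theorem contraPencil_eq (hu : u ∈ region ν) (t : ℝ) :
    contraPencil (diag (chMetric ν)) (diag fun i u => chMetric ν i u / (u i + ν)) t u =
      diag (fun i u => (quotMetric ν 1 t 0 0 i u)⁻¹) u := by
  have h0 : ∀ i, chMetric ν i u ≠ 0 := fun i => by
    rw [chMetric_eq hu]
    exact baseMetric_ne_zero hu i
  rw [contraPencil, diag_inv u h0, diag_inv u fun i => div_ne_zero (h0 i) (region_pos hu i).ne',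
    ← Matrix.diagonal_smul, Matrix.diagonal_add]
  refine congrArg Matrix.diagonal (funext fun i => ?_)
  have := h0 i
  rw [chMetric_eq hu] at this
  simp only [Pi.smul_apply, smul_eq_mul, chMetric_eq hu, quotMetric, inv_div]
  field_simp
  ring

theorem isFlatPencilOn_chMetric (ν : ℝ) :
    IsFlatPencilOn (region ν) (diag (chMetric ν))
      (diag fun i u => chMetric ν i u / (u i + ν)) := by
  intro t
  -- The nondegeneracy locus is where no 1 + t v_i vanishes; in this form it is visibly open.
  have hV : {u ∈ region ν | (contraPencil (diag (chMetric ν))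
      (diag fun i u => chMetric ν i u / (u i + ν)) t u).det ≠ 0} =
      region ν ∩ ⋂ i, {u | 1 + t * (u i + ν) ≠ 0} := by
    ext u
    simp only [Set.mem_ofPred_eq, Set.mem_inter_iff, Set.mem_iInter]
    refine and_congr_right fun hu => ?_
    rw [contraPencil_eq hu, diag, Matrix.det_diagonal, Finset.prod_ne_zero_iff]
    simp [quotMetric, baseMetric_ne_zero hu]
  rw [hV]
  have hopen : IsOpen (region ν ∩ ⋂ i, {u : Fin 3 → ℝ | 1 + t * (u i + ν) ≠ 0}) :=
    (isOpen_region ν).inter (isOpen_iInter_of_finite fun i =>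
      isOpen_ne_fun (by fun_prop) continuous_const)
  have hp : ∀ u ∈ region ν ∩ ⋂ i, {u : Fin 3 → ℝ | 1 + t * (u i + ν) ≠ 0}, ∀ i,
      1 + t * (u i + ν) ≠ 0 := fun u hu i => Set.mem_iInter.1 hu.2 i
  refine (isFlatOn_quotMetric hopen Set.inter_subset_left hp).congr_on hopen fun u hu => ?_
  rw [contraPencil_eq hu.1, diag_inv u fun i => inv_ne_zero (div_ne_zero
    (baseMetric_ne_zero hu.1 i) (by simpa using hp u hu i))]
  exact congrArg Matrix.diagonal (funext fun i => inv_inv _)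

end

end CHWhitham

end

theorem mainTheorem3 (ν : ℝ) :
    -- the speeds and the metric components are well defined and smooth, the metric is nondegenerate
    (∀ u ∈ CHWhitham.region ν, ∀ i, CHWhitham.pd i (CHWhitham.waveNumber ν) u ≠ 0) ∧
    (∀ i, ContDiffOn ℝ (⊤ : ℕ∞) (CHWhitham.speed ν i) (CHWhitham.region ν)) ∧
    (∀ u ∈ CHWhitham.region ν, ∀ i,
      (CHWhitham.chMetric ν i u : ℂ) = CHWhitham.metricExpr ν i u) ∧
    CHWhitham.IsMetricOn (CHWhitham.region ν) (CHWhitham.diag (CHWhitham.chMetric ν)) ∧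
    -- Tsarev's relations
    CHWhitham.TsarevOn (CHWhitham.region ν) (CHWhitham.speed ν) (CHWhitham.chMetric ν) ∧
    -- they determine the metric up to factors that depend on `u^i` alone, which are arbitrary
    (∀ h : Fin 3 → (Fin 3 → ℝ) → ℝ,
      (∀ i, ContDiffOn ℝ 1 (h i) (CHWhitham.region ν)) →
      (∀ i, ∀ u ∈ CHWhitham.region ν, h i u ≠ 0) →
      (CHWhitham.TsarevOn (CHWhitham.region ν) (CHWhitham.speed ν) h ↔
        ∃ f : Fin 3 → ℝ → ℝ, ∀ i, ∀ u ∈ CHWhitham.region ν,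
          h i u = f i (u i) * CHWhitham.chMetric ν i u)) ∧
    -- the metrics `g_{ii}` and `g_{ii} / (2 (u^i + ν))` are flat
    CHWhitham.IsFlatOn (CHWhitham.region ν) (CHWhitham.diag (CHWhitham.chMetric ν)) ∧
    CHWhitham.IsFlatOn (CHWhitham.region ν) (CHWhitham.diag (CHWhitham.chMetricTwo ν)) ∧
    -- `g_{ii} / (4 (u^i + ν)²)` has constant curvature: `1`, and `-1` with the opposite sign
    CHWhitham.HasConstantCurvatureOn (CHWhitham.region ν)
      (CHWhitham.diag (CHWhitham.chMetricThree ν)) 1 ∧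
    CHWhitham.HasConstantCurvatureOn (CHWhitham.region ν)
      (CHWhitham.diag (fun i u => -CHWhitham.chMetricThree ν i u)) (-1) ∧
    -- `g_{ii} / (8 (u^i + ν)³)` is conformally flat, with the stated curvature
    CHWhitham.IsConformallyFlatOn (CHWhitham.region ν)
      (CHWhitham.diag (CHWhitham.chMetricFour ν)) ∧
    CHWhitham.HasDiagonalCurvatureOn (CHWhitham.region ν)
      (CHWhitham.diag (CHWhitham.chMetricFour ν))
      (fun i j u => CHWhitham.speed ν i u + CHWhitham.speed ν j u + 2 * ν) ∧
    CHWhitham.HasDiagonalCurvatureOn (CHWhitham.region ν)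
      (CHWhitham.diag (fun i u => -CHWhitham.chMetricFour ν i u))
      (fun i j u => -CHWhitham.speed ν i u - CHWhitham.speed ν j u - 2 * ν) ∧
    -- the pencil is flat
    CHWhitham.IsFlatPencilOn (CHWhitham.region ν) (CHWhitham.diag (CHWhitham.chMetric ν))
      (CHWhitham.diag (fun i u => CHWhitham.chMetric ν i u / (u i + ν))) ∧
    -- none of the four metrics is of Egorov type, on any nonempty open subset
    (∀ U ⊆ CHWhitham.region ν, IsOpen U → U.Nonempty →
      ¬ CHWhitham.IsEgorovOn U (CHWhitham.chMetric ν) ∧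
      ¬ CHWhitham.IsEgorovOn U (CHWhitham.chMetricTwo ν) ∧
      ¬ CHWhitham.IsEgorovOn U (CHWhitham.chMetricThree ν) ∧
      ¬ CHWhitham.IsEgorovOn U (CHWhitham.chMetricFour ν)) := by
  refine ⟨fun u hu => CHWhitham.pd_waveNumber_ne_zero hu, CHWhitham.contDiffOn_speed ν,
    fun u hu i => ?_, (CHWhitham.isFlatOn_chMetric ν).1, CHWhitham.tsarevOn_chMetric ν,
    fun h => CHWhitham.tsarevOn_iff_exists, CHWhitham.isFlatOn_chMetric ν,
    CHWhitham.isFlatOn_chMetricTwo ν, CHWhitham.hasConstantCurvatureOn_chMetricThree ν,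
    CHWhitham.hasConstantCurvatureOn_neg_chMetricThree ν,
    CHWhitham.isConformallyFlatOn_chMetricFour ν,
    CHWhitham.hasDiagonalCurvatureOn_chMetricFour ν,
    CHWhitham.hasDiagonalCurvatureOn_neg_chMetricFour ν,
    CHWhitham.isFlatPencilOn_chMetric ν, fun U hUr hU hne => ⟨?_, ?_, ?_, ?_⟩⟩
  · rw [CHWhitham.metricExpr_eq hu, CHWhitham.chMetric_eq hu]
  · exact fun hE => CHWhitham.not_isEgorovOn_quotMetric hU hUr hne (by simp) (hE.congr_on hU
      fun u hu i => (CHWhitham.chMetric_eq_quotMetric (hUr hu) i).symm)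
  · exact fun hE => CHWhitham.not_isEgorovOn_quotMetric hU hUr hne (by simp) (hE.congr_on hU
      fun u hu i => (CHWhitham.chMetricTwo_eq_quotMetric (hUr hu) i).symm)
  · exact fun hE => CHWhitham.not_isEgorovOn_quotMetric hU hUr hne (by simp) (hE.congr_on hU
      fun u hu i => (CHWhitham.chMetricThree_eq_quotMetric (hUr hu) i).symm)
  · exact fun hE => CHWhitham.not_isEgorovOn_quotMetric hU hUr hne (by simp) (hE.congr_on hU
      fun u hu i => (CHWhitham.chMetricFour_eq_quotMetric (hUr hu) i).symm)
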